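/- **Setting.** There are $m$ identical items and $n$ players ($n,m\ge 0$). A valuation is a non-decreasing function $v:\{0,1,\dots,m\}\to\mathbb{Q}$ with $v(0)=0$. Player $i$ has a finite set $V_i$ of valuations, listed without repetition in a total order as $v_i^{0}\prec v_i^{1}\prec\cdots$. The domain $V_i$ is *single crossing* if for all $t<t'$ and all quantities $s<s'$ $$v_i^{t'}(s')-v_i^{t'}(s)\ \ge\ v_i^{t}(s')-v_i^{t}(s).$$ An allocation is a vector $s=(s_1,\dots,s_n)$ of non-negative integers with $\sum_i s_i\le m$, and its welfare at the profile $t=(t_1,\dots,t_n)$ is $\sum_i v_i^{t_i}(s_i)$. A (direct, deterministic) mechanism consists of a map $f$ from profiles to allocations and of payments $P_i$, which are functions of the profile. It is *incentive-compatible* if $$v_i^{t_i}(f_i(t_i,t_{-i}))-P_i(t_i,t_{-i})\ \ge\ v_i^{t_i}(f_i(t_i',t_{-i}))-P_i(t_i',t_{-i})$$ for all $i$, $t_i$, $t_i'$ and $t_{-i}$. It is a *$(1-\varepsilon)$-approximation* if at every profile the welfare of $f(t)$ is at least $(1-\varepsilon)$ times the welfare of every allocation. Algorithms have access to the domains only through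 *extended value queries*: given $(i,t,s)$, the oracle returns $v_i^t(s)$ (and $0$ if there is no such player, valuation or quantity). Rational numbers are represented by a sign and a reduced fraction in binary, and running time is measured in bit operations, up to a polynomial: each elementary step on data costs the bit length of the data that it reads and writes. Let $b$ be the maximal number of bits of a value $v_i^t(s)$ over all $i$, $t$ and $s$. **Theorem.** There are an algorithm with extended value queries and a polynomial $p$ such that the following holds for every $\varepsilon>0$, all $n$ and $m$, and all finite single-crossing domains $V_1,\dots,V_n$. There is a deterministic incentive-compatible mechanism for $V_1,\dots,V_n$ that is a $(1-\varepsilon)$-approximation to the optimal welfare, and for every profile $(t_1,\dots,t_n)$ the algorithm, on input $\lceil 1/\varepsilon\rceil$, $m$ and $(t_1,\dots,t_n)$, outputs the allocation and the payments of this mechanism in time at most $p(n,1/\varepsilon,\log_2 m,b)$ and with at most $p(n,1/\varepsilon,\log_2 m,b)$ extended value queries (where $\log_2 0$ is read as $0$). -/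

import Mathlib

noncomputable section

namespace MultiUnit

/-! ### A programming language with an oracle and logarithmic (bit) cost

Data are binary trees whose leaves are rational numbers. Every elementary step is charged the bit
length of the data it reads, copies and writes, so that the running time agrees, up to a
polynomial, with the running time of an oracle Turing machine. -/

/-- The number of bits of a rational number, written as a sign and a reduced fraction whose
numerator and denominator are in binary. -/
def bits (q : ℚ) : ℕ := 1 + q.num.natAbs.size + q.den.size

/-- The data that programs work on. -/
inductive Data : Type
  | num : ℚ → Data
  | pair : Data → Data → Data

namespace Data

/-- The number of bits of a datum, with one more symbol for each inner node of the tree. -/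
def size : Data → ℕ
  | num q => bits q
  | pair x y => 1 + x.size + y.size

/-- Lists as data: the empty list is `num 0`, and `x :: l` is the pair of `x` and `l`. -/
def ofList : List Data → Data
  | [] => num 0
  | x :: l => pair x (ofList l)

/-- Truth values as data. -/
def ofBool (b : Bool) : Data := num (if b then 1 else 0)

end Data

/-- The primitive operations. -/
inductive Prim : Type
  | const : ℚ → Prim
  | copy | fst | snd | isPair
  | plus | minus | times | divide | floor | le

/-- The result of a primitive operation. An operation that does not fit its argument, such as the
addition of something that is not a pair of numbers, returns `num 0`; so does division by `0`. -/
def Prim.eval : Prim → Data → Data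
  | .const q, _ => .num q
  | .copy, x => x
  | .fst, .pair x _ => x
  | .snd, .pair _ y => y
  | .isPair, .pair _ _ => Data.ofBool true
  | .plus, .pair (.num a) (.num b) => .num (a + b)
  | .minus, .pair (.num a) (.num b) => .num (a - b)
  | .times, .pair (.num a) (.num b) => .num (a * b)
  | .divide, .pair (.num a) (.num b) => .num (a / b)
  | .floor, .num a => .num ⌊a⌋
  | .le, .pair (.num a) (.num b) => Data.ofBool (decide (a ≤ b))
  | _, _ => .num 0

/-- Programs. Each of them maps an input datum to an output datum. -/
inductive Prog : Type
  /-- Apply a primitive operation to the input. -/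
  | prim : Prim → Prog
  /-- Send the input to the oracle and return its answer. -/
  | query : Prog
  /-- Run the first program, then the second one on the result. -/
  | seq : Prog → Prog → Prog
  /-- Run both programs on the input and return the pair of the results. -/
  | both : Prog → Prog → Prog
  /-- `cond c f g` runs `c` on the input and then runs, on the input, `f` if the test succeeded
  (its result was not `num 0`) and `g` otherwise. -/
  | cond : Prog → Prog → Prog → Prog
  /-- `loop c f` replaces the current datum by its image under `f` as long as the test `c`
  succeeds on it. -/
  | loop : Prog → Prog → Prog

/-- `Runs O P x y T Q`: with oracle `O`, program `P` on input `x` halts with output `y` after time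
`T` and with `Q` oracle queries. -/
inductive Runs (O : Data → Data) : Prog → Data → Data → ℕ → ℕ → Prop
  | prim (p : Prim) (x : Data) :
      Runs O (.prim p) x (p.eval x) (1 + x.size + (p.eval x).size) 0
  | query (x : Data) :
      Runs O .query x (O x) (1 + x.size + (O x).size) 1
  | seq {f g : Prog} {x y z : Data} {T T' Q Q' : ℕ} :
      Runs O f x y T Q → Runs O g y z T' Q' →
      Runs O (.seq f g) x z (1 + T + T') (Q + Q')
  | both {f g : Prog} {x y z : Data} {T T' Q Q' : ℕ} :
      Runs O f x y T Q → Runs O g x z T' Q' →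
      Runs O (.both f g) x (.pair y z) (1 + x.size + T + T') (Q + Q')
  | cond_true {c f g : Prog} {x y z : Data} {T T' Q Q' : ℕ} :
      Runs O c x y T Q → y ≠ .num 0 → Runs O f x z T' Q' →
      Runs O (.cond c f g) x z (1 + x.size + T + T') (Q + Q')
  | cond_false {c f g : Prog} {x z : Data} {T T' Q Q' : ℕ} :
      Runs O c x (.num 0) T Q → Runs O g x z T' Q' →
      Runs O (.cond c f g) x z (1 + x.size + T + T') (Q + Q')
  | loop_stop {c f : Prog} {x : Data} {T Q : ℕ} :
      Runs O c x (.num 0) T Q →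
      Runs O (.loop c f) x x (1 + x.size + T) Q
  | loop_step {c f : Prog} {x y x' z : Data} {T T' T'' Q Q' Q'' : ℕ} :
      Runs O c x y T Q → y ≠ .num 0 → Runs O f x x' T' Q' → Runs O (.loop c f) x' z T'' Q'' →
      Runs O (.loop c f) x z (1 + x.size + T + T' + T'') (Q + Q' + Q'')

/-! ### Multi-unit auctions with finite domains of valuations -/

/-- A finite domain (set) of valuations for `m` identical items. The valuations are listed without
repetition, in the order of the domain; each of them is normalized and non-decreasing. -/
structure Domain (m : ℕ) where
  size : ℕ
  val : Fin size → Fin (m + 1) → ℚ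
  injective : Function.Injective val
  normalized : ∀ t, val t 0 = 0
  monotone : ∀ t, Monotone (val t)

/-- The domain is single crossing with respect to its order and the order of the quantities. -/
def Domain.SingleCrossing {m : ℕ} (V : Domain m) : Prop :=
  ∀ t t' : Fin V.size, t < t' → ∀ s s' : Fin (m + 1), s < s' →
    V.val t s' - V.val t s ≤ V.val t' s' - V.val t' s

/-- An allocation of at most `m` items to `n` players. -/
def Allocation (n m : ℕ) : Type :=
  {s : Fin n → Fin (m + 1) // ∑ i, (s i : ℕ) ≤ m}

/-- A profile of valuations, given by the index of the valuation of each player. -/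
abbrev Profile {n m : ℕ} (V : Fin n → Domain m) : Type :=
  ∀ i, Fin (V i).size

/-- The welfare of an allocation. -/
def welfare {n m : ℕ} (V : Fin n → Domain m) (t : Profile V) (s : Allocation n m) : ℚ :=
  ∑ i, (V i).val (t i) (s.1 i)

/-- A direct deterministic mechanism: a social choice function and payments. -/
structure Mechanism {n m : ℕ} (V : Fin n → Domain m) where
  alloc : Profile V → Allocation n m
  pay : Profile V → Fin n → ℚ

namespace Mechanism

variable {n m : ℕ} {V : Fin n → Domain m}

/-- The profit of player `i` at the reported profile `r` if his valuation has index `t`. -/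
def profit (M : Mechanism V) (i : Fin n) (t : Fin (V i).size) (r : Profile V) : ℚ :=
  (V i).val t ((M.alloc r).1 i) - M.pay r i

/-- Reporting the true valuation is a dominant strategy of every player. -/
def IncentiveCompatible (M : Mechanism V) : Prop :=
  ∀ (i : Fin n) (t : Profile V) (t' : Fin (V i).size),
    M.profit i (t i) (Function.update t i t') ≤ M.profit i (t i) t

/-- The welfare of the outcome is always at least `α` times that of every allocation. -/
def Approximates (M : Mechanism V) (α : ℝ) : Prop :=
  ∀ (t : Profile V) (o : Allocation n m),
    α * (welfare V t o : ℝ) ≤ (welfare V t (M.alloc t) : ℝ)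

end Mechanism

/-! ### Computing a mechanism with extended value queries -/

/-- The value of the `t`-th valuation of player `i` for `s` items, and `0` if there is no such
player, valuation or quantity. Everything is counted from `0`. -/
def extendedValue {n m : ℕ} (V : Fin n → Domain m) (i t s : ℕ) : ℚ :=
  if hi : i < n then
    if ht : t < (V ⟨i, hi⟩).size then
      if hs : s < m + 1 then (V ⟨i, hi⟩).val ⟨t, ht⟩ ⟨s, hs⟩ else 0
    else 0
  else 0

/-- The oracle for extended value queries `(i, (t, s))`. -/
def oracle {n m : ℕ} (V : Fin n → Domain m) : Data → Data
  | .pair (.num i) (.pair (.num t) (.num s)) => .num (extendedValue V ⌊i⌋₊ ⌊t⌋₊ ⌊s⌋₊)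
  | _ => .num 0

/-- The largest number of bits of a value in the domains of the players. -/
def maxBits {n m : ℕ} (V : Fin n → Domain m) : ℕ :=
  Finset.univ.sup fun i => Finset.univ.sup fun t => Finset.univ.sup fun s =>
    bits ((V i).val t s)

/-- The input of the algorithm: the accuracy parameter `a`, which stands for `ε = 1 / a`, the number
of items, and the list of the indices of the valuations of the players. -/
def input {n m : ℕ} {V : Fin n → Domain m} (a : ℕ) (t : Profile V) : Data :=
  .pair (.num a) (.pair (.num m) (Data.ofList (List.ofFn fun i => .num ((t i : ℕ) : ℚ))))

/-- The output of the algorithm: the list of the pairs (number of items, payment) of the players. -/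
def output {n m : ℕ} {V : Fin n → Domain m} (M : Mechanism V) (t : Profile V) : Data :=
  Data.ofList (List.ofFn fun i =>
    .pair (.num (((M.alloc t).1 i : ℕ) : ℚ)) (.num (M.pay t i)))

end MultiUnit

end

/-! On a single-crossing domain, a rule that gives a player a non-decreasing quantity as the
player's type rises is made incentive-compatible by payments that telescope along the types
(`payment_ic`). What is needed is therefore a monotone approximation computable in polynomial time,
together with a way to evaluate the payments although the types may be exponentially many.

Values of the whole bundle are cut into geometric levels `x l`, which depend on the domains and not
on the reports; `lev i t` counts the levels reached. A type is replaced by the first type in its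
level. The resulting valuation telescopes over the levels into increments `inc`, non-decreasing in
the quantity by single crossing, and each increment is rounded down to multiples of `del l`. This
yields a step function with polynomially many jumps, and the jumps of a lower type form an initial
part of those of a higher type (`pt_congr`). Raising a type thus only raises marginal values.

An exact dynamic program over objective values needs small integers, hence a unit `eta K`
proportional to the highest level `K` reached in the profile. A report that changes `K` changes the
unit, and the rounding errors could destroy monotonicity. Therefore each jump carries a bonus `gam
L` that grows with the number `L` of levels of the player. Whoever raises `K` stands on the top
level, and the growth of the bonus at a single jump exceeds all rounding errors in both units
(`error_lt_gap`). If `K` stays the same, ties are broken by the least `code`, which does not depend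
on types. This gives `IsOpt.mono`. Approximation (`IsOpt.approx`) holds because each player
contributes an error of order `1/q` of the top level, which is itself a lower bound for the optimum.
`alloc_isOpt` shows that the dynamic program finds the tie-broken optimum.

As a player's type varies, the outcome takes only polynomially many values, and by monotonicity
binary search finds the types at which it changes; the payment is a sum over these changes
(`payment_eq_sum`). Type indices have polynomially many bits by `size_type_le`.

The running time is handled by a calculus: `Comp ρ e f` says that one program computes `f` from `e`
for a whole family of instances in polynomial time. It is closed under arithmetic, branching,
bounded loops, tables and search, so that `comp_mech` follows the definitions of the mechanism. -/

noncomputable section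

namespace MultiUnit

/-! ### Bit lengths -/

theorem natSize_mul_le (a b : ℕ) : (a * b).size ≤ a.size + b.size := by
  rw [Nat.size_le, pow_add]
  exact Nat.mul_lt_mul'' (Nat.lt_size_self a) (Nat.lt_size_self b)

theorem natSize_add_le (a b : ℕ) : (a + b).size ≤ max a.size b.size + 1 := by
  rw [Nat.size_le, pow_succ]
  have h1 := (Nat.lt_size_self a).trans_le (Nat.pow_le_pow_right (n := 2) (by norm_num)
    (le_max_left a.size b.size))
  have h2 := (Nat.lt_size_self b).trans_le (Nat.pow_le_pow_right (n := 2) (by norm_num)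
    (le_max_right a.size b.size))
  omega

theorem natSize_le_self (a : ℕ) : a.size ≤ a := by
  rw [Nat.size_le]; exact Nat.lt_two_pow_self

theorem bits_natCast (k : ℕ) : bits (k : ℚ) = k.size + 2 := by
  simp [bits]; ring

theorem one_le_bits (a : ℚ) : 1 ≤ bits a := by unfold bits; omega

/-- Reduction to lowest terms shrinks numerator and denominator, so every representation as a
fraction bounds the bit length. -/
theorem bits_le_of_eq_div {q : ℚ} {a : ℤ} {d : ℕ} (hd : d ≠ 0) (h : q = a / d) :
    bits q ≤ 1 + a.natAbs.size + d.size := by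
  have hq : q = Rat.divInt a (d : ℤ) := by rw [Rat.divInt_eq_div]; exact_mod_cast h
  have h2 : q.den ≤ d := by
    rw [hq]
    exact Nat.le_of_dvd (Nat.pos_of_ne_zero hd) (by exact_mod_cast Rat.den_dvd a d)
  have h1 : q.num.natAbs ≤ a.natAbs := by
    by_cases ha : a = 0
    · subst ha; simp [h]
    · have : q.num ∣ a := by rw [hq]; exact Rat.num_dvd a (by exact_mod_cast hd)
      exact Nat.le_of_dvd (by omega) (Int.natAbs_dvd_natAbs.mpr this)
  unfold bits
  have := Nat.size_le_size h1
  have := Nat.size_le_size h2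
  omega

theorem bits_neg (a : ℚ) : bits (-a) = bits a := by simp [bits]

theorem bits_add_le (a b : ℚ) : bits (a + b) ≤ 2 * (bits a + bits b) := by
  have ha := a.den_ne_zero
  have hb := b.den_ne_zero
  have h := bits_le_of_eq_div (q := a + b) (a := a.num * b.den + b.num * a.den)
    (d := a.den * b.den) (mul_ne_zero ha hb) (by
      have ha' : (a.den : ℚ) ≠ 0 := by exact_mod_cast ha
      have hb' : (b.den : ℚ) ≠ 0 := by exact_mod_cast hb
      conv_lhs => rw [← Rat.num_div_den a, ← Rat.num_div_den b]
      push_cast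
      field_simp)
  have h1 : (a.num * b.den + b.num * a.den).natAbs ≤
      a.num.natAbs * b.den + b.num.natAbs * a.den := by
    refine (Int.natAbs_add_le _ _).trans ?_
    simp [Int.natAbs_mul]
  have h2 := Nat.size_le_size h1
  have h3 := natSize_add_le (a.num.natAbs * b.den) (b.num.natAbs * a.den)
  have h4 := natSize_mul_le a.num.natAbs b.den
  have h5 := natSize_mul_le b.num.natAbs a.den
  have h6 := natSize_mul_le a.den b.den
  unfold bits at *
  omega

theorem bits_sub_le (a b : ℚ) : bits (a - b) ≤ 2 * (bits a + bits b) := by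
  rw [sub_eq_add_neg, ← bits_neg b]; exact bits_add_le a (-b)

theorem bits_mul_le (a b : ℚ) : bits (a * b) ≤ bits a + bits b := by
  have ha := a.den_ne_zero
  have hb := b.den_ne_zero
  have h := bits_le_of_eq_div (q := a * b) (a := a.num * b.num)
    (d := a.den * b.den) (mul_ne_zero ha hb) (by
      conv_lhs => rw [← Rat.num_div_den a, ← Rat.num_div_den b]
      push_cast
      field_simp)
  have h4 := natSize_mul_le a.num.natAbs b.num.natAbs
  have h6 := natSize_mul_le a.den b.den
  rw [Int.natAbs_mul] at h
  unfold bits at *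
  omega

theorem bits_inv_le (a : ℚ) : bits a⁻¹ ≤ bits a := by
  by_cases h : a = 0
  · simp [h]
  unfold bits
  have : a.num ≠ 0 := by simpa using h
  rw [Rat.num_inv, Rat.den_inv, Int.natAbs_mul]
  simp [Int.natAbs_sign_of_ne_zero this, this]
  omega

theorem bits_div_le (a b : ℚ) : bits (a / b) ≤ bits a + bits b := by
  rw [div_eq_mul_inv]
  exact (bits_mul_le _ _).trans (by have := bits_inv_le b; omega)

theorem bits_floor_le (a : ℚ) : bits (⌊a⌋ : ℚ) ≤ bits a + 2 := by
  have h1 : (⌊a⌋).natAbs ≤ a.num.natAbs + 1 := by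
    have h2 : |a| ≤ (a.num.natAbs : ℚ) := by
      conv_lhs => rw [← Rat.num_div_den a]
      rw [abs_div, Nat.abs_cast, Nat.cast_natAbs, Int.cast_abs]
      exact div_le_self (abs_nonneg _) (by exact_mod_cast a.den_pos)
    have h3 : |(⌊a⌋ : ℚ)| ≤ (a.num.natAbs : ℚ) + 1 := by
      have := Int.floor_le a
      have := Int.lt_floor_add_one a
      have := abs_le.mp h2
      rw [abs_le]; constructor <;> linarith
    rw [← Int.cast_abs, ← Nat.cast_natAbs] at h3
    exact_mod_cast h3
  have h2 := Nat.size_le_size h1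
  have h3 := natSize_add_le a.num.natAbs 1
  have h4 : 1 ≤ a.den.size := Nat.size_pos.mpr a.den_pos
  have : bits (⌊a⌋ : ℚ) = 1 + (⌊a⌋).natAbs.size + 1 := by simp [bits]
  rw [this]
  have h5 : Nat.size 1 = 1 := Nat.size_one
  unfold bits
  rcases le_total a.num.natAbs.size 1 with h | h
  · rw [h5, max_eq_right h] at h3; omega
  · rw [h5, max_eq_left h] at h3; omega

theorem Data.one_le_size (x : Data) : 1 ≤ x.size := by
  cases x <;> simp [Data.size, bits] <;> omega

theorem Data.size_ofBool_le (b : Bool) : (Data.ofBool b).size ≤ 3 := by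
  cases b <;> simp [Data.ofBool, Data.size, bits]

/-- One application grows data at most linearly. Iterated applications could grow them
exponentially, which is why loops ask separately for a size bound on their states. -/
theorem Prim.size_eval_le (p : Prim) : ∃ C : ℕ, ∀ x, (p.eval x).size ≤ C * x.size := by
  have h0 : ∀ x : Data, (Data.num 0).size ≤ 3 * x.size := fun x => by
    have := x.one_le_size; simp [Data.size, bits]; omega
  have kb : ∀ (b : Bool) (x : Data), (Data.ofBool b).size ≤ 3 * x.size := fun b x => by
    have := Data.size_ofBool_le b; have := x.one_le_size; omega
  have hb := one_le_bits
  cases p with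
  | const q => exact ⟨bits q, fun x => Nat.le_mul_of_pos_right (bits q) x.one_le_size⟩
  | copy => exact ⟨1, fun x => (one_mul x.size).ge⟩
  | fst =>
    refine ⟨3, fun x => ?_⟩
    rcases x with a | ⟨x, y⟩
    · exact h0 _
    · simp only [Prim.eval, Data.size]; omega
  | snd =>
    refine ⟨3, fun x => ?_⟩
    rcases x with a | ⟨x, y⟩
    · exact h0 _
    · simp only [Prim.eval, Data.size]; omega
  | isPair =>
    refine ⟨3, fun x => ?_⟩
    rcases x with a | ⟨x, y⟩
    · exact h0 _
    · exact kb _ _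
  | plus =>
    refine ⟨3, fun x => ?_⟩
    rcases x with a | ⟨a | ⟨x, y⟩, b | ⟨z, w⟩⟩ <;> try exact h0 _
    have := bits_add_le a b
    simp only [Prim.eval, Data.size]; omega
  | minus =>
    refine ⟨3, fun x => ?_⟩
    rcases x with a | ⟨a | ⟨x, y⟩, b | ⟨z, w⟩⟩ <;> try exact h0 _
    have := bits_sub_le a b
    simp only [Prim.eval, Data.size]; omega
  | times =>
    refine ⟨3, fun x => ?_⟩
    rcases x with a | ⟨a | ⟨x, y⟩, b | ⟨z, w⟩⟩ <;> try exact h0 _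
    have := bits_mul_le a b
    simp only [Prim.eval, Data.size]; omega
  | divide =>
    refine ⟨3, fun x => ?_⟩
    rcases x with a | ⟨a | ⟨x, y⟩, b | ⟨z, w⟩⟩ <;> try exact h0 _
    have := bits_div_le a b
    simp only [Prim.eval, Data.size]; omega
  | floor =>
    refine ⟨3, fun x => ?_⟩
    rcases x with a | ⟨x, y⟩
    · have := bits_floor_le a
      have := hb a
      simp only [Prim.eval, Data.size]; omega
    · exact h0 _
  | le =>
    refine ⟨3, fun x => ?_⟩
    rcases x with a | ⟨a | ⟨x, y⟩, b | ⟨z, w⟩⟩ <;> try exact h0 _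
    exact kb _ _

/-- Every rule charges for what it reads and writes and at least one unit per query, so only the
time has to be bounded in what follows. -/
theorem Runs.size_le {O : Data → Data} {P : Prog} {x y : Data} {T Q : ℕ}
    (h : Runs O P x y T Q) : x.size ≤ T ∧ y.size ≤ T ∧ Q ≤ T := by
  induction h <;> (try simp only [Data.size]) <;> omega

/-! ### Instances and polynomially bounded quantities -/

/-- An instance of the problem: an accuracy parameter and single-crossing domains. -/
structure Inst where
  n : ℕ
  m : ℕ
  a : ℕ
  V : Fin n → Domain m
  singleCrossing : ∀ i, (V i).SingleCrossing

/-- The size parameter of an instance. -/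
def Inst.N (I : Inst) : ℕ := I.n + I.a + I.m.size + maxBits I.V

variable {ι κ : Type} {ρ : ι → Inst} {e : ι → Data}

/-- A family of numbers is bounded by a polynomial in the size parameter. -/
def PB (ρ : ι → Inst) (g : ι → ℕ) : Prop := ∃ k, ∀ c, g c ≤ ((ρ c).N + 2) ^ k

namespace PB

variable {g h : ι → ℕ}

theorem mono (hg : PB ρ g) (hh : ∀ c, h c ≤ g c) : PB ρ h := by
  obtain ⟨k, hk⟩ := hg; exact ⟨k, fun c => (hh c).trans (hk c)⟩

/-- The base is at least 2, so that an exponent absorbs constants and sums. -/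
theorem const (ρ : ι → Inst) (C : ℕ) : PB ρ (fun _ => C) :=
  ⟨C, fun c => Nat.lt_two_pow_self.le.trans (Nat.pow_le_pow_left (by omega) C)⟩

theorem add (hg : PB ρ g) (hh : PB ρ h) : PB ρ (fun c => g c + h c) := by
  obtain ⟨k, hk⟩ := hg
  obtain ⟨l, hl⟩ := hh
  refine ⟨k + l + 1, fun c => ?_⟩
  have h2 : 2 ≤ (ρ c).N + 2 := by omega
  have h1 : ∀ j, 0 < ((ρ c).N + 2) ^ j := fun j => Nat.pow_pos (by omega)
  have h3 := Nat.pow_le_pow_right (n := (ρ c).N + 2) (by omega) (Nat.le_add_right k l)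
  have h4 := Nat.pow_le_pow_right (n := (ρ c).N + 2) (by omega) (Nat.le_add_left l k)
  have := hk c
  have := hl c
  rw [pow_succ]
  nlinarith

theorem mul (hg : PB ρ g) (hh : PB ρ h) : PB ρ (fun c => g c * h c) := by
  obtain ⟨k, hk⟩ := hg
  obtain ⟨l, hl⟩ := hh
  exact ⟨k + l, fun c => by rw [pow_add]; exact Nat.mul_le_mul (hk c) (hl c)⟩

theorem pow (hg : PB ρ g) (j : ℕ) : PB ρ (fun c => g c ^ j) := by
  obtain ⟨k, hk⟩ := hg
  exact ⟨k * j, fun c => by rw [pow_mul]; exact Nat.pow_le_pow_left (hk c) j⟩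

theorem param (ρ : ι → Inst) : PB ρ (fun c => (ρ c).N) := ⟨1, fun c => by simp⟩

theorem comap (hg : PB ρ g) (r : κ → ι) : PB (fun c => ρ (r c)) (fun c => g (r c)) := by
  obtain ⟨k, hk⟩ := hg; exact ⟨k, fun c => hk _⟩

theorem sum {s : ι → ℕ} {f : ι → ℕ → ℕ} (hs : PB ρ s) (hg : PB ρ g)
    (hf : ∀ c, ∀ k < s c, f c k ≤ g c) : PB ρ (fun c => ∑ k ∈ Finset.range (s c), f c k) :=
  (hs.mul hg).mono fun c => by
    simpa using Finset.sum_le_card_nsmul (Finset.range (s c)) (f c) (g c)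
      (fun k hk => hf c k (Finset.mem_range.mp hk))

end PB

/-- A family of data has polynomially bounded size. -/
def Small (ρ : ι → Inst) (e : ι → Data) : Prop := PB ρ (fun c => (e c).size)

theorem Small.pair {f g : ι → Data} (hf : Small ρ f) (hg : Small ρ g) :
    Small ρ (fun c => .pair (f c) (g c)) :=
  ((PB.const ρ 1).add hf).add hg

theorem Small.comap {f : ι → Data} (hf : Small ρ f) (r : κ → ι) :
    Small (fun c => ρ (r c)) (fun c => f (r c)) := PB.comap hf r

theorem Small.natCast {g : ι → ℕ} (h : PB ρ (fun c => (g c).size)) :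
    Small ρ (fun c => .num (g c)) :=
  (h.add (PB.const ρ 2)).mono fun c => by simp [Data.size, bits_natCast]

theorem PB.natSize {g : ι → ℕ} (h : PB ρ g) : PB ρ (fun c => (g c).size) :=
  h.mono fun _ => natSize_le_self _

theorem Small.natCast' {g : ι → ℕ} (h : PB ρ g) : Small ρ (fun c => .num (g c)) :=
  Small.natCast h.natSize

theorem Small.natCast_le {g h : ι → ℕ} (hh : Small ρ (fun c => .num (h c)))
    (hg : ∀ c, g c ≤ h c) : Small ρ (fun c => .num (g c)) :=
  hh.mono fun c => by
    simp only [Data.size, bits_natCast]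
    have := Nat.size_le_size (hg c)
    omega

/-! ### Uniform computability in polynomial time -/

/-- A single program computes `f c` from `e c`, for every `c`, in polynomial time. -/
def Comp (ρ : ι → Inst) (e f : ι → Data) : Prop :=
  ∃ (P : Prog) (k : ℕ), ∀ c, ∃ T Q, Runs (oracle (ρ c).V) P (e c) (f c) T Q ∧
    T ≤ ((ρ c).N + 2) ^ k

theorem Comp.of_bound {f : ι → Data} (P : Prog) (g : ι → ℕ) (hg : PB ρ g)
    (h : ∀ c, ∃ T Q, Runs (oracle (ρ c).V) P (e c) (f c) T Q ∧ T ≤ g c) : Comp ρ e f := by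
  obtain ⟨k, hk⟩ := hg
  refine ⟨P, k, fun c => ?_⟩
  obtain ⟨T, Q, hr, hT⟩ := h c
  exact ⟨T, Q, hr, hT.trans (hk c)⟩

namespace Comp

variable {f g h : ι → Data}

theorem comap (hf : Comp ρ e f) (r : κ → ι) :
    Comp (fun c => ρ (r c)) (fun c => e (r c)) (fun c => f (r c)) := by
  obtain ⟨P, k, h⟩ := hf; exact ⟨P, k, fun c => h _⟩

theorem small_left (hf : Comp ρ e f) : Small ρ e := by
  obtain ⟨P, k, h⟩ := hf
  exact ⟨k, fun c => by obtain ⟨T, Q, hr, hT⟩ := h c; exact hr.size_le.1.trans hT⟩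

theorem small (hf : Comp ρ e f) : Small ρ f := by
  obtain ⟨P, k, h⟩ := hf
  exact ⟨k, fun c => by obtain ⟨T, Q, hr, hT⟩ := h c; exact hr.size_le.2.1.trans hT⟩

theorem trans (hf : Comp ρ e f) (hg : Comp ρ f g) : Comp ρ e g := by
  obtain ⟨P, k, hP⟩ := hf
  obtain ⟨R, l, hR⟩ := hg
  refine of_bound (.seq P R) (fun c => 1 + ((ρ c).N + 2) ^ k + ((ρ c).N + 2) ^ l)
    (((PB.const ρ 1).add ⟨k, fun c => le_rfl⟩).add ⟨l, fun c => le_rfl⟩) fun c => ?_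
  obtain ⟨T, Q, h1, h2⟩ := hP c
  obtain ⟨T', Q', h3, h4⟩ := hR c
  exact ⟨_, _, .seq h1 h3, by omega⟩

theorem pair (hf : Comp ρ e f) (hg : Comp ρ e g) : Comp ρ e (fun c => .pair (f c) (g c)) := by
  have hs := hf.small_left
  obtain ⟨P, k, hP⟩ := hf
  obtain ⟨R, l, hR⟩ := hg
  refine of_bound (.both P R) (fun c => 1 + (e c).size + ((ρ c).N + 2) ^ k + ((ρ c).N + 2) ^ l)
    ((((PB.const ρ 1).add hs).add ⟨k, fun c => le_rfl⟩).add ⟨l, fun c => le_rfl⟩) fun c => ?_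
  obtain ⟨T, Q, h1, h2⟩ := hP c
  obtain ⟨T', Q', h3, h4⟩ := hR c
  exact ⟨_, _, .both h1 h3, by omega⟩

theorem prim (p : Prim) (hs : Small ρ e) : Comp ρ e (fun c => p.eval (e c)) := by
  obtain ⟨C, hC⟩ := p.size_eval_le
  exact of_bound (.prim p) (fun c => 1 + (e c).size + C * (e c).size)
    (((PB.const ρ 1).add hs).add ((PB.const ρ C).mul hs)) fun c =>
      ⟨_, _, .prim p _, by have := hC (e c); omega⟩

theorem app (p : Prim) (hf : Comp ρ e f) : Comp ρ e (fun c => p.eval (f c)) :=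
  hf.trans (prim p hf.small)

theorem refl (hs : Small ρ e) : Comp ρ e e := prim .copy hs

theorem num (q : ℚ) (hs : Small ρ e) : Comp ρ e (fun _ => .num q) := prim (.const q) hs

theorem fst (hf : Comp ρ e (fun c => .pair (f c) (g c))) : Comp ρ e f := app .fst hf

theorem snd (hf : Comp ρ e (fun c => .pair (f c) (g c))) : Comp ρ e g := app .snd hf

theorem add {a b : ι → ℚ} (ha : Comp ρ e (fun c => .num (a c)))
    (hb : Comp ρ e (fun c => .num (b c))) : Comp ρ e (fun c => .num (a c + b c)) :=
  app .plus (ha.pair hb)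

theorem sub {a b : ι → ℚ} (ha : Comp ρ e (fun c => .num (a c)))
    (hb : Comp ρ e (fun c => .num (b c))) : Comp ρ e (fun c => .num (a c - b c)) :=
  app .minus (ha.pair hb)

theorem mul {a b : ι → ℚ} (ha : Comp ρ e (fun c => .num (a c)))
    (hb : Comp ρ e (fun c => .num (b c))) : Comp ρ e (fun c => .num (a c * b c)) :=
  app .times (ha.pair hb)

theorem div {a b : ι → ℚ} (ha : Comp ρ e (fun c => .num (a c)))
    (hb : Comp ρ e (fun c => .num (b c))) : Comp ρ e (fun c => .num (a c / b c)) :=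
  app .divide (ha.pair hb)

theorem floor {a : ι → ℚ} (ha : Comp ρ e (fun c => .num (a c))) :
    Comp ρ e (fun c => .num (⌊a c⌋ : ℚ)) :=
  app .floor ha

theorem le {a b : ι → ℚ} (ha : Comp ρ e (fun c => .num (a c)))
    (hb : Comp ρ e (fun c => .num (b c))) :
    Comp ρ e (fun c => Data.ofBool (decide (a c ≤ b c))) :=
  app .le (ha.pair hb)

theorem congr (hf : Comp ρ e f) (hfg : ∀ c, f c = g c) : Comp ρ e g := by
  rwa [show g = f from (funext hfg).symm]

theorem num_congr {a b : ι → ℚ} (hf : Comp ρ e (fun c => .num (a c))) (hab : ∀ c, a c = b c) :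
    Comp ρ e (fun c => .num (b c)) :=
  hf.congr fun c => by rw [hab c]

theorem query (hs : Small ρ e) (hs' : Small ρ (fun c => oracle (ρ c).V (e c))) :
    Comp ρ e (fun c => oracle (ρ c).V (e c)) :=
  of_bound .query _ (((PB.const ρ 1).add hs).add hs') fun _ => ⟨_, _, .query _, le_rfl⟩

theorem ofBool_false : Data.ofBool false = .num 0 := by simp [Data.ofBool]

theorem ofBool_true_ne : Data.ofBool true ≠ .num 0 := by simp [Data.ofBool]

/-- Each branch has to be correct only on the subfamily that reaches it, so its side conditions may
use the outcome of the test. -/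
theorem cond {b : ι → Bool} (hb : Comp ρ e (fun c => Data.ofBool (b c)))
    (hf : Comp (fun c : {c // b c = true} => ρ c) (fun c => e c) (fun c => f c))
    (hg : Comp (fun c : {c // b c = false} => ρ c) (fun c => e c) (fun c => g c)) :
    Comp ρ e (fun c => if b c then f c else g c) := by
  have hs := hb.small_left
  obtain ⟨C, j, hC⟩ := hb
  obtain ⟨P, k, hP⟩ := hf
  obtain ⟨R, l, hR⟩ := hg
  refine of_bound (.cond C P R) (fun c => 1 + (e c).size + ((ρ c).N + 2) ^ j +
    ((ρ c).N + 2) ^ k + ((ρ c).N + 2) ^ l)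
    (((((PB.const ρ 1).add hs).add ⟨j, fun _ => le_rfl⟩).add ⟨k, fun _ => le_rfl⟩).add
      ⟨l, fun c => le_rfl⟩) fun c => ?_
  obtain ⟨T, Q, h1, h2⟩ := hC c
  simp only at h1
  cases hc : b c with
  | true =>
    obtain ⟨T', Q', h3, h4⟩ := hP ⟨c, hc⟩
    rw [hc] at h1
    exact ⟨_, _, .cond_true h1 ofBool_true_ne (by simpa using h3), by simp only at h4; omega⟩
  | false =>
    obtain ⟨T', Q', h3, h4⟩ := hR ⟨c, hc⟩
    rw [hc, ofBool_false] at h1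
    exact ⟨_, _, .cond_false h1 (by simpa using h3), by simp only at h4; omega⟩

theorem ite {p : ι → Prop} [∀ c, Decidable (p c)]
    (hb : Comp ρ e (fun c => Data.ofBool (decide (p c))))
    (hf : Comp ρ e f) (hg : Comp ρ e g) : Comp ρ e (fun c => if p c then f c else g c) := by
  simpa using cond hb (hf.comap _) (hg.comap _)

theorem num_ite {p : ι → Prop} [∀ c, Decidable (p c)] {a b : ι → ℚ}
    (hb : Comp ρ e (fun c => Data.ofBool (decide (p c))))
    (hf : Comp ρ e (fun c => .num (a c))) (hg : Comp ρ e (fun c => .num (b c))) :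
    Comp ρ e (fun c => .num (if p c then a c else b c)) :=
  (ite hb hf hg).congr fun c => by split_ifs <;> rfl

theorem not {p : ι → Prop} [∀ c, Decidable (p c)]
    (hb : Comp ρ e (fun c => Data.ofBool (decide (p c)))) :
    Comp ρ e (fun c => Data.ofBool (decide (¬ p c))) :=
  (ite hb (num 0 hb.small_left) (num 1 hb.small_left)).congr fun c => by
    by_cases h : p c <;> simp [h, Data.ofBool]

theorem bool_congr {p r : ι → Prop} [∀ c, Decidable (p c)] [∀ c, Decidable (r c)]
    (hb : Comp ρ e (fun c => Data.ofBool (decide (p c)))) (h : ∀ c, p c ↔ r c) :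
    Comp ρ e (fun c => Data.ofBool (decide (r c))) :=
  hb.congr fun c => by simp [h c]

theorem lt {a b : ι → ℚ} (ha : Comp ρ e (fun c => .num (a c)))
    (hb : Comp ρ e (fun c => .num (b c))) :
    Comp ρ e (fun c => Data.ofBool (decide (a c < b c))) :=
  (hb.le ha).not.bool_congr fun c => by simp

end Comp

/-! ### Loops -/

/-- Iteration numbers below `cnt c`. -/
structure Ix (cnt : ι → ℕ) where
  c : ι
  k : ℕ
  lt : k < cnt c

/-- The sequence of states is prescribed in advance. The program need not compute `cnt`; it only has
to recognize from the state whether it is finished. The time is the number of rounds times a uniform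
polynomial bound for one round. -/
theorem Comp.loop {cnt : ι → ℕ} {st : ι → ℕ → Data} (hcnt : PB ρ cnt)
    (htest : Comp (fun x : Ix (fun c => cnt c + 1) => ρ x.c) (fun x => st x.c x.k)
      (fun x => Data.ofBool (decide (x.k < cnt x.c))))
    (hbody : Comp (fun x : Ix cnt => ρ x.c) (fun x => st x.c x.k) (fun x => st x.c (x.k + 1))) :
    Comp ρ (fun c => st c 0) (fun c => st c (cnt c)) := by
  have hs := htest.small_left
  obtain ⟨s, hs⟩ := hs
  obtain ⟨C, j, hC⟩ := htest
  obtain ⟨P, l, hP⟩ := hbody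
  let D : ι → ℕ := fun c => 1 + ((ρ c).N + 2) ^ s + ((ρ c).N + 2) ^ j + ((ρ c).N + 2) ^ l
  have hD : PB ρ D := (((PB.const ρ 1).add ⟨s, fun c => le_rfl⟩).add ⟨j, fun _ => le_rfl⟩).add
      ⟨l, fun c => le_rfl⟩
  refine of_bound (.loop C P) (fun c => (cnt c + 1) * D c) ((hcnt.add (PB.const ρ 1)).mul hD)
    fun c => ?_
  have key : ∀ i k, k + i = cnt c → ∃ T Q, Runs (oracle (ρ c).V) (.loop C P) (st c k)
      (st c (cnt c)) T Q ∧ T ≤ (i + 1) * D c := by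
    intro i
    induction i with
    | zero =>
      intro k hk
      obtain ⟨T, Q, h1, h2⟩ := hC ⟨c, k, by omega⟩
      have h3 := hs ⟨c, k, by omega⟩
      simp only at h1 h2 h3
      rw [decide_eq_false (by omega), ofBool_false] at h1
      have hk' : k = cnt c := by omega
      subst hk'
      exact ⟨_, _, by constructor; exact h1, by simp only [D]; omega⟩
    | succ i ih =>
      intro k hk
      obtain ⟨T, Q, h1, h2⟩ := hC ⟨c, k, by omega⟩
      have h3 := hs ⟨c, k, by omega⟩
      obtain ⟨T', Q', h4, h5⟩ := hP ⟨c, k, by omega⟩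
      obtain ⟨T'', Q'', h6, h7⟩ := ih (k + 1) (by omega)
      simp only at h1 h2 h3 h4 h5
      rw [decide_eq_true (by omega)] at h1
      refine ⟨_, _, .loop_step h1 ofBool_true_ne h4 h6, ?_⟩
      rw [add_mul (i + 1) 1]
      simp only [D] at h7 ⊢
      omega
  simpa using key (cnt c) 0 (by omega)

namespace Comp

variable {cnt : ι → ℕ} {st : ι → ℕ → Data} {f : ι → Data}

/-- The original datum is carried along with the state. Test and body are given for an arbitrary
environment `e'` from which both can be computed, so nested loops can be assembled without fixing a
data layout. -/
theorem whileLoop (hcnt : PB ρ cnt) (hs : Small (fun x : Ix (fun c => cnt c + 1) => ρ x.c)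
      (fun x => st x.c x.k))
    (h0 : Comp ρ e (fun c => st c 0))
    (htest : ∀ e' : Ix (fun c => cnt c + 1) → Data, Comp (fun x => ρ x.c) e' (fun x => e x.c) →
      Comp (fun x => ρ x.c) e' (fun x => st x.c x.k) →
      Comp (fun x => ρ x.c) e' (fun x => Data.ofBool (decide (x.k < cnt x.c))))
    (hbody : ∀ e' : Ix cnt → Data, Comp (fun x => ρ x.c) e' (fun x => e x.c) →
      Comp (fun x => ρ x.c) e' (fun x => st x.c x.k) →
      Comp (fun x => ρ x.c) e' (fun x => st x.c (x.k + 1))) :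
    Comp ρ e (fun c => st c (cnt c)) := by
  have he := h0.small_left
  have r1 := refl ((he.comap (fun x : Ix (fun c => cnt c + 1) => x.c)).pair hs)
  have r2 := r1.comap (fun x : Ix cnt => ⟨x.c, x.k, x.lt.trans (Nat.lt_succ_self _)⟩)
  exact (((refl he).pair h0).trans (loop (st := fun c k => .pair (e c) (st c k)) hcnt
    (htest _ r1.fst r1.snd) (r2.fst.pair (hbody _ r2.fst r2.snd)))).snd

end Comp

/-! ### Bit lengths of powers and of sums. -/

theorem bits_pow_le (a : ℚ) (j : ℕ) : bits (a ^ j) ≤ j * bits a + 3 := by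
  induction j with
  | zero => simp [bits]
  | succ j ih =>
    rw [pow_succ, add_mul, one_mul]
    exact (bits_mul_le _ _).trans (by omega)

/-- Iterating `bits_add_le` would double the length at every addition. Instead all terms are brought
to the product of the denominators, which is at most `2 ^ (j * B)`. -/
theorem bits_sum_le (f : ℕ → ℚ) (B j : ℕ) (h : ∀ k < j, bits (f k) ≤ B) :
    bits (∑ k ∈ Finset.range j, f k) ≤ 3 + j + B + 2 * (j * B) := by
  have key : ∃ (a : ℤ) (d : ℕ), d ≠ 0 ∧ ∑ k ∈ Finset.range j, f k = a / d ∧ d ≤ 2 ^ (j * B) ∧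
      a.natAbs ≤ j * 2 ^ B * d := by
    induction j with
    | zero => exact ⟨0, 1, one_ne_zero, by simp, by simp, by simp⟩
    | succ j ih =>
      obtain ⟨a, d, hd, hs, hd', ha⟩ := ih fun k hk => h k (by omega)
      have hB := h j (by omega)
      have h1 : (f j).den ≤ 2 ^ B := (Nat.lt_size_self _).le.trans
        (Nat.pow_le_pow_right (by norm_num) (by unfold bits at hB; omega))
      have h2 : (f j).num.natAbs ≤ 2 ^ B := (Nat.lt_size_self _).le.trans
        (Nat.pow_le_pow_right (by norm_num) (by unfold bits at hB; omega))
      have h3 := (f j).den_pos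
      refine ⟨a * (f j).den + (f j).num * d, d * (f j).den, mul_ne_zero hd h3.ne', ?_, ?_, ?_⟩
      · rw [Finset.sum_range_succ, hs]
        have hd0 : (d : ℚ) ≠ 0 := by exact_mod_cast hd
        have hf0 : ((f j).den : ℚ) ≠ 0 := by exact_mod_cast h3.ne'
        conv_lhs => rw [← Rat.num_div_den (f j)]
        push_cast
        field_simp
      · rw [add_mul, one_mul, pow_add]; exact Nat.mul_le_mul hd' h1
      · refine (Int.natAbs_add_le _ _).trans ?_
        rw [Int.natAbs_mul, Int.natAbs_mul, Int.natAbs_natCast, Int.natAbs_natCast]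
        calc a.natAbs * (f j).den + (f j).num.natAbs * d
            ≤ (j * 2 ^ B * d) * (f j).den + (2 ^ B * d) * (f j).den :=
              Nat.add_le_add (Nat.mul_le_mul_right _ ha)
                ((Nat.mul_le_mul_right _ h2).trans (Nat.le_mul_of_pos_right _ h3))
          _ = (j + 1) * 2 ^ B * (d * (f j).den) := by ring
  obtain ⟨a, d, hd, hs, hd', ha⟩ := key
  refine (bits_le_of_eq_div hd hs).trans ?_
  have h1 : d.size ≤ j * B + 1 := by
    rw [Nat.size_le]; exact hd'.trans_lt (Nat.pow_lt_pow_right (by norm_num) (by omega))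
  have h2 : a.natAbs.size ≤ j + B + j * B + 1 := by
    rw [Nat.size_le, pow_succ, pow_add, pow_add]
    have hj : j ≤ 2 ^ j := Nat.lt_two_pow_self.le
    have h4 : a.natAbs ≤ 2 ^ j * 2 ^ B * 2 ^ (j * B) :=
      ha.trans (Nat.mul_le_mul (Nat.mul_le_mul_right _ hj) hd')
    have : 0 < 2 ^ j * 2 ^ B * 2 ^ (j * B) := by positivity
    omega
  omega

/-! ### Lists indexed by ranges of natural numbers -/

/-- The list of the values of `g` from `j` on, `k` of them. -/
def seg (g : ℕ → Data) (j k : ℕ) : Data := Data.ofList ((List.range' j k).map g)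

/-- The list of the first `k` values of `g`. -/
def tab (k : ℕ) (g : ℕ → Data) : Data := seg g 0 k

theorem seg_zero (g : ℕ → Data) (j : ℕ) : seg g j 0 = .num 0 := rfl

theorem seg_succ (g : ℕ → Data) (j k : ℕ) : seg g j (k + 1) = .pair (g j) (seg g (j + 1) k) := rfl

theorem size_seg_le (g : ℕ → Data) (B : ℕ) (k : ℕ) : ∀ j, (∀ i, j ≤ i → i < j + k → (g i).size ≤ B) →
    (seg g j k).size ≤ 2 + k * (1 + B) := by
  induction k with
  | zero => intro j _; simp [seg_zero, Data.size, bits]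
  | succ k ih =>
    intro j h
    have h1 := h j le_rfl (by omega)
    have h2 := ih (j + 1) fun i hi hi' => h i (by omega) (by omega)
    rw [seg_succ, Data.size, add_mul]
    omega

theorem le_size_seg (g : ℕ → Data) (k : ℕ) : ∀ j, k ≤ (seg g j k).size := by
  induction k with
  | zero => intro j; omega
  | succ k ih => intro j; rw [seg_succ, Data.size]; have := ih (j + 1); omega

theorem size_seg_add_le (g : ℕ → Data) (i : ℕ) : ∀ j k,
    (seg g (j + i) k).size ≤ (seg g j (k + i)).size := by
  induction i with
  | zero => intro j k; rfl
  | succ i ih =>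
    intro j k
    have := ih (j + 1) k
    rw [← add_assoc k i 1, seg_succ, Data.size, show j + (i + 1) = j + 1 + i by ring]
    omega

theorem tab_congr {k : ℕ} {g g' : ℕ → Data} (h : ∀ j < k, g j = g' j) : tab k g = tab k g' := by
  unfold tab seg
  congr 1
  exact List.map_congr_left fun j hj => h j (by simpa using hj)

/-- The least `k < N` that satisfies `p`, or `N` if there is none. -/
def lst (N : ℕ) (p : ℕ → Prop) : ℕ := sInf {k | N ≤ k ∨ p k}

section lst

variable {N : ℕ} {p : ℕ → Prop}

theorem lst_spec (N : ℕ) (p : ℕ → Prop) : N ≤ lst N p ∨ p (lst N p) :=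
  Nat.sInf_mem (s := {k | N ≤ k ∨ p k}) ⟨N, Or.inl le_rfl⟩

theorem lst_le (N : ℕ) (p : ℕ → Prop) : lst N p ≤ N := Nat.sInf_le (Or.inl le_rfl)

theorem lst_le_of {k : ℕ} (h : p k) : lst N p ≤ k := Nat.sInf_le (Or.inr h)

theorem lst_holds (h : lst N p < N) : p (lst N p) := (lst_spec N p).resolve_left (by omega)

theorem not_of_lt_lst {k : ℕ} (h : k < lst N p) : ¬ p k := fun hp => by
  have := lst_le_of (N := N) hp; omega

theorem lst_eq {k : ℕ} (h1 : k ≤ N) (h2 : N ≤ k ∨ p k) (h3 : ∀ j < k, ¬ p j) : lst N p = k := by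
  refine le_antisymm (Nat.sInf_le h2) ?_
  by_contra! h
  rcases lst_spec N p with h4 | h4
  · omega
  · exact h3 _ h h4

end lst

theorem PB.num {g : ι → ℕ} (h : PB ρ g) : Small ρ (fun c => .num (g c : ℚ)) := Small.natCast' h

theorem Small.seg {cnt : ι → ℕ} {g : ι → ℕ → Data} (hcnt : PB ρ cnt)
    (hg : Small (fun x : Ix cnt => ρ x.c) (fun x => g x.c x.k)) (r : κ → ι) (j k : κ → ℕ)
    (h : ∀ y, j y + k y ≤ cnt (r y)) :
    Small (fun y => ρ (r y)) (fun y => seg (g (r y)) (j y) (k y)) := by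
  obtain ⟨d, hd⟩ := hg
  have h1 : PB (fun y => ρ (r y)) (fun y => 2 + cnt (r y) * (1 + ((ρ (r y)).N + 2) ^ d)) :=
    (PB.const _ 2).add ((hcnt.comap r).mul ((PB.const _ 1).add ⟨d, fun _ => le_rfl⟩))
  refine h1.mono fun y => (size_seg_le _ (((ρ (r y)).N + 2) ^ d) _ _ fun i hi hi' =>
    hd ⟨r y, i, by have := h y; omega⟩).trans ?_
  have : k y ≤ cnt (r y) := by have := h y; omega
  gcongr

/-! ### Arithmetic, counting loops and tables in the calculus. -/

namespace Comp

variable {f : ι → Data}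

theorem lift {f : ι → Data} {r : κ → ι} {e' : κ → Data}
    (he : Comp (fun x => ρ (r x)) e' (fun x => e (r x))) (hf : Comp ρ e f) :
    Comp (fun x => ρ (r x)) e' (fun x => f (r x)) :=
  he.trans (hf.comap r)

theorem nat_add {a b : ι → ℕ} (ha : Comp ρ e (fun c => .num (a c)))
    (hb : Comp ρ e (fun c => .num (b c))) : Comp ρ e (fun c => .num (a c + b c : ℕ)) :=
  (ha.add hb).num_congr fun c => by push_cast; rfl

theorem nat_mul {a b : ι → ℕ} (ha : Comp ρ e (fun c => .num (a c)))
    (hb : Comp ρ e (fun c => .num (b c))) : Comp ρ e (fun c => .num (a c * b c : ℕ)) :=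
  (ha.mul hb).num_congr fun c => by push_cast; rfl

theorem nat_sub {a b : ι → ℕ} (ha : Comp ρ e (fun c => .num (a c)))
    (hb : Comp ρ e (fun c => .num (b c))) (h : ∀ c, b c ≤ a c) :
    Comp ρ e (fun c => .num (a c - b c : ℕ)) :=
  (ha.sub hb).num_congr fun c => by rw [Nat.cast_sub (h c)]

theorem nat (k : ℕ) (hs : Small ρ e) : Comp ρ e (fun _ => .num (k : ℕ)) := num k hs

theorem succ {a : ι → ℕ} (ha : Comp ρ e (fun c => .num (a c))) :
    Comp ρ e (fun c => .num (a c + 1 : ℕ)) :=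
  nat_add ha (nat 1 ha.small_left)

theorem nat_floor {a : ι → ℚ} (ha : Comp ρ e (fun c => .num (a c))) (h : ∀ c, 0 ≤ a c) :
    Comp ρ e (fun c => .num (⌊a c⌋₊ : ℕ)) :=
  ha.floor.num_congr fun c => by rw [natCast_floor_eq_intCast_floor (h c)]

theorem nat_div {a b : ι → ℕ} (ha : Comp ρ e (fun c => .num (a c)))
    (hb : Comp ρ e (fun c => .num (b c))) : Comp ρ e (fun c => .num (a c / b c : ℕ)) :=
  ((ha.div hb).nat_floor fun c => by positivity).num_congr fun c => by
    rw [Nat.floor_div_eq_div]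

theorem nat_mod {a b : ι → ℕ} (ha : Comp ρ e (fun c => .num (a c)))
    (hb : Comp ρ e (fun c => .num (b c))) : Comp ρ e (fun c => .num (a c % b c : ℕ)) :=
  (nat_sub ha (nat_mul hb (nat_div ha hb)) fun c => Nat.mul_div_le _ _).num_congr fun c => by
    congr 1; have := Nat.mod_add_div (a c) (b c); omega

theorem nat_le {a b : ι → ℕ} (ha : Comp ρ e (fun c => .num (a c)))
    (hb : Comp ρ e (fun c => .num (b c))) :
    Comp ρ e (fun c => Data.ofBool (decide (a c ≤ b c))) :=
  (ha.le hb).bool_congr fun c => by simp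

theorem nat_lt {a b : ι → ℕ} (ha : Comp ρ e (fun c => .num (a c)))
    (hb : Comp ρ e (fun c => .num (b c))) :
    Comp ρ e (fun c => Data.ofBool (decide (a c < b c))) :=
  (ha.lt hb).bool_congr fun c => by simp

theorem nat_ite {p : ι → Prop} [∀ c, Decidable (p c)] {a b : ι → ℕ}
    (hb : Comp ρ e (fun c => Data.ofBool (decide (p c))))
    (hf : Comp ρ e (fun c => .num (a c))) (hg : Comp ρ e (fun c => .num (b c))) :
    Comp ρ e (fun c => .num (if p c then a c else b c : ℕ)) :=
  (num_ite hb hf hg).num_congr fun c => by split_ifs <;> rfl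

theorem nat_eq_zero {a : ι → ℕ} (ha : Comp ρ e (fun c => .num (a c))) :
    Comp ρ e (fun c => Data.ofBool (decide (a c = 0))) :=
  (nat_le ha (nat 0 ha.small_left)).bool_congr fun c => by simp

theorem nat_congr {a b : ι → ℕ} (hf : Comp ρ e (fun c => .num (a c))) (hab : ∀ c, a c = b c) :
    Comp ρ e (fun c => .num (b c)) :=
  hf.congr fun c => by rw [hab c]

theorem nat_eq {a b : ι → ℕ} (ha : Comp ρ e (fun c => .num (a c)))
    (hb : Comp ρ e (fun c => .num (b c))) :
    Comp ρ e (fun c => Data.ofBool (decide (a c = b c))) :=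
  (ite (nat_le ha hb) (nat_le hb ha) (num 0 ha.small_left)).congr fun c => by
    split_ifs with h
    · congr 1; simp; omega
    · rw [← ofBool_false]; congr 1; simp; omega

variable {cnt : ι → ℕ} {st : ι → ℕ → Data}

theorem iter (hcnt : PB ρ cnt) (hc : Comp ρ e (fun c => .num (cnt c)))
    (hs : Small (fun x : Ix (fun c => cnt c + 1) => ρ x.c) (fun x => st x.c x.k))
    (h0 : Comp ρ e (fun c => st c 0))
    (hbody : ∀ e' : Ix cnt → Data, Comp (fun x => ρ x.c) e' (fun x => e x.c) →
      Comp (fun x => ρ x.c) e' (fun x => .num (x.k : ℕ)) →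
      Comp (fun x => ρ x.c) e' (fun x => st x.c x.k) →
      Comp (fun x => ρ x.c) e' (fun x => st x.c (x.k + 1))) :
    Comp ρ e (fun c => st c (cnt c)) := by
  have hk : PB (fun x : Ix (fun c => cnt c + 1) => ρ x.c) (fun x => x.k) :=
    (hcnt.comap _).mono fun x => Nat.lt_succ_iff.mp x.lt
  refine snd (f := fun c => .num (cnt c)) (whileLoop (st := fun c k => .pair (.num (k : ℕ)) (st c k))
    hcnt (hk.num.pair hs) ((nat 0 h0.small_left).pair h0) ?_ ?_)
  · intro e' he hst
    exact nat_lt hst.fst (he.lift hc)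
  · intro e' he hst
    exact (succ hst.fst).pair (hbody e' he hst.fst hst.snd)

theorem pow {a : ι → ℚ} {j : ι → ℕ} (ha : Comp ρ e (fun c => .num (a c)))
    (hj : Comp ρ e (fun c => .num (j c))) (pj : PB ρ j) :
    Comp ρ e (fun c => .num (a c ^ j c)) := by
  refine iter (st := fun c k => .num (a c ^ k)) pj hj ?_
    ((num 1 ha.small_left).num_congr fun c => by simp) ?_
  · have h := ((pj.comap (fun x : Ix (fun c => j c + 1) => x.c)).mul
      (ha.small.comap fun x : Ix (fun c => j c + 1) => x.c)).add (PB.const _ 3)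
    refine h.mono fun x => (bits_pow_le _ _).trans ?_
    simp only [Data.size]
    have := Nat.lt_succ_iff.mp x.lt
    gcongr
  · intro e' he hk hst
    exact (hst.mul (he.lift ha)).num_congr fun x => by rw [pow_succ]

theorem nat_pow {a : ι → ℕ} {j : ι → ℕ} (ha : Comp ρ e (fun c => .num (a c)))
    (hj : Comp ρ e (fun c => .num (j c))) (pj : PB ρ j) :
    Comp ρ e (fun c => .num (a c ^ j c : ℕ)) :=
  (pow ha hj pj).num_congr fun c => by push_cast; rfl

/-- The environment of the body of a counting loop. -/
theorem body_env (he : Small ρ e) (hcnt : PB ρ cnt) :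
    Small (fun x : Ix cnt => ρ x.c) (fun x => .pair (e x.c) (.num (x.k : ℕ))) :=
  (he.comap _).pair ((hcnt.comap fun x : Ix cnt => x.c).mono fun x => x.lt.le).num

theorem sum {g : ι → ℕ → ℚ} (hcnt : PB ρ cnt) (hc : Comp ρ e (fun c => .num (cnt c)))
    (hg : ∀ e' : Ix cnt → Data, Comp (fun x => ρ x.c) e' (fun x => e x.c) →
      Comp (fun x => ρ x.c) e' (fun x => .num (x.k : ℕ)) →
      Comp (fun x => ρ x.c) e' (fun x => .num (g x.c x.k))) :
    Comp ρ e (fun c => .num (∑ k ∈ Finset.range (cnt c), g c k)) := by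
  have r := refl (body_env hc.small_left hcnt)
  obtain ⟨d, hd⟩ := (hg _ r.fst r.snd).small
  refine iter (st := fun c j => .num (∑ k ∈ Finset.range j, g c k)) hcnt hc ?_
    ((num 0 hc.small_left).num_congr fun c => by simp) ?_
  · have hB : PB (fun x : Ix (fun c => cnt c + 1) => ρ x.c) (fun x => ((ρ x.c).N + 2) ^ d) :=
      ⟨d, fun _ => le_rfl⟩
    have hc' := hcnt.comap (fun x : Ix (fun c => cnt c + 1) => x.c)
    refine ((((PB.const _ 3).add hc').add hB).add ((PB.const _ 2).mul (hc'.mul hB))).mono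
      fun x => ?_
    have hx := Nat.lt_succ_iff.mp x.lt
    refine (bits_sum_le (g x.c) (((ρ x.c).N + 2) ^ d) x.k fun k hk => hd ⟨x.c, k, by omega⟩).trans ?_
    gcongr
  · intro e' he hk hst
    exact (hst.add (hg e' he hk)).num_congr fun x => by rw [Finset.sum_range_succ]

theorem nat_sum {g : ι → ℕ → ℕ} (hcnt : PB ρ cnt) (hc : Comp ρ e (fun c => .num (cnt c)))
    (hg : ∀ e' : Ix cnt → Data, Comp (fun x => ρ x.c) e' (fun x => e x.c) →
      Comp (fun x => ρ x.c) e' (fun x => .num (x.k : ℕ)) →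
      Comp (fun x => ρ x.c) e' (fun x => .num (g x.c x.k : ℕ))) :
    Comp ρ e (fun c => .num (∑ k ∈ Finset.range (cnt c), g c k : ℕ)) :=
  (sum hcnt hc hg).num_congr fun c => by push_cast; rfl

theorem sup {g : ι → ℕ → ℕ} {b : ι → ℕ} (hcnt : PB ρ cnt) (hc : Comp ρ e (fun c => .num (cnt c)))
    (hb : PB ρ b) (hgb : ∀ c, ∀ k < cnt c, g c k ≤ b c)
    (hg : ∀ e' : Ix cnt → Data, Comp (fun x => ρ x.c) e' (fun x => e x.c) →
      Comp (fun x => ρ x.c) e' (fun x => .num (x.k : ℕ)) →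
      Comp (fun x => ρ x.c) e' (fun x => .num (g x.c x.k : ℕ))) :
    Comp ρ e (fun c => .num ((Finset.range (cnt c)).sup (g c) : ℕ)) := by
  refine iter (st := fun c j => .num ((Finset.range j).sup (g c) : ℕ)) hcnt hc ?_
    ((nat 0 hc.small_left).num_congr fun c => by simp) ?_
  · refine PB.num ((hb.comap fun x : Ix (fun c => cnt c + 1) => x.c).mono fun x =>
      Finset.sup_le fun k hk => hgb _ _ ?_)
    have := x.lt; simp at hk; omega
  · intro e' he hk hst
    refine (nat_ite (nat_le (hg e' he hk) hst) hst (hg e' he hk)).nat_congr fun x => ?_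
    rw [Finset.range_add_one, Finset.sup_insert]
    split_ifs with h
    · exact (sup_eq_right.mpr h).symm
    · exact (sup_eq_left.mpr (by omega)).symm

theorem tab {g : ι → ℕ → Data} (hcnt : PB ρ cnt) (hc : Comp ρ e (fun c => .num (cnt c)))
    (hg : ∀ e' : Ix cnt → Data, Comp (fun x => ρ x.c) e' (fun x => e x.c) →
      Comp (fun x => ρ x.c) e' (fun x => .num (x.k : ℕ)) →
      Comp (fun x => ρ x.c) e' (fun x => g x.c x.k)) :
    Comp ρ e (fun c => tab (cnt c) (g c)) := by
  have r := refl (body_env hc.small_left hcnt)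
  have hg' := hg _ r.fst r.snd
  -- The list grows from its end, since a new element can only be put in front.
  have := iter (st := fun c j => seg (g c) (cnt c - j) j) hcnt hc
    (Small.seg hcnt hg'.small _ _ _ fun x => by have := x.lt; omega)
    ((num 0 hc.small_left).congr fun c => rfl) ?_
  · exact this.congr fun c => by simp [MultiUnit.tab]
  · intro e' he hk hst
    have h1 : Comp (fun x : Ix cnt => ρ x.c) e' (fun x => .num ((cnt x.c - (x.k + 1) : ℕ) : ℕ)) :=
      nat_sub (he.lift hc) (succ hk) fun x => x.lt
    refine ((((he.pair h1).trans (hg'.comap fun x : Ix cnt =>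
      ⟨x.c, cnt x.c - (x.k + 1), by have := x.lt; omega⟩))).pair hst).congr fun x => ?_
    rw [seg_succ]
    have := x.lt
    congr 3
    omega

theorem pb_of_tab {g : ι → ℕ → Data} (h : Comp ρ e (fun c => MultiUnit.tab (cnt c) (g c))) :
    PB ρ cnt :=
  h.small.mono fun _ => le_size_seg _ _ _

theorem small_seg_of_tab {g : ι → ℕ → Data} (h : Comp ρ e (fun c => MultiUnit.tab (cnt c) (g c))) :
    Small (fun x : Ix (fun c => cnt c + 1) => ρ x.c)
      (fun x => seg (g x.c) x.k (cnt x.c - x.k)) :=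
  (h.small.comap _).mono fun x => by
    have := size_seg_add_le (g x.c) x.k 0 (cnt x.c - x.k)
    have hx := x.lt
    rwa [zero_add, Nat.sub_add_cancel (by omega)] at this

theorem seg_step {j k : ℕ} (g : ℕ → Data) (h : j < k) :
    seg g j (k - j) = .pair (g j) (seg g (j + 1) (k - (j + 1))) := by
  rw [show k - j = k - (j + 1) + 1 by omega, seg_succ]

theorem get {g : ι → ℕ → Data} {j : ι → ℕ} (h : Comp ρ e (fun c => MultiUnit.tab (cnt c) (g c)))
    (hj : Comp ρ e (fun c => .num (j c))) (hlt : ∀ c, j c < cnt c) :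
    Comp ρ e (fun c => g c (j c)) := by
  have pj : PB ρ j := (pb_of_tab h).mono fun c => (hlt c).le
  have := iter (st := fun c j => seg (g c) j (cnt c - j)) pj hj
    ((small_seg_of_tab h).comap fun x : Ix (fun c => j c + 1) =>
      ⟨x.c, x.k, by have := x.lt; have := hlt x.c; omega⟩) (h.congr fun c => rfl) ?_
  · exact (this.congr fun c => seg_step _ (hlt c)).fst
  · intro e' he hk hst
    exact (hst.congr fun x => seg_step _ (x.lt.trans (hlt x.c))).snd

theorem length {g : ι → ℕ → Data} (h : Comp ρ e (fun c => MultiUnit.tab (cnt c) (g c))) :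
    Comp ρ e (fun c => .num (cnt c)) := by
  have pc := pb_of_tab h
  refine fst (g := fun c => seg (g c) (cnt c) (cnt c - cnt c))
    (whileLoop (st := fun c j => .pair (.num (j : ℕ)) (seg (g c) j (cnt c - j))) pc ?_
      ((nat 0 h.small_left).pair (h.congr fun c => rfl)) ?_ ?_)
  · refine Small.pair (PB.num ?_) (small_seg_of_tab h)
    exact (pc.comap _).mono fun x => Nat.lt_succ_iff.mp x.lt
  · intro e' he hst
    -- Only non-empty lists are pairs, so the shape of the remaining list tells whether its end is
    -- reached.
    refine (app .isPair hst.snd).congr fun x => ?_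
    have hx := x.lt
    by_cases h : x.k < cnt x.c
    · rw [seg_step _ h, decide_eq_true h]; rfl
    · rw [decide_eq_false h, show cnt x.c - x.k = 0 by omega, seg_zero, ofBool_false]; rfl
  · intro e' he hst
    exact (succ hst.fst).pair (hst.snd.congr fun x => seg_step _ x.lt).snd

end Comp

/-! ### Searching -/

/-- One step of binary search in the interval `[lo, hi]`. -/
def bisect (p : ℕ → Prop) [DecidablePred p] (z : ℕ × ℕ) : ℕ × ℕ :=
  if z.1 < z.2 then
    if p ((z.1 + z.2) / 2) then (z.1, (z.1 + z.2) / 2) else ((z.1 + z.2) / 2 + 1, z.2)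
  else z

/-- The interval always contains the answer and its length is halved. Monotonicity of `p` matters
only below `N`: beyond the known types or quantities the oracle answers `0`. -/
theorem bisect_invariant {N : ℕ} {p : ℕ → Prop} [DecidablePred p]
    (hp : ∀ j j', j ≤ j' → j' < N → p j → p j') (k : ℕ) :
    ((bisect p)^[k] (0, N)).1 ≤ lst N p ∧ lst N p ≤ ((bisect p)^[k] (0, N)).2 ∧
      ((bisect p)^[k] (0, N)).2 ≤ N ∧
      ((bisect p)^[k] (0, N)).2 ≤ ((bisect p)^[k] (0, N)).1 + N / 2 ^ k := by
  induction k with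
  | zero => simp [lst_le]
  | succ k ih =>
    rw [Function.iterate_succ_apply']
    obtain ⟨h1, h2, h3, h4⟩ := ih
    have h5 : N / 2 ^ (k + 1) = N / 2 ^ k / 2 := by rw [pow_succ, Nat.div_div_eq_div_mul]
    generalize (bisect p)^[k] (0, N) = z at *
    unfold bisect
    split_ifs with h h'
    · exact ⟨h1, lst_le_of h', by simp only; omega, by simp only; omega⟩
    · refine ⟨?_, h2, h3, by simp only; omega⟩
      by_contra! h6
      simp only at h6
      exact h' (hp (lst N p) _ (by omega) (by omega) (lst_holds (by omega)))
    · exact ⟨h1, h2, h3, by omega⟩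

namespace Comp

/-- Binary search takes about as many rounds as `N` has bits, so `N` itself may be exponential, as
the number of items or of types is. -/
theorem least {N : ι → ℕ} {p : ι → ℕ → Prop} [∀ c, DecidablePred (p c)]
    (hN : Comp ρ e (fun c => .num (N c)))
    (hmono : ∀ c j j', j ≤ j' → j' < N c → p c j → p c j')
    (hp : ∀ e' : Ix N → Data, Comp (fun x => ρ x.c) e' (fun x => e x.c) →
      Comp (fun x => ρ x.c) e' (fun x => .num (x.k : ℕ)) →
      Comp (fun x => ρ x.c) e' (fun x => Data.ofBool (decide (p x.c x.k)))) :
    Comp ρ e (fun c => .num (lst (N c) (p c) : ℕ)) := by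
  have hsN : Small (fun x : Ix N => ρ x.c) (fun x => .num (x.k : ℕ)) :=
    (hN.small.comap fun x : Ix N => x.c).natCast_le (h := fun x => N x.c) fun x => x.lt.le
  have r := refl ((hN.small_left.comap fun x : Ix N => x.c).pair hsN)
  have hp' := hp _ r.fst r.snd
  let z : ι → ℕ → ℕ × ℕ := fun c k => (bisect (p c))^[k] (0, N c)
  have hz : ∀ c k, z c (k + 1) = bisect (p c) (z c k) := fun c k =>
    Function.iterate_succ_apply' _ _ _
  have hinv := fun c k => bisect_invariant (hmono c) k
  -- The first round in which the interval is closed. The program never computes this number; it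
  -- only compares the two ends.
  let last : ι → ℕ := fun c => sInf {k | (z c k).2 ≤ (z c k).1}
  have hlast : ∀ c, (z c (N c).size).2 ≤ (z c (N c).size).1 := fun c => by
    have := (hinv c (N c).size).2.2.2
    rwa [Nat.div_eq_of_lt (Nat.lt_size_self _)] at this
  have hlast' : ∀ c, (z c (last c)).2 ≤ (z c (last c)).1 := fun c =>
    Nat.sInf_mem (s := {k | (z c k).2 ≤ (z c k).1}) ⟨_, hlast c⟩
  have hgo : ∀ c, ∀ k < last c, (z c k).1 < (z c k).2 := fun c k hk => by
    have := Nat.notMem_of_lt_sInf hk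
    simpa using this
  have plast : PB ρ last := hN.small.mono fun c => by
    have h : last c ≤ (N c).size := Nat.sInf_le (hlast c)
    simp only [Data.size, bits_natCast]; omega
  have key := whileLoop (ρ := ρ) (e := e) (cnt := last)
    (st := fun c k => .pair (.num ((z c k).1 : ℕ)) (.num ((z c k).2 : ℕ))) plast ?_ ?_ ?_ ?_
  · refine key.fst.nat_congr fun c => ?_
    have := hlast' c
    have h := hinv c (last c)
    change (z c _).1 ≤ _ ∧ _ ≤ (z c _).2 ∧ _ at h
    omega
  · have h := hN.small.comap fun x : Ix (fun c => last c + 1) => x.c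
    refine (h.natCast_le (h := fun x => N x.c) fun x => ?_).pair
      (h.natCast_le (h := fun x => N x.c) fun x => (hinv x.c x.k).2.2.1)
    exact (hinv x.c x.k).1.trans (lst_le _ _)
  · exact ((nat 0 hN.small_left).congr fun c => by simp [z]).pair
      (hN.congr fun c => by simp [z])
  · intro e' he hst
    refine (nat_lt hst.fst hst.snd).bool_congr fun x => ?_
    constructor
    · intro h
      have hx := x.lt
      by_contra h'
      have := hlast' x.c
      rw [show last x.c = x.k by omega] at this
      omega
    · exact hgo _ _
  · intro e' he hst
    have hmid : Comp (fun x : Ix last => ρ x.c) e'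
        (fun x => .num ((((z x.c x.k).1 + (z x.c x.k).2) / 2 : ℕ) : ℕ)) :=
      nat_div (nat_add hst.fst hst.snd) (nat 2 he.small_left)
    have hpm := (he.pair hmid).trans (hp'.comap fun x : Ix last =>
      ⟨x.c, ((z x.c x.k).1 + (z x.c x.k).2) / 2, by
        have := hgo x.c x.k x.lt
        have h2 := (hinv x.c x.k).2.2.1
        change (z x.c x.k).2 ≤ _ at h2
        omega⟩)
    refine (ite hpm (hst.fst.pair hmid) ((succ hmid).pair hst.snd)).congr fun x => ?_
    have := hgo x.c x.k x.lt
    rw [hz, bisect, if_pos this]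
    split_ifs <;> rfl

/-- Linear search: no monotonicity is needed, but the answer must be polynomially bounded. -/
theorem find {b : ι → ℕ} {p : ι → ℕ → Prop} [∀ c, DecidablePred (p c)] (hs : Small ρ e)
    (hb : PB ρ b) (hex : ∀ c, ∃ j ≤ b c, p c j)
    (hp : ∀ e' : Ix (fun c => b c + 1) → Data, Comp (fun x => ρ x.c) e' (fun x => e x.c) →
      Comp (fun x => ρ x.c) e' (fun x => .num (x.k : ℕ)) →
      Comp (fun x => ρ x.c) e' (fun x => Data.ofBool (decide (p x.c x.k)))) :
    Comp ρ e (fun c => .num (sInf {j | p c j} : ℕ)) := by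
  have hle : ∀ c, sInf {j | p c j} ≤ b c := fun c => by
    obtain ⟨j, h1, h2⟩ := hex c; exact (Nat.sInf_le h2).trans h1
  have hmem : ∀ c, p c (sInf {j | p c j}) := fun c => by
    obtain ⟨j, _, h⟩ := hex c; exact Nat.sInf_mem (s := {j | p c j}) ⟨j, h⟩
  have r := refl (body_env (cnt := fun c => b c + 1) hs (hb.add (PB.const ρ 1)))
  have hp' := hp _ r.fst r.snd
  refine whileLoop (cnt := fun c => sInf {j | p c j}) (st := fun _ j => .num (j : ℕ))
    (hb.mono hle) ?_ (nat 0 hs) ?_ ?_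
  · exact PB.num (((hb.mono hle).comap _).mono fun x => Nat.lt_succ_iff.mp x.lt)
  · intro e' he hst
    refine ((he.pair hst).trans (hp'.comap fun x : Ix (fun c => sInf {j | p c j} + 1) =>
      ⟨x.c, x.k, by have := x.lt; have := hle x.c; omega⟩)).not.bool_congr fun x => ?_
    have hx := x.lt
    constructor
    · intro h
      refine lt_of_le_of_ne (by omega) fun h' => h ?_
      simp only; rw [h']; exact hmem x.c
    · intro h; exact Nat.notMem_of_lt_sInf h
  · intro e' he hst
    exact succ hst

end Comp

/-! ### Value queries -/

/-- The extended values of an instance. -/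
def Inst.ev (I : Inst) : ℕ → ℕ → ℕ → ℚ := extendedValue I.V

theorem bits_le_maxBits {n m : ℕ} (V : Fin n → Domain m) (i : Fin n) (t : Fin (V i).size)
    (s : Fin (m + 1)) : bits ((V i).val t s) ≤ maxBits V := by
  refine le_trans ?_ (Finset.le_sup (f := fun i => Finset.univ.sup fun t => Finset.univ.sup fun s =>
    bits ((V i).val t s)) (Finset.mem_univ i))
  refine le_trans ?_ (Finset.le_sup (f := fun t => Finset.univ.sup fun s =>
    bits ((V i).val t s)) (Finset.mem_univ t))
  exact Finset.le_sup (f := fun s => bits ((V i).val t s)) (Finset.mem_univ s)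

theorem Inst.bits_ev_le (I : Inst) (i t s : ℕ) : bits (I.ev i t s) ≤ I.N + 2 := by
  have h0 : bits 0 ≤ I.N + 2 := by simp [bits]
  unfold Inst.ev extendedValue
  split_ifs with hi ht hs
  · have := bits_le_maxBits I.V ⟨i, hi⟩ ⟨t, ht⟩ ⟨s, hs⟩
    unfold Inst.N; omega
  all_goals exact h0

theorem small_ev (i t s : ι → ℕ) : Small ρ (fun c => .num ((ρ c).ev (i c) (t c) (s c))) :=
  ((PB.param ρ).add (PB.const ρ 2)).mono fun c => (ρ c).bits_ev_le _ _ _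

theorem Comp.ev {i t s : ι → ℕ} (hi : Comp ρ e (fun c => .num (i c)))
    (ht : Comp ρ e (fun c => .num (t c))) (hs : Comp ρ e (fun c => .num (s c))) :
    Comp ρ e (fun c => .num ((ρ c).ev (i c) (t c) (s c))) := by
  have h := hi.pair (ht.pair hs)
  have h1 : ∀ c, oracle (ρ c).V (.pair (.num (i c)) (.pair (.num (t c)) (.num (s c)))) =
      .num ((ρ c).ev (i c) (t c) (s c)) := fun c => by simp [oracle, Inst.ev]
  exact (h.trans (Comp.query h.small ((small_ev i t s).mono fun c =>
    (congrArg Data.size (h1 c)).le))).congr h1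

/-! ### Properties of the value oracle -/

namespace Inst

variable (I : Inst)

/-- The number of valuations of player `i`. -/
def sz (i : ℕ) : ℕ := if h : i < I.n then (I.V ⟨i, h⟩).size else 0

variable {I} {i t t' s s' : ℕ}

theorem lt_n_of_lt_sz (h : t < I.sz i) : i < I.n := by
  unfold sz at h; split_ifs at h with h1
  · exact h1
  · omega

theorem ev_eq (hi : i < I.n) (ht : t < (I.V ⟨i, hi⟩).size) (hs : s < I.m + 1) :
    I.ev i t s = (I.V ⟨i, hi⟩).val ⟨t, ht⟩ ⟨s, hs⟩ := by
  simp [ev, extendedValue, hi, ht, hs]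

theorem ev_zero : I.ev i t 0 = 0 := by
  unfold ev extendedValue
  split_ifs with hi ht hs
  · exact (I.V ⟨i, hi⟩).normalized ⟨t, ht⟩
  all_goals rfl

theorem ev_mono (ht : t < I.sz i) (h : s ≤ s') (hs' : s' ≤ I.m) :
    I.ev i t s ≤ I.ev i t s' := by
  have hi := lt_n_of_lt_sz ht
  simp only [sz, hi, dif_pos] at ht
  rw [ev_eq hi ht (by omega), ev_eq hi ht (by omega)]
  exact (I.V ⟨i, hi⟩).monotone _ (by simpa using h)

theorem ev_nonneg : 0 ≤ I.ev i t s := by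
  unfold ev extendedValue
  split_ifs with hi ht hs
  · rw [← (I.V ⟨i, hi⟩).normalized ⟨t, ht⟩]
    exact (I.V ⟨i, hi⟩).monotone _ (Fin.zero_le _)
  all_goals rfl

theorem ev_sub_le (htt : t ≤ t') (ht : t' < I.sz i) (h : s ≤ s') (hs' : s' ≤ I.m) :
    I.ev i t s' - I.ev i t s ≤ I.ev i t' s' - I.ev i t' s := by
  have hi := lt_n_of_lt_sz ht
  simp only [sz, hi, dif_pos] at ht
  rcases htt.eq_or_lt with rfl | htt
  · rfl
  rcases h.eq_or_lt with rfl | h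
  · simp
  rw [ev_eq hi (htt.trans ht) (by omega), ev_eq hi (htt.trans ht) (by omega),
    ev_eq hi ht (by omega), ev_eq hi ht (by omega)]
  exact I.singleCrossing ⟨i, hi⟩ ⟨t, _⟩ ⟨t', _⟩ htt _ _ h

/-- Single crossing against the quantity 0, where all valuations vanish. -/
theorem ev_mono_type (htt : t ≤ t') (ht : t' < I.sz i) (hs : s ≤ I.m) :
    I.ev i t s ≤ I.ev i t' s := by
  simpa [ev_zero] using ev_sub_le htt ht (Nat.zero_le s) hs

theorem exists_ev_lt (htt : t < t') (ht : t' < I.sz i) : ∃ s ≤ I.m, I.ev i t s < I.ev i t' s := by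
  by_contra! h
  have hi := lt_n_of_lt_sz ht
  have ht1 := ht
  simp only [sz, hi, dif_pos] at ht1
  have : (⟨t, htt.trans ht1⟩ : Fin (I.V ⟨i, hi⟩).size) = ⟨t', ht1⟩ := by
    apply (I.V ⟨i, hi⟩).injective
    funext s
    have h1 := h s (by have := s.2; omega)
    have h2 := ev_mono_type htt.le ht (show (s : ℕ) ≤ I.m by have := s.2; omega)
    rw [ev_eq hi (htt.trans ht1) s.2, ev_eq hi ht1 s.2] at h1 h2
    exact le_antisymm h2 h1
  simp at this
  omega

/-- Distinct valuations that are ordered pointwise leave only type 0 as a possible zero valuation.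
-/
theorem ev_pos (h0 : 0 < t) (ht : t < I.sz i) : 0 < I.ev i t I.m := by
  obtain ⟨s, hs, h⟩ := exists_ev_lt h0 ht
  exact (ev_nonneg.trans_lt h).trans_le (ev_mono ht hs le_rfl)

/-! ### Geometric levels of values -/

variable (I)

/-- The resolution of the algorithm. -/
def q : ℕ := 4 * (I.n + 1) * (I.a + 1)

/-- A lower bound for all positive values of the whole bundle. -/
def base : ℚ := (1 + ∑ i ∈ Finset.range I.n, ((I.ev i 0 I.m)⁻¹ + (I.ev i 1 I.m)⁻¹))⁻¹

/-- The levels of values. -/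
def x (j : ℕ) : ℚ := I.base * (1 + 1 / I.q) ^ j

/-- The number of levels that the value of player `i` with type `t` reaches. -/
def lev (i t : ℕ) : ℕ := sInf {j | I.ev i t I.m < I.x j}

/-- A bound for the number of levels. -/
def levBound : ℕ := I.q * (2 * I.N + I.n + 6)

variable {I}

theorem q_pos : 0 < I.q := by unfold q; positivity

theorem q_cast_pos : (0 : ℚ) < I.q := by exact_mod_cast q_pos

theorem base_pos : 0 < I.base := by
  unfold base
  have : 0 ≤ ∑ i ∈ Finset.range I.n, ((I.ev i 0 I.m)⁻¹ + (I.ev i 1 I.m)⁻¹) :=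
    Finset.sum_nonneg fun i _ => add_nonneg (inv_nonneg.mpr ev_nonneg) (inv_nonneg.mpr ev_nonneg)
  positivity

/-- Types are ordered pointwise and type 1 is already positive by `ev_pos`, so two types per player
suffice. Zero or missing values contribute the inverse `0⁻¹ = 0` and do no harm. -/
theorem base_le (ht : t < I.sz i) (hpos : 0 < I.ev i t I.m) : I.base ≤ I.ev i t I.m := by
  have hi := lt_n_of_lt_sz ht
  have h1 : (I.ev i 0 I.m)⁻¹ + (I.ev i 1 I.m)⁻¹ ≤
      ∑ i ∈ Finset.range I.n, ((I.ev i 0 I.m)⁻¹ + (I.ev i 1 I.m)⁻¹) :=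
    Finset.single_le_sum (f := fun i => (I.ev i 0 I.m)⁻¹ + (I.ev i 1 I.m)⁻¹)
      (fun i _ => add_nonneg (inv_nonneg.mpr ev_nonneg) (inv_nonneg.mpr ev_nonneg))
      (Finset.mem_range.mpr hi)
  have n0 : 0 ≤ (I.ev i 0 I.m)⁻¹ := inv_nonneg.mpr ev_nonneg
  have n1 : 0 ≤ (I.ev i 1 I.m)⁻¹ := inv_nonneg.mpr ev_nonneg
  unfold base
  rcases Nat.eq_zero_or_pos t with rfl | h0
  · exact inv_le_of_inv_le₀ hpos (by linarith)
  · have h2 := ev_pos one_pos (lt_of_le_of_lt h0 ht)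
    exact (inv_le_of_inv_le₀ h2 (by linarith)).trans (ev_mono_type h0 ht le_rfl)

theorem x_zero : I.x 0 = I.base := by simp [x]

theorem x_succ (j : ℕ) : I.x (j + 1) = I.x j + I.x j / I.q := by
  unfold x; rw [pow_succ]; ring

theorem x_pos (j : ℕ) : 0 < I.x j := by
  have := I.base_pos; have := I.q_cast_pos; unfold x; positivity

theorem x_strictMono : StrictMono I.x := strictMono_nat_of_lt_succ fun j => by
  rw [x_succ]; have := div_pos (I.x_pos j) I.q_cast_pos; linarith

theorem sum_x (L : ℕ) : ∑ l ∈ Finset.range L, I.x l ≤ I.q * I.x L := by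
  induction L with
  | zero => simp only [Finset.range_zero, Finset.sum_empty]; have := I.x_pos 0; positivity
  | succ L ih =>
    rw [Finset.sum_range_succ, x_succ, mul_add, mul_div_cancel₀ _ I.q_cast_pos.ne']
    linarith

theorem le_two_pow_bits (a : ℚ) : a ≤ 2 ^ bits a := by
  have h1 : a ≤ (a.num.natAbs : ℚ) := by
    refine (le_abs_self a).trans ?_
    conv_lhs => rw [← Rat.num_div_den a]
    rw [abs_div, Nat.abs_cast, Nat.cast_natAbs, Int.cast_abs]
    exact div_le_self (abs_nonneg _) (by exact_mod_cast a.den_pos)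
  have h2 : a.num.natAbs ≤ 2 ^ bits a := (Nat.lt_size_self _).le.trans
    (Nat.pow_le_pow_right (by norm_num) (by unfold bits; omega))
  exact h1.trans (by exact_mod_cast h2)

theorem ev_le_two_pow : I.ev i t s ≤ 2 ^ (I.N + 2) :=
  (le_two_pow_bits _).trans (pow_le_pow_right₀ (by norm_num) (I.bits_ev_le i t s))

theorem inv_ev_le_two_pow : (I.ev i t s)⁻¹ ≤ 2 ^ (I.N + 2) :=
  (le_two_pow_bits _).trans (pow_le_pow_right₀ (by norm_num)
    ((bits_inv_le _).trans (I.bits_ev_le i t s)))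

theorem inv_base_le : I.base⁻¹ ≤ 2 ^ (I.N + I.n + 3) := by
  unfold base
  rw [inv_inv]
  have h : ∑ i ∈ Finset.range I.n, ((I.ev i 0 I.m)⁻¹ + (I.ev i 1 I.m)⁻¹) ≤
      (Finset.range I.n).card • (2 ^ (I.N + 3) : ℚ) :=
    Finset.sum_le_card_nsmul _ _ _ fun i _ => by
      have h0 := I.inv_ev_le_two_pow (i := i) (t := 0) (s := I.m)
      have h1 := I.inv_ev_le_two_pow (i := i) (t := 1) (s := I.m)
      rw [pow_succ]; linarith
  rw [Finset.card_range, nsmul_eq_mul] at h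
  have h1 : (1 : ℚ) ≤ 2 ^ (I.N + 3) := one_le_pow₀ (by norm_num)
  have h2 : (I.n : ℚ) + 1 ≤ 2 ^ I.n := by exact_mod_cast Nat.lt_two_pow_self
  rw [show I.N + I.n + 3 = I.n + (I.N + 3) by ring, pow_add]
  nlinarith

/-- By Bernoulli's inequality `q` successive levels at least double the value. The exponent covers
the distance from `base`, at least `2 ^ (-(N + n + 3))`, up to the largest value, at most `2 ^ (N +
2)`. -/
theorem ev_lt_x_levBound : I.ev i t s < I.x I.levBound := by
  have h1 : (2 : ℚ) ≤ (1 + 1 / I.q) ^ I.q := by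
    have h0 : (0 : ℚ) ≤ 1 / I.q := by positivity
    have h := one_add_mul_le_pow (a := (1 / I.q : ℚ)) (by linarith) I.q
    rw [mul_one_div_cancel I.q_cast_pos.ne'] at h
    linarith
  have h2 : (2 : ℚ) ^ (2 * I.N + I.n + 6) ≤ (1 + 1 / I.q) ^ I.levBound := by
    rw [levBound, pow_mul]; exact pow_le_pow_left₀ (by norm_num) h1 _
  refine I.ev_le_two_pow.trans_lt ?_
  have h3 : 1 ≤ I.base * 2 ^ (I.N + I.n + 3) := by
    have := mul_le_mul_of_nonneg_left I.inv_base_le I.base_pos.le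
    rwa [mul_inv_cancel₀ I.base_pos.ne'] at this
  have h4 : (2 : ℚ) ^ (2 * I.N + I.n + 6) = 2 ^ (I.N + I.n + 3) * 2 ^ (I.N + 3) := by
    rw [← pow_add]; ring_nf
  have h5 : (2 : ℚ) ^ (I.N + 2) < 2 ^ (I.N + 3) := pow_lt_pow_right₀ (by norm_num) (by omega)
  have h6 : (0 : ℚ) < 2 ^ (I.N + 3) := by positivity
  calc (2 : ℚ) ^ (I.N + 2) < 2 ^ (I.N + 3) := h5
    _ ≤ I.base * 2 ^ (I.N + I.n + 3) * 2 ^ (I.N + 3) := le_mul_of_one_le_left h6.le h3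
    _ = I.base * 2 ^ (2 * I.N + I.n + 6) := by rw [h4]; ring
    _ ≤ I.x I.levBound := mul_le_mul_of_nonneg_left h2 I.base_pos.le

theorem lev_le : I.lev i t ≤ I.levBound := Nat.sInf_le (s := {j | I.ev i t I.m < I.x j})
  I.ev_lt_x_levBound

theorem ev_lt_x_lev : I.ev i t I.m < I.x (I.lev i t) :=
  Nat.sInf_mem (s := {j | I.ev i t I.m < I.x j}) ⟨_, I.ev_lt_x_levBound⟩

theorem lt_lev_iff {l : ℕ} : l < I.lev i t ↔ I.x l ≤ I.ev i t I.m := by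
  constructor
  · intro h; simpa using Nat.notMem_of_lt_sInf h
  · intro h; exact I.x_strictMono.lt_iff_lt.mp (h.trans_lt I.ev_lt_x_lev)

theorem lev_mono (htt : t ≤ t') (ht : t' < I.sz i) : I.lev i t ≤ I.lev i t' := by
  by_contra! h
  exact absurd (lt_lev_iff.mpr ((lt_lev_iff.mp h).trans (ev_mono_type htt ht le_rfl)))
    (lt_irrefl _)

theorem lev_pos (ht : t < I.sz i) (hpos : 0 < I.ev i t I.m) : 0 < I.lev i t := by
  rw [lt_lev_iff, x_zero]; exact base_le ht hpos

/-! ### Rounding of the valuations -/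

variable (I)

/-- The first type up to `t` of player `i` whose value reaches the level `l`. -/
def first (i t l : ℕ) : ℕ := lst (t + 1) fun u => I.x l ≤ I.ev i u I.m

/-- One more than the first type in the highest non-empty level below `l`, or `0` if there is no
such type. -/
def rep (i t : ℕ) : ℕ → ℕ
  | 0 => 0
  | l + 1 => if I.ev i (I.first i t l) I.m < I.x (l + 1) then I.first i t l + 1 else rep i t l

/-- The values of type `c - 1`, and the zero valuation for `c = 0`. -/
def val (i c s : ℕ) : ℚ := if c = 0 then 0 else I.ev i (c - 1) s

/-- The increment of the rounded valuation at the level `l`. -/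
def inc (i t l s : ℕ) : ℚ := I.val i (I.rep i t (l + 1)) s - I.val i (I.rep i t l) s

/-- The unit of the increments at the level `l`. -/
def del (l : ℕ) : ℚ := I.x l / (I.q * (I.q + 1))

/-- The number of units in an increment. -/
def grid : ℕ := (I.q + 1) ^ 2

/-- The least quantity for which the increment at level `l` reaches `c + 1` units. -/
def pos (i t l c : ℕ) : ℕ := lst (I.m + 1) fun s => (c + 1) * I.del l ≤ I.inc i t l s

/-- All the jumps of the rounded valuation of type `t`, for `j < grid * lev i t`. -/
def pt (i t j : ℕ) : ℕ := I.pos i t (j / I.grid) (j % I.grid)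

/-- The bonus for each jump of a type that reaches `L` levels. -/
def gam (L : ℕ) : ℚ := I.x L / ((I.q + 1) ^ 3 * (L + 2 * I.q))

/-- The unit of the objective function if the highest type reaches `K` levels. -/
def eta (K : ℕ) : ℚ := I.x K / ((I.q + 1) ^ 7 * (K + 2 * I.q) ^ 2)

/-- The weight of a jump. -/
def wt (K l L : ℕ) : ℕ := ⌊(I.del l + I.gam L) / I.eta K⌋₊

variable {I} {l : ℕ}

theorem first_mono {l' : ℕ} (h : l ≤ l') : I.first i t l ≤ I.first i t l' := by
  unfold first
  rcases lst_spec (t + 1) (fun u => I.x l' ≤ I.ev i u I.m) with h1 | h1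
  · exact (lst_le _ _).trans h1
  · exact lst_le_of ((I.x_strictMono.monotone h).trans h1)

theorem first_le (hl : l < I.lev i t) : I.first i t l ≤ t := lst_le_of (lt_lev_iff.mp hl)

theorem x_le_first (hl : l < I.lev i t) : I.x l ≤ I.ev i (I.first i t l) I.m :=
  lst_holds (p := fun u => I.x l ≤ I.ev i u I.m) (Nat.lt_succ_of_le (first_le hl))

/-- The search is confined to types up to the report, because the size of the domain is unknown to
the algorithm. A level that `t` reaches has its first type already among these, so the confinement
does not show. -/
theorem first_congr (htt : t ≤ t') (hl : l < I.lev i t) : I.first i t' l = I.first i t l :=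
  lst_eq ((first_le hl).trans (by omega)) (Or.inr (x_le_first hl)) fun _ hj => not_of_lt_lst hj

theorem rep_congr (htt : t ≤ t') (hl : l ≤ I.lev i t) : I.rep i t' l = I.rep i t l := by
  induction l with
  | zero => rfl
  | succ l ih => simp only [rep, first_congr htt hl, ih (by omega)]

theorem rep_le_first (l' : ℕ) (h : l ≤ l' + 1) : I.rep i t l ≤ I.first i t l' + 1 := by
  induction l with
  | zero => exact Nat.zero_le _
  | succ l ih =>
    rw [rep]
    split_ifs
    · exact Nat.succ_le_succ (first_mono (by omega))
    · exact ih (by omega)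

theorem rep_le_succ : I.rep i t l ≤ I.rep i t (l + 1) := by
  rw [rep]
  split_ifs
  · exact rep_le_first l (by omega)
  · rfl

theorem rep_le (hl : l ≤ I.lev i t) : I.rep i t l ≤ t + 1 := by
  cases l with
  | zero => exact Nat.zero_le _
  | succ l => exact (rep_le_first l le_rfl).trans (Nat.succ_le_succ (first_le hl))

theorem val_rep_lt : I.val i (I.rep i t l) I.m < I.x l := by
  induction l with
  | zero => simpa [rep, val] using I.x_pos 0
  | succ l ih =>
    rw [rep]
    split_ifs with h
    · simpa [val] using h
    · exact ih.trans (I.x_strictMono (by omega))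

/-- The highest level reached by `t` is non-empty, since `t` itself lies in it. -/
theorem rep_top (ht : t < I.sz i) (hl : I.lev i t = l + 1) :
    I.rep i t (l + 1) = I.first i t l + 1 := by
  rw [rep, if_pos]
  rw [← hl]
  exact (ev_mono_type (first_le (by omega)) ht le_rfl).trans_lt I.ev_lt_x_lev

theorem val_mono {c : ℕ} (hc : c ≤ I.sz i) (h : s ≤ s') (hs' : s' ≤ I.m) :
    I.val i c s ≤ I.val i c s' := by
  unfold val
  split_ifs with h0
  · rfl
  · exact ev_mono (by omega) h hs'

/-- The zero valuation can be put below the domain without losing single crossing, since the other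
valuations are non-decreasing. -/
theorem val_sub_le {c c' : ℕ} (hcc : c ≤ c') (hc : c' ≤ I.sz i) (h : s ≤ s') (hs' : s' ≤ I.m) :
    I.val i c s' - I.val i c s ≤ I.val i c' s' - I.val i c' s := by
  by_cases h0 : c = 0
  · have := val_mono hc h hs'
    simp only [h0, val, if_pos] at this ⊢
    linarith
  · simp only [val, h0, if_neg, show c' ≠ 0 by omega, not_false_eq_true]
    exact ev_sub_le (by omega) (by omega) h hs'

theorem val_zero {c : ℕ} : I.val i c 0 = 0 := by simp [val, ev_zero]

theorem val_nonneg {c : ℕ} : 0 ≤ I.val i c s := by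
  unfold val; split_ifs
  · rfl
  · exact ev_nonneg

theorem inc_mono (ht : t < I.sz i) (hl : l < I.lev i t) (h : s ≤ s') (hs' : s' ≤ I.m) :
    I.inc i t l s ≤ I.inc i t l s' := by
  have := val_sub_le (I := I) (i := i) rep_le_succ ((rep_le (t := t) hl).trans ht) h hs'
  unfold inc; linarith

theorem inc_nonneg (ht : t < I.sz i) (hl : l < I.lev i t) (hs : s ≤ I.m) :
    0 ≤ I.inc i t l s := by
  have := inc_mono ht hl (Nat.zero_le s) hs
  rwa [inc, val_zero, val_zero, sub_zero] at this

theorem inc_lt (ht : t < I.sz i) (hl : l < I.lev i t) (hs : s ≤ I.m) :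
    I.inc i t l s < I.x (l + 1) :=
  (inc_mono ht hl hs le_rfl).trans_lt <| (sub_le_self _ val_nonneg).trans_lt val_rep_lt

theorem inc_congr (htt : t ≤ t') (hl : l < I.lev i t) : I.inc i t' l = I.inc i t l := by
  funext s; rw [inc, inc, rep_congr htt hl, rep_congr htt hl.le]

theorem pos_congr (htt : t ≤ t') (hl : l < I.lev i t) : I.pos i t' l = I.pos i t l := by
  funext c; rw [pos, pos, inc_congr htt hl]

theorem grid_pos : 0 < I.grid := by unfold grid; positivity

/-- Raising a type keeps the existing jumps and only appends new ones, because the data of levels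
below `lev i t` do not depend on the type. All monotonicity rests on this. -/
theorem pt_congr (htt : t ≤ t') {j : ℕ} (hj : j < I.grid * I.lev i t) : I.pt i t' j = I.pt i t j := by
  rw [pt, pt, pos_congr htt (Nat.div_lt_of_lt_mul hj)]

theorem pos_le_iff (ht : t < I.sz i) (hl : l < I.lev i t) (hs : s ≤ I.m) {c : ℕ} :
    I.pos i t l c ≤ s ↔ (c + 1) * I.del l ≤ I.inc i t l s := by
  constructor
  · intro h
    exact (lst_holds (p := fun s => (c + 1) * I.del l ≤ I.inc i t l s)
      (h.trans_lt (Nat.lt_succ_of_le hs))).trans (inc_mono ht hl h hs)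
  · intro h; exact lst_le_of h

theorem del_pos : 0 < I.del l := by
  have := I.x_pos l; have := I.q_cast_pos; unfold del; positivity

theorem sum_pos_le (ht : t < I.sz i) (hl : l < I.lev i t) (hs : s ≤ I.m) :
    (∑ c ∈ Finset.range I.grid, if I.pos i t l c ≤ s then I.del l else 0) ≤ I.inc i t l s ∧
    I.inc i t l s - I.del l ≤
      ∑ c ∈ Finset.range I.grid, if I.pos i t l c ≤ s then I.del l else 0 := by
  have hd := I.del_pos (l := l)
  have h0 := inc_nonneg ht hl hs
  have hlt : I.inc i t l s / I.del l < I.grid := by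
    rw [div_lt_iff₀ hd]
    -- The number `grid` is chosen so that `grid * del l` is exactly `x (l + 1)`.
    refine (inc_lt ht hl hs).trans_le (le_of_eq ?_)
    have := I.q_cast_pos
    rw [x_succ, grid, del]
    push_cast
    field_simp
  have heq : (Finset.range I.grid).filter (fun c => I.pos i t l c ≤ s) =
      Finset.range ⌊I.inc i t l s / I.del l⌋₊ := by
    ext c
    rw [Finset.mem_filter, Finset.mem_range, Finset.mem_range, pos_le_iff ht hl hs,
      ← le_div_iff₀ hd, ← Nat.succ_le_iff (n := ⌊_⌋₊), Nat.le_floor_iff (div_nonneg h0 hd.le)]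
    push_cast
    constructor
    · exact fun h => h.2
    · intro h
      refine ⟨?_, h⟩
      have := h.trans_lt hlt
      have : c + 1 < I.grid := by exact_mod_cast this
      omega
  rw [← Finset.sum_filter, heq, Finset.sum_const, Finset.card_range, nsmul_eq_mul]
  constructor
  · exact (le_div_iff₀ hd).mp (Nat.floor_le (div_nonneg h0 hd.le))
  · have := (div_lt_iff₀ hd).mp (Nat.lt_floor_add_one (I.inc i t l s / I.del l))
    linarith

end Inst

namespace Inst

variable (I : Inst)

/-! ### The objective function -/

/-- The rounded value of `s` items for player `i` with type `t`, in units of `eta K`. -/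
def phi (K i t s : ℕ) : ℕ :=
  ∑ j ∈ Finset.range (I.grid * I.lev i t),
    if I.pt i t j ≤ s then I.wt K (j / I.grid) (I.lev i t) else 0

/-- The rounded value before the conversion to integers. -/
def rphi (i t s : ℕ) : ℚ :=
  ∑ j ∈ Finset.range (I.grid * I.lev i t),
    if I.pt i t j ≤ s then I.del (j / I.grid) + I.gam (I.lev i t) else 0

/-- The highest level reached in a profile. -/
def scale (t : ℕ → ℕ) : ℕ := (Finset.range I.n).sup fun i => I.lev i (t i)

/-- The objective function. -/
def obj (t s : ℕ → ℕ) : ℕ := ∑ i ∈ Finset.range I.n, I.phi (I.scale t) i (t i) (s i)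

/-- The welfare in terms of extended values. -/
def wel (t s : ℕ → ℕ) : ℚ := ∑ i ∈ Finset.range I.n, I.ev i (t i) (s i)

/-- Allocations that sell at most `m` items. -/
def Feasible (s : ℕ → ℕ) : Prop := ∑ i ∈ Finset.range I.n, s i ≤ I.m

/-- Profiles of types that exist. -/
def Valid (t : ℕ → ℕ) : Prop := ∀ i < I.n, t i < I.sz i

/-- A number that determines an allocation and has the number of sold items as its leading digit. -/
def code (s : ℕ → ℕ) : ℕ :=
  ∑ k ∈ Finset.range I.n, s k * ((I.m + 2) ^ I.n + (I.m + 2) ^ k)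

/-- The maximizer of the objective function of least code. -/
structure IsOpt (t s : ℕ → ℕ) : Prop where
  feasible : I.Feasible s
  candidate : ∀ i < I.n, s i = 0 ∨ ∃ j < I.grid * I.lev i (t i), s i = I.pt i (t i) j
  best : ∀ s', I.Feasible s' →
    I.obj t s' < I.obj t s ∨ I.obj t s' = I.obj t s ∧ I.code s ≤ I.code s'

variable {I} {i t t' s s' K L l : ℕ}

theorem Feasible.le {s : ℕ → ℕ} (h : I.Feasible s) (hi : i < I.n) : s i ≤ I.m :=
  (Finset.single_le_sum (f := s) (fun _ _ => Nat.zero_le _) (Finset.mem_range.mpr hi)).trans h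

theorem lev_le_scale (t : ℕ → ℕ) (hi : i < I.n) : I.lev i (t i) ≤ I.scale t :=
  Finset.le_sup (f := fun i => I.lev i (t i)) (Finset.mem_range.mpr hi)

/-! ### Error estimates -/

theorem gam_pos : 0 < I.gam L := by
  have := I.x_pos L; have := I.q_cast_pos; unfold gam; positivity

theorem eta_pos : 0 < I.eta K := by
  have := I.x_pos K; have := I.q_cast_pos; unfold eta; positivity

/-- From `L` to `L + 1` the numerator grows by the factor `1 + 1/q`, while the summand `2 * q` keeps
the growth of the denominator to at most `1 + 1/(2q)`. The bonus therefore gains a fixed fraction at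
each level. -/
theorem gam_step : I.gam (L + 1) / (2 * (I.q + 1)) ≤ I.gam (L + 1) - I.gam L := by
  have hq := I.q_cast_pos
  have hx := I.x_pos L
  have hL : (0 : ℚ) ≤ L := Nat.cast_nonneg L
  have h1 : I.gam (L + 1) =
      I.x L * (I.q + 1) / (I.q * (I.q + 1) ^ 3 * (L + 1 + 2 * I.q)) := by
    rw [gam, x_succ]; push_cast; field_simp
  have h2 : I.gam (L + 1) - I.gam L - I.gam (L + 1) / (2 * (I.q + 1)) =
      I.x L * L / (2 * I.q * (I.q + 1) ^ 3 * (L + 2 * I.q) * (L + 1 + 2 * I.q)) := by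
    rw [h1, gam]; field_simp; ring
  have h3 : 0 ≤ I.gam (L + 1) - I.gam L - I.gam (L + 1) / (2 * (I.q + 1)) := by
    rw [h2]; positivity
  linarith

theorem gam_mono : Monotone I.gam := monotone_nat_of_le_succ fun L => by
  have h := I.gam_step (L := L)
  have := I.gam_pos (L := L + 1)
  have : 0 ≤ I.gam (L + 1) / (2 * (I.q + 1)) := by positivity
  linarith

/-- The left side bounds the loss of one player from taking integer parts. In `eta`, the exponent 7
consists of 2 for `grid`, 3 for `gam` and 2 for the gain here; one factor `K + 2 * q` pays for the
`K` levels and the other belongs to `gam`. -/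
theorem grid_mul_eta_le : I.grid * K * I.eta K ≤ I.gam K / (I.q + 1) ^ 2 := by
  have hq := I.q_cast_pos
  have hx := I.x_pos K
  have hK : (0 : ℚ) ≤ K := Nat.cast_nonneg K
  have h : I.gam K / (I.q + 1) ^ 2 - I.grid * K * I.eta K =
      I.x K * (2 * I.q) / ((I.q + 1) ^ 5 * (K + 2 * I.q) ^ 2) := by
    rw [gam, eta, grid]; push_cast; field_simp; ring
  have : 0 ≤ I.gam K / (I.q + 1) ^ 2 - I.grid * K * I.eta K := by rw [h]; positivity
  linarith

/-- All the bonuses of a player together stay negligible; the exponent 3 in `gam` is 2 for `grid`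
and 1 for this gain. -/
theorem grid_mul_gam_le : I.grid * L * I.gam L ≤ I.x L / (I.q + 1) := by
  have hq := I.q_cast_pos
  have hx := I.x_pos L
  have hL : (0 : ℚ) ≤ L := Nat.cast_nonneg L
  have h : I.x L / (I.q + 1) - I.grid * L * I.gam L =
      I.x L * (2 * I.q) / ((I.q + 1) * (L + 2 * I.q)) := by
    rw [gam, grid]; push_cast; field_simp; ring
  have : 0 ≤ I.x L / (I.q + 1) - I.grid * L * I.gam L := by rw [h]; positivity
  linarith

theorem gam_le : I.gam K ≤ I.x K / (I.q + 1) := by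
  have hq := I.q_cast_pos
  have hq1 : (1 : ℚ) ≤ I.q := by exact_mod_cast I.q_pos
  have hx := I.x_pos K
  have hK : (0 : ℚ) ≤ K := Nat.cast_nonneg K
  unfold gam
  apply div_le_div_of_nonneg_left hx.le (by positivity)
  calc (I.q + 1 : ℚ) = (I.q + 1) * 1 := by ring
    _ ≤ (I.q + 1) ^ 3 * (K + 2 * I.q) := by
      apply mul_le_mul _ (by linarith) (by norm_num) (by positivity)
      exact le_self_pow₀ (by linarith) (by norm_num)

theorem eta_mul_phi_le : I.eta K * I.phi K i t s ≤ I.rphi i t s := by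
  unfold phi rphi
  rw [Nat.cast_sum, Finset.mul_sum]
  refine Finset.sum_le_sum fun j _ => ?_
  have := I.del_pos (l := j / I.grid)
  have := I.gam_pos (L := I.lev i t)
  have he := I.eta_pos (K := K)
  split_ifs
  · rw [mul_comm]
    exact (le_div_iff₀ he).mp (Nat.floor_le (by positivity))
  · simp

theorem rphi_le (hK : I.lev i t ≤ K) :
    I.rphi i t s ≤ I.eta K * I.phi K i t s + I.gam K / (I.q + 1) ^ 2 := by
  have he := I.eta_pos (K := K)
  have h : I.rphi i t s ≤ I.eta K * I.phi K i t s + I.grid * I.lev i t * I.eta K := by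
    unfold phi rphi
    have : (I.grid * I.lev i t * I.eta K : ℚ) =
        ∑ j ∈ Finset.range (I.grid * I.lev i t), I.eta K := by simp
    rw [this, Nat.cast_sum, Finset.mul_sum, ← Finset.sum_add_distrib]
    refine Finset.sum_le_sum fun j _ => ?_
    split_ifs
    · have := (div_lt_iff₀ he).mp (Nat.lt_floor_add_one
        ((I.del (j / I.grid) + I.gam (I.lev i t)) / I.eta K))
      unfold wt; linarith
    · simpa using he.le
  have h1 : (I.lev i t : ℚ) ≤ K := by exact_mod_cast hK
  have h2 : (I.grid * I.lev i t * I.eta K : ℚ) ≤ I.grid * K * I.eta K := by gcongr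
  linarith [I.grid_mul_eta_le (K := K)]

theorem sum_range_mul (g : ℕ) (f : ℕ → ℚ) (L : ℕ) :
    ∑ j ∈ Finset.range (g * L), f j =
      ∑ l ∈ Finset.range L, ∑ c ∈ Finset.range g, f (g * l + c) := by
  induction L with
  | zero => simp
  | succ L ih => rw [mul_add, mul_one, Finset.sum_range_add, ih, Finset.sum_range_succ]

theorem rphi_eq : I.rphi i t s = ∑ l ∈ Finset.range (I.lev i t), ∑ c ∈ Finset.range I.grid,
    if I.pos i t l c ≤ s then I.del l + I.gam (I.lev i t) else 0 := by
  unfold rphi pt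
  rw [sum_range_mul]
  refine Finset.sum_congr rfl fun l _ => Finset.sum_congr rfl fun c hc => ?_
  have hc := Finset.mem_range.mp hc
  rw [Nat.mul_add_div grid_pos, Nat.div_eq_of_lt hc, Nat.mul_add_mod, Nat.mod_eq_of_lt hc, add_zero]

theorem sum_inc : ∑ l ∈ Finset.range L, I.inc i t l s = I.val i (I.rep i t L) s := by
  unfold inc
  rw [Finset.sum_range_sub (fun l => I.val i (I.rep i t l) s)]
  simp [rep, val]

/-- Earlier types and rounding down only decrease the value, so the excess comes from the bonuses
alone. -/
theorem rphi_le_ev (ht : t < I.sz i) (hs : s ≤ I.m) (hK : I.lev i t ≤ K) :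
    I.rphi i t s ≤ I.ev i t s + I.x K / (I.q + 1) := by
  have hq := I.q_cast_pos
  have h1 : I.rphi i t s ≤ ∑ l ∈ Finset.range (I.lev i t),
      (I.inc i t l s + I.grid * I.gam (I.lev i t)) := by
    rw [rphi_eq]
    refine Finset.sum_le_sum fun l hl => ?_
    have h2 := (sum_pos_le ht (Finset.mem_range.mp hl) hs).1
    have h3 : (I.grid * I.gam (I.lev i t) : ℚ) =
        ∑ c ∈ Finset.range I.grid, I.gam (I.lev i t) := by simp
    rw [h3]
    refine le_trans ?_ (add_le_add_left h2 _)
    rw [← Finset.sum_add_distrib]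
    refine Finset.sum_le_sum fun c _ => ?_
    have := I.gam_pos (L := I.lev i t)
    split_ifs <;> linarith
  rw [Finset.sum_add_distrib, sum_inc] at h1
  simp only [Finset.sum_const, Finset.card_range, nsmul_eq_mul] at h1
  have h4 : I.val i (I.rep i t (I.lev i t)) s ≤ I.ev i t s := by
    have h5 := rep_le (I := I) (i := i) (t := t) le_rfl
    unfold val
    split_ifs
    · exact ev_nonneg
    · exact ev_mono_type (by omega) ht hs
  have h6 := I.grid_mul_gam_le (L := I.lev i t)
  have h7 : I.x (I.lev i t) / (I.q + 1) ≤ I.x K / (I.q + 1) := by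
    gcongr; exact I.x_strictMono.monotone hK
  linarith

/-- By single crossing, the gap to the representative at `s` is at most the gap at the whole bundle.
There both lie in one level, whose width is `x l / q = x (l + 1) / (q + 1)`. -/
theorem ev_le_val (ht : t < I.sz i) (hs : s ≤ I.m) :
    I.ev i t s ≤ I.val i (I.rep i t (I.lev i t)) s + I.x (I.lev i t) / (I.q + 1) := by
  have hq := I.q_cast_pos
  have hx := I.x_pos
  rcases Nat.eq_zero_or_pos (I.lev i t) with h0 | h0
  · have h1 : I.ev i t I.m ≤ 0 := by
      by_contra! h; have := lev_pos ht h; omega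
    have h2 := (ev_mono ht hs le_rfl).trans h1
    have h3 : 0 ≤ I.x (I.lev i t) / (I.q + 1) := by have := hx (I.lev i t); positivity
    have := I.val_nonneg (i := i) (c := I.rep i t (I.lev i t)) (s := s)
    linarith
  · obtain ⟨l, hl⟩ := Nat.exists_eq_succ_of_ne_zero h0.ne'
    have h1 := rep_top ht hl
    have h2 := first_le (I := I) (i := i) (t := t) (l := l) (by omega)
    have h3 := x_le_first (I := I) (i := i) (t := t) (l := l) (by omega)
    have h4 := ev_sub_le h2 ht hs le_rfl
    have h5 := I.ev_lt_x_lev (i := i) (t := t)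
    have h6 : I.x (I.lev i t) / (I.q + 1) = I.x l / I.q := by
      rw [hl, Nat.succ_eq_add_one, x_succ]; field_simp
    rw [hl, Nat.succ_eq_add_one, x_succ] at h5
    rw [h6, hl, Nat.succ_eq_add_one, h1, val, if_neg (by omega), Nat.add_sub_cancel]
    linarith

/-- One error term comes from the choice of the representative, the other from the units `del l`,
whose geometric sum over all levels is dominated by the top. -/
theorem ev_le_rphi (ht : t < I.sz i) (hs : s ≤ I.m) (hK : I.lev i t ≤ K) :
    I.ev i t s ≤ I.rphi i t s + 2 * (I.x K / (I.q + 1)) := by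
  have hq := I.q_cast_pos
  have h1 : ∑ l ∈ Finset.range (I.lev i t), (I.inc i t l s - I.del l) ≤ I.rphi i t s := by
    rw [rphi_eq]
    refine Finset.sum_le_sum fun l hl => ?_
    refine (sum_pos_le ht (Finset.mem_range.mp hl) hs).2.trans (Finset.sum_le_sum fun c _ => ?_)
    have := I.gam_pos (L := I.lev i t)
    split_ifs <;> linarith
  rw [Finset.sum_sub_distrib, sum_inc] at h1
  have h2 : ∑ l ∈ Finset.range (I.lev i t), I.del l ≤ I.x (I.lev i t) / (I.q + 1) := by
    unfold del
    rw [← Finset.sum_div, div_le_div_iff₀ (by positivity) (by positivity)]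
    have := mul_le_mul_of_nonneg_right (I.sum_x (I.lev i t)) (show (0 : ℚ) ≤ I.q + 1 by positivity)
    linarith
  have h3 := ev_le_val ht hs
  have h7 : I.x (I.lev i t) / (I.q + 1) ≤ I.x K / (I.q + 1) := by
    gcongr; exact I.x_strictMono.monotone hK
  linarith

/-! ### Approximation -/

/-- Of the four error terms per player, three come from underestimating `o` (two from `ev_le_rphi`,
one from integer parts) and one from overestimating `A`. -/
theorem IsOpt.wel_le {t A o : ℕ → ℕ} (ht : I.Valid t) (hA : I.IsOpt t A) (ho : I.Feasible o) :
    I.wel t o ≤ I.wel t A + 4 * I.n * (I.x (I.scale t) / (I.q + 1)) := by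
  have hq := I.q_cast_pos
  set K := I.scale t with hK
  set y := I.x K / (I.q + 1) with hy
  have hη := I.eta_pos (K := K)
  have h1 : I.wel t o ≤ I.eta K * I.obj t o + I.n * (3 * y) := by
    unfold wel obj
    have : (I.n * (3 * y) : ℚ) = ∑ i ∈ Finset.range I.n, 3 * y := by simp
    rw [this, Nat.cast_sum, Finset.mul_sum, ← Finset.sum_add_distrib]
    refine Finset.sum_le_sum fun i hi => ?_
    have hi := Finset.mem_range.mp hi
    have h2 := ev_le_rphi (ht i hi) (ho.le hi) (lev_le_scale t hi)
    have h3 := rphi_le (I := I) (s := o i) (lev_le_scale t hi)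
    have h4 : I.gam K / (I.q + 1) ^ 2 ≤ y :=
      (div_le_self gam_pos.le (one_le_pow₀ (by linarith))).trans gam_le
    linarith
  have h2 : I.eta K * I.obj t A ≤ I.wel t A + I.n * y := by
    unfold wel obj
    have : (I.n * y : ℚ) = ∑ i ∈ Finset.range I.n, y := by simp
    rw [this, Nat.cast_sum, Finset.mul_sum, ← Finset.sum_add_distrib]
    refine Finset.sum_le_sum fun i hi => ?_
    have hi := Finset.mem_range.mp hi
    exact eta_mul_phi_le.trans (rphi_le_ev (ht i hi) (hA.feasible.le hi) (lev_le_scale t hi))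
  have h3 : I.obj t o ≤ I.obj t A := by
    rcases hA.best o ho with h | h
    · exact h.le
    · exact h.1.le
  have h4 : I.eta K * I.obj t o ≤ I.eta K * I.obj t A := by gcongr
  linarith

theorem wel_nonneg {t s : ℕ → ℕ} : 0 ≤ I.wel t s := Finset.sum_nonneg fun _ _ => ev_nonneg

theorem IsOpt.approx {t A o : ℕ → ℕ} (ht : I.Valid t) (hA : I.IsOpt t A) (ho : I.Feasible o) :
    (1 - 1 / (I.a + 1)) * I.wel t o ≤ I.wel t A := by
  have hq := I.q_cast_pos
  have ha : (0 : ℚ) < I.a + 1 := by positivity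
  have hr : (0 : ℚ) ≤ 1 - 1 / (I.a + 1) := by
    rw [sub_nonneg, div_le_one ha]; have : (0 : ℚ) ≤ I.a := Nat.cast_nonneg _; linarith
  rcases Nat.eq_zero_or_pos (I.scale t) with h0 | h0
  · have : I.wel t o ≤ 0 := Finset.sum_nonpos fun i hi => by
      have hi := Finset.mem_range.mp hi
      have h1 := lev_le_scale t hi
      refine (ev_mono (ht i hi) (ho.le hi) le_rfl).trans ?_
      by_contra! h
      have := lev_pos (ht i hi) h
      omega
    rw [le_antisymm this wel_nonneg, mul_zero]
    exact wel_nonneg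
  obtain ⟨k, hk⟩ := Nat.exists_eq_succ_of_ne_zero h0.ne'
  obtain ⟨i, hi, hik⟩ : ∃ i < I.n, k < I.lev i (t i) := by
    by_contra! h
    have : I.scale t ≤ k := Finset.sup_le fun i hi => h i (Finset.mem_range.mp hi)
    omega
  have hxk := lt_lev_iff.mp hik
  have hy : I.x (I.scale t) / (I.q + 1) = I.x k / I.q := by
    rw [hk, Nat.succ_eq_add_one, x_succ]; field_simp
  have hq' : (I.q : ℚ) = 4 * (I.n + 1) * (I.a + 1) := by unfold q; push_cast; ring
  have hxp := I.x_pos k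
  -- This fixes the factor `4 * (n + 1) * (a + 1)` in `q`.
  have hloss : 4 * I.n * (I.x k / I.q) ≤ I.x k / (I.a + 1) := by
    rw [mul_div_assoc', div_le_div_iff₀ hq ha, hq']
    have : 0 ≤ I.x k * (I.a + 1) := by positivity
    nlinarith
  have key : ∀ o', I.Feasible o' → I.x k ≤ I.wel t o' →
      (1 - 1 / (I.a + 1)) * I.wel t o' ≤ I.wel t A := by
    intro o' ho' hw
    have h1 := hA.wel_le ht ho'
    rw [hy] at h1
    have h2 : I.x k / (I.a + 1) ≤ I.wel t o' / (I.a + 1) := by gcongr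
    rw [sub_mul, one_mul, one_div_mul_eq_div]
    linarith
  rcases le_total (I.x k) (I.wel t o) with h | h
  · exact key o ho h
  -- If `o` is worth less than the top level, selling everything to a player on that level is at
  -- least as good and meets the hypothesis of `key`.
  · let o' : ℕ → ℕ := fun j => if j = i then I.m else 0
    have h1 : I.Feasible o' := by simp [Feasible, o', hi]
    have h2 : I.x k ≤ I.wel t o' := by
      refine hxk.trans ?_
      have := Finset.single_le_sum (f := fun j => I.ev j (t j) (o' j))
        (fun _ _ => ev_nonneg) (Finset.mem_range.mpr hi)
      simpa [o', wel] using this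
    exact (mul_le_mul_of_nonneg_left (h.trans h2) hr).trans (key o' h1 h2)

/-! ### Codes of allocations -/

theorem digit_eq {B : ℕ} (c : ℕ) (i : ℕ) : ∀ (n : ℕ) (f : ℕ → ℕ), (∀ k < n, f k < B) → i < n →
    ((∑ k ∈ Finset.range n, f k * B ^ k) + c * B ^ n) / B ^ i % B = f i := by
  induction i with
  | zero =>
    intro n f hf hn
    obtain ⟨n, rfl⟩ := Nat.exists_eq_succ_of_ne_zero (by omega : n ≠ 0)
    rw [Finset.sum_range_succ']
    have : (∑ k ∈ Finset.range n, f (k + 1) * B ^ (k + 1)) + f 0 * B ^ 0 + c * B ^ (n + 1) =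
        f 0 + B * ((∑ k ∈ Finset.range n, f (k + 1) * B ^ k) + c * B ^ n) := by
      rw [mul_add, Finset.mul_sum]
      have : ∀ k, f (k + 1) * B ^ (k + 1) = B * (f (k + 1) * B ^ k) := fun k => by ring
      simp only [this]; ring
    rw [this, pow_zero, Nat.div_one, Nat.add_mul_mod_self_left, Nat.mod_eq_of_lt (hf 0 hn)]
  | succ i ih =>
    intro n f hf hn
    obtain ⟨n, rfl⟩ := Nat.exists_eq_succ_of_ne_zero (by omega : n ≠ 0)
    have h0 := hf 0 (by omega)
    rw [Finset.sum_range_succ']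
    have : (∑ k ∈ Finset.range n, f (k + 1) * B ^ (k + 1)) + f 0 * B ^ 0 + c * B ^ (n + 1) =
        f 0 + B * ((∑ k ∈ Finset.range n, f (k + 1) * B ^ k) + c * B ^ n) := by
      rw [mul_add, Finset.mul_sum]
      have : ∀ k, f (k + 1) * B ^ (k + 1) = B * (f (k + 1) * B ^ k) := fun k => by ring
      simp only [this]; ring
    rw [this, pow_succ', ← Nat.div_div_eq_div_mul, Nat.add_mul_div_left _ _ (by omega),
      Nat.div_eq_of_lt h0, zero_add]
    exact ih n (fun k => f (k + 1)) (fun k hk => hf _ (by omega)) (by omega)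

theorem code_eq (s : ℕ → ℕ) : I.code s = (∑ k ∈ Finset.range I.n, s k * (I.m + 2) ^ k) +
    (∑ k ∈ Finset.range I.n, s k) * (I.m + 2) ^ I.n := by
  unfold code
  rw [Finset.sum_mul, ← Finset.sum_add_distrib]
  exact Finset.sum_congr rfl fun k _ => by ring

theorem digit_code {s : ℕ → ℕ} (hs : I.Feasible s) (hi : i < I.n) :
    I.code s / (I.m + 2) ^ i % (I.m + 2) = s i := by
  rw [code_eq]
  exact digit_eq _ _ _ _ (fun k hk => by have := hs.le hk; omega) hi

theorem sum_digits_lt {B : ℕ} (n : ℕ) (f : ℕ → ℕ) (hf : ∀ k < n, f k < B) :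
    ∑ k ∈ Finset.range n, f k * B ^ k < B ^ n := by
  induction n with
  | zero => simp
  | succ n ih =>
    have h1 := ih fun k hk => hf k (by omega)
    have h2 : (f n + 1) * B ^ n ≤ B * B ^ n := Nat.mul_le_mul_right _ (hf n (by omega))
    rw [Finset.sum_range_succ, pow_succ']
    linarith

/-- The leading digit counts the items sold. If the allocation is feasible, the other digits do not
carry into it; if not, the leading term alone is too large. A cap on codes thus enforces the supply
constraint in the dynamic program. -/
theorem code_lt_iff {s : ℕ → ℕ} : I.code s < (I.m + 1) * (I.m + 2) ^ I.n ↔ I.Feasible s := by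
  rw [code_eq]
  constructor
  · intro h
    by_contra h'
    have h1 : (I.m + 1) * (I.m + 2) ^ I.n ≤
        (∑ k ∈ Finset.range I.n, s k) * (I.m + 2) ^ I.n :=
      Nat.mul_le_mul_right _ (by unfold Feasible at h'; omega)
    omega
  · intro h
    have h1 := sum_digits_lt I.n s (B := I.m + 2) fun k hk => by have := h.le hk; omega
    have h2 : (∑ k ∈ Finset.range I.n, s k) * (I.m + 2) ^ I.n ≤ I.m * (I.m + 2) ^ I.n :=
      Nat.mul_le_mul_right _ h
    linarith

/-! ### Monotonicity -/

/-- Only jumps in `(s, s']` count. Their weights do not decrease, and one such jump contributes the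
surplus `g`. -/
theorem sum_step_sub_le (S : ℕ) (p : ℕ → ℕ) (w w' : ℕ → ℚ) (hw : ∀ j < S, w j ≤ w' j)
    {s s' : ℕ} (hs : s ≤ s') (g : ℚ)
    (hg : g = 0 ∨ ∃ j < S, s < p j ∧ p j ≤ s' ∧ w j + g ≤ w' j) :
    (∑ j ∈ Finset.range S, if p j ≤ s' then w j else 0) -
      (∑ j ∈ Finset.range S, if p j ≤ s then w j else 0) + g ≤
    (∑ j ∈ Finset.range S, if p j ≤ s' then w' j else 0) -
      (∑ j ∈ Finset.range S, if p j ≤ s then w' j else 0) := by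
  have h1 : g ≤ ∑ j ∈ Finset.range S, if s < p j ∧ p j ≤ s' then w' j - w j else 0 := by
    have hnn : ∀ j ∈ Finset.range S, (0 : ℚ) ≤ if s < p j ∧ p j ≤ s' then w' j - w j else 0 := by
      intro j hj
      have := hw j (Finset.mem_range.mp hj)
      split_ifs <;> linarith
    rcases hg with rfl | ⟨j, hj, h2, h3, h4⟩
    · exact Finset.sum_nonneg hnn
    · refine le_trans ?_ (Finset.single_le_sum hnn (Finset.mem_range.mpr hj))
      rw [if_pos ⟨h2, h3⟩]; linarith
  rw [← Finset.sum_sub_distrib, ← Finset.sum_sub_distrib]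
  refine (add_le_add_right h1 _).trans ?_
  rw [← Finset.sum_add_distrib]
  refine Finset.sum_le_sum fun j _ => ?_
  by_cases ha : p j ≤ s
  · simp [ha, ha.trans hs, not_lt.mpr ha]
  · by_cases hb : p j ≤ s'
    · simp [ha, hb, not_le.mp ha]
    · simp [ha, hb]

/-- Jumps that the lower type lacks are given weight 0, so that two types can be compared jump by
jump. -/
theorem sum_step_extend {S S' : ℕ} (hS : S ≤ S') {p p' : ℕ → ℕ}
    (hp : ∀ j < S, p' j = p j) (w : ℕ → ℚ) (s : ℕ) :
    (∑ j ∈ Finset.range S, if p j ≤ s then w j else 0) =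
      ∑ j ∈ Finset.range S', if p' j ≤ s then (if j < S then w j else 0) else 0 := by
  have : ∀ j ∈ Finset.range S', (if p' j ≤ s then (if j < S then w j else 0) else 0) =
      if j ∈ Finset.range S then (if p j ≤ s then w j else 0) else 0 := by
    intro j _
    by_cases h : j < S
    · simp [h, hp j h]
    · simp [h]
  rw [Finset.sum_congr rfl this, Finset.sum_ite_mem, Finset.inter_eq_right.mpr]
  exact Finset.range_subset_range.mpr hS

theorem grid_mul_lev_mono (htt : t ≤ t') (ht : t' < I.sz i) :
    I.grid * I.lev i t ≤ I.grid * I.lev i t' := Nat.mul_le_mul_left _ (lev_mono htt ht)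

theorem phi_sub_le (htt : t ≤ t') (ht : t' < I.sz i) (hs : s ≤ s') :
    (I.phi K i t s' : ℚ) - I.phi K i t s ≤ I.phi K i t' s' - I.phi K i t' s := by
  have hL := grid_mul_lev_mono htt ht
  unfold phi
  push_cast
  rw [sum_step_extend hL (p' := I.pt i t') fun j hj => pt_congr htt hj,
    sum_step_extend hL (p' := I.pt i t') fun j hj => pt_congr htt hj]
  have := sum_step_sub_le (I.grid * I.lev i t') (I.pt i t')
    (fun j => if j < I.grid * I.lev i t then (I.wt K (j / I.grid) (I.lev i t) : ℚ) else 0)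
    (fun j => (I.wt K (j / I.grid) (I.lev i t') : ℚ)) (fun j _ => ?_) hs 0 (Or.inl rfl)
  · simpa using this
  · split_ifs
    · have := I.eta_pos (K := K)
      have := I.gam_mono (lev_mono htt ht)
      unfold wt; gcongr
    · positivity

theorem rphi_sub_le (htt : t ≤ t') (ht : t' < I.sz i) {j : ℕ} (hj : j < I.grid * I.lev i t)
    (h1 : s < I.pt i t j) (h2 : I.pt i t j ≤ s') :
    I.rphi i t s' - I.rphi i t s + (I.gam (I.lev i t') - I.gam (I.lev i t)) ≤
      I.rphi i t' s' - I.rphi i t' s := by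
  have hL := grid_mul_lev_mono htt ht
  have hg := I.gam_mono (lev_mono htt ht)
  unfold rphi
  rw [sum_step_extend hL (p' := I.pt i t') fun j hj => pt_congr htt hj,
    sum_step_extend hL (p' := I.pt i t') fun j hj => pt_congr htt hj]
  refine sum_step_sub_le (I.grid * I.lev i t') (I.pt i t')
    (fun j => if j < I.grid * I.lev i t then I.del (j / I.grid) + I.gam (I.lev i t) else 0)
    (fun j => I.del (j / I.grid) + I.gam (I.lev i t')) (fun j _ => ?_) (h1.trans_le h2).le _
    (Or.inr ⟨j, hj.trans_le hL, ?_, ?_, ?_⟩)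
  · split_ifs
    · linarith
    · have := I.del_pos (l := j / I.grid); have := I.gam_pos (L := I.lev i t'); positivity
  · rwa [pt_congr htt hj]
  · rwa [pt_congr htt hj]
  · rw [if_pos hj]; linarith

/-- If the scale rises, the bonus of the player who causes this exceeds all rounding errors. -/
theorem error_lt_gap {K' : ℕ} (hLK : L ≤ K) (hK : K < K') :
    I.n * (I.gam K / (I.q + 1) ^ 2) + I.n * (I.gam K' / (I.q + 1) ^ 2) <
      I.gam K' - I.gam L := by
  obtain ⟨k, rfl⟩ := Nat.exists_eq_succ_of_ne_zero (by omega : K' ≠ 0)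
  have hq := I.q_cast_pos
  have h1 := I.gam_step (L := k)
  have h2 := I.gam_mono (show L ≤ k by omega)
  have h3 := I.gam_mono hK.le
  have h4 := I.gam_pos (L := k + 1)
  -- The total error is at most `2n / (q + 1) ^ 2` of the new bonus and the gain is at least `1 / (2
  -- * (q + 1))` of it.
  have h5 : (4 * I.n : ℚ) < I.q + 1 := by
    have : 4 * I.n < I.q + 1 := by unfold q; nlinarith [Nat.zero_le I.n, Nat.zero_le I.a]
    exact_mod_cast this
  have h6 : I.n * (I.gam K / (I.q + 1) ^ 2) ≤ I.n * (I.gam (k + 1) / (I.q + 1) ^ 2) := by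
    gcongr
  have h7 : 2 * (I.n * (I.gam (k + 1) / (I.q + 1) ^ 2)) < I.gam (k + 1) / (2 * (I.q + 1)) := by
    rw [mul_div_assoc', mul_div_assoc', div_lt_div_iff₀ (by positivity) (by positivity)]
    have : 0 < I.gam (k + 1) * (I.q + 1) := by positivity
    nlinarith
  simp only [Nat.succ_eq_add_one]
  linarith

theorem sum_sub_sum_eq {f g : ℕ → ℚ} (hi : i < I.n) (h : ∀ j < I.n, j ≠ i → f j = g j) :
    (∑ j ∈ Finset.range I.n, f j) - ∑ j ∈ Finset.range I.n, g j = f i - g i := by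
  rw [← Finset.sum_sub_distrib]
  refine Finset.sum_eq_single i (fun j hj hne => ?_) (fun h => absurd (Finset.mem_range.mpr hi) h)
  rw [h j (Finset.mem_range.mp hj) hne, sub_self]

theorem IsOpt.mono {t t' A A' : ℕ → ℕ} (ht : I.Valid t') (hi : i < I.n)
    (htt : t i ≤ t' i) (hne : ∀ j, j ≠ i → t j = t' j) (hA : I.IsOpt t A) (hA' : I.IsOpt t' A') :
    A i ≤ A' i := by
  by_contra! hlt
  have hti := ht i hi
  have hK : I.scale t ≤ I.scale t' := Finset.sup_le fun j hj => by
    have hj := Finset.mem_range.mp hj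
    refine le_trans ?_ (lev_le_scale t' hj)
    by_cases h : j = i
    · subst h; exact lev_mono htt hti
    · rw [hne j h]
  have hb : I.obj t A' ≤ I.obj t A := by
    rcases hA.best A' hA'.feasible with h | h
    · exact h.le
    · exact h.1.le
  have hb' : I.obj t' A ≤ I.obj t' A' := by
    rcases hA'.best A hA.feasible with h | h
    · exact h.le
    · exact h.1.le
  rcases hK.eq_or_lt with hK | hK
  -- In a common unit, larger marginal values of the higher type force ties in both profiles. Both
  -- allocations then have the least code among tied ones, hence equal codes and equal digits.
  · have h1 := phi_sub_le (K := I.scale t) htt hti hlt.le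
    have h2 : ∀ s : ℕ → ℕ, (I.obj t' s : ℚ) - I.obj t s =
        I.phi (I.scale t) i (t' i) (s i) - I.phi (I.scale t) i (t i) (s i) := by
      intro s
      unfold obj
      rw [← hK]
      push_cast
      exact sum_sub_sum_eq hi fun j _ hj => by rw [hne j hj]
    have h3 := h2 A
    have h4 := h2 A'
    have hb1 : (I.obj t A' : ℚ) ≤ I.obj t A := by exact_mod_cast hb
    have hb1' : (I.obj t' A : ℚ) ≤ I.obj t' A' := by exact_mod_cast hb'
    have e1 : I.obj t A' = I.obj t A := by
      have : (I.obj t A' : ℚ) = I.obj t A := by linarith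
      exact_mod_cast this
    have e2 : I.obj t' A = I.obj t' A' := by
      have : (I.obj t' A : ℚ) = I.obj t' A' := by linarith
      exact_mod_cast this
    have c1 : I.code A ≤ I.code A' := by
      rcases hA.best A' hA'.feasible with h | h
      · omega
      · exact h.2
    have c2 : I.code A' ≤ I.code A := by
      rcases hA'.best A hA.feasible with h | h
      · omega
      · exact h.2
    have := digit_code hA.feasible hi
    have := digit_code hA'.feasible hi
    rw [le_antisymm c1 c2] at *
    omega
  -- The units differ, so the comparison is made in the rational objective `R`. Only player `i`
  -- changed, so it is this player who sets the new scale.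
  · have hL : I.lev i (t' i) = I.scale t' := by
      refine le_antisymm (lev_le_scale t' hi) ?_
      by_contra! h
      have : I.scale t' ≤ max (I.scale t) (I.lev i (t' i)) := Finset.sup_le fun j hj => by
        have hj := Finset.mem_range.mp hj
        by_cases hji : j = i
        · subst hji; exact le_max_right _ _
        · rw [← hne j hji]; exact (lev_le_scale t hj).trans (le_max_left _ _)
      rcases le_max_iff.mp this with h' | h' <;> omega
    -- The quantity `A i` exceeds `A' i`, so it is a jump rather than 0, and it is a jump of both
    -- types. It earns the strict surplus.
    obtain ⟨j, hj, hAj⟩ := (hA.candidate i hi).resolve_left (by omega)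
    have h1 := rphi_sub_le htt hti hj (s := A' i) (s' := A i) (by omega) hAj.ge
    have hgap := I.error_lt_gap (lev_le_scale t hi) hK
    rw [hL] at h1
    let R : (ℕ → ℕ) → (ℕ → ℕ) → ℚ := fun t s => ∑ k ∈ Finset.range I.n, I.rphi k (t k) (s k)
    have h2 : ∀ s, R t' s - R t s = I.rphi i (t' i) (s i) - I.rphi i (t i) (s i) := fun s =>
      sum_sub_sum_eq hi fun j _ hj => by rw [hne j hj]
    have lo : ∀ t s, I.eta (I.scale t) * I.obj t s ≤ R t s := fun t s => by
      unfold obj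
      rw [Nat.cast_sum, Finset.mul_sum]
      exact Finset.sum_le_sum fun k _ => eta_mul_phi_le
    have up : ∀ t s, R t s ≤ I.eta (I.scale t) * I.obj t s +
        I.n * (I.gam (I.scale t) / (I.q + 1) ^ 2) := fun t s => by
      unfold obj
      have : (I.n * (I.gam (I.scale t) / (I.q + 1) ^ 2) : ℚ) =
          ∑ k ∈ Finset.range I.n, I.gam (I.scale t) / (I.q + 1) ^ 2 := by simp
      rw [this, Nat.cast_sum, Finset.mul_sum, ← Finset.sum_add_distrib]
      exact Finset.sum_le_sum fun k hk => rphi_le (lev_le_scale t (Finset.mem_range.mp hk))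
    have e1 : I.eta (I.scale t) * I.obj t A' ≤ I.eta (I.scale t) * I.obj t A := by
      have := I.eta_pos (K := I.scale t); gcongr
    have e2 : I.eta (I.scale t') * I.obj t' A ≤ I.eta (I.scale t') * I.obj t' A' := by
      have := I.eta_pos (K := I.scale t'); gcongr
    have := h2 A
    have := h2 A'
    have := lo t A
    have := up t A'
    have := lo t' A'
    have := up t' A
    linarith

end Inst

namespace Inst

variable (I : Inst)

/-! ### Dynamic programming -/

/-- The minimum of `b` and the first values of `f`. -/
def minUpTo (b : ℕ) (f : ℕ → ℕ) : ℕ → ℕ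
  | 0 => b
  | j + 1 => if f j < minUpTo b f j then f j else minUpTo b f j

/-- The quantities that player `i` may receive, for `j < grid * lev i t + 1`. -/
def cand (i t j : ℕ) : ℕ := if j = 0 then 0 else I.pt i t (j - 1)

/-- A bound for the codes of allocations. -/
def top : ℕ := (I.m + 1) * (I.m + 2) ^ I.n

/-- The number of candidate quantities. -/
def numCand (i t : ℕ) : ℕ := I.grid * I.lev i t + 1

/-- The value at `v` that player `i` obtains from the values `D` of the previous players and his
`j`-th candidate quantity. -/
def relax (K : ℕ) (t : ℕ → ℕ) (i : ℕ) (D : ℕ → ℕ) (v j : ℕ) : ℕ :=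
  if I.phi K i (t i) (I.cand i (t i) j) ≤ v then
    D (v - I.phi K i (t i) (I.cand i (t i) j)) +
      I.cand i (t i) j * ((I.m + 2) ^ I.n + (I.m + 2) ^ i)
  else I.top

/-- The least code of an allocation to the first players with objective value exactly `v`, and
`top` if there is none. -/
def dp (K : ℕ) (t : ℕ → ℕ) : ℕ → ℕ → ℕ
  | 0, v => if v = 0 then 0 else I.top
  | i + 1, v => minUpTo I.top (I.relax K t i (dp K t i) v) (I.numCand i (t i))

/-- A bound for the objective value. -/
def objBound (t : ℕ → ℕ) : ℕ := ∑ i ∈ Finset.range I.n, I.phi (I.scale t) i (t i) I.m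

/-- The greatest objective value below `v` that is attained. -/
def best (t : ℕ → ℕ) : ℕ → ℕ
  | 0 => 0
  | v + 1 => if I.dp (I.scale t) t I.n v < I.top then v else best t v

/-- The allocation computed by the algorithm. -/
def alloc (t : ℕ → ℕ) (i : ℕ) : ℕ :=
  I.dp (I.scale t) t I.n (I.best t (I.objBound t + 1)) / (I.m + 2) ^ i % (I.m + 2)

variable {I} {i t t' s s' K : ℕ}

theorem minUpTo_le_left (b : ℕ) (f : ℕ → ℕ) (j : ℕ) : minUpTo b f j ≤ b := by
  induction j with
  | zero => rfl
  | succ j ih => rw [minUpTo]; split_ifs <;> omega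

theorem minUpTo_le {b : ℕ} {f : ℕ → ℕ} {j k : ℕ} (h : k < j) : minUpTo b f j ≤ f k := by
  induction j with
  | zero => omega
  | succ j ih =>
    rw [minUpTo]
    rcases Nat.lt_succ_iff_lt_or_eq.mp h with h | rfl
    · have := ih h; split_ifs <;> omega
    · split_ifs <;> omega

theorem minUpTo_eq (b : ℕ) (f : ℕ → ℕ) (j : ℕ) :
    minUpTo b f j = b ∨ ∃ k < j, minUpTo b f j = f k := by
  induction j with
  | zero => exact Or.inl rfl
  | succ j ih =>
    rw [minUpTo]
    split_ifs
    · exact Or.inr ⟨j, by omega, rfl⟩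
    · rcases ih with h | ⟨k, hk, h⟩
      · exact Or.inl h
      · exact Or.inr ⟨k, by omega, h⟩

/-- The step function is constant between jumps: the largest candidate not above `s` has the same
value. -/
theorem exists_cand (K i t s : ℕ) :
    ∃ j < I.numCand i t, I.cand i t j ≤ s ∧ I.phi K i t (I.cand i t j) = I.phi K i t s := by
  obtain ⟨j, hj, hmax⟩ := Finset.exists_max_image
    ((Finset.range (I.numCand i t)).filter fun j => I.cand i t j ≤ s) (I.cand i t)
    ⟨0, Finset.mem_filter.mpr ⟨by simp [numCand], by simp [cand]⟩⟩
  simp only [Finset.mem_filter, Finset.mem_range] at hj hmax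
  refine ⟨j, hj.1, hj.2, Finset.sum_congr rfl fun k hk => ?_⟩
  have hk := Finset.mem_range.mp hk
  have : I.pt i t k ≤ I.cand i t j ↔ I.pt i t k ≤ s := by
    refine ⟨fun h => h.trans hj.2, fun h => ?_⟩
    have := hmax (k + 1) ⟨by unfold numCand; omega, by simpa [cand] using h⟩
    simpa [cand] using this
  simp only [this]

theorem dp_le_top (K : ℕ) (t : ℕ → ℕ) (i v : ℕ) : I.dp K t i v ≤ I.top := by
  cases i with
  | zero => rw [dp]; split_ifs <;> omega
  | succ i => exact minUpTo_le_left _ _ _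

theorem dp_sound {t : ℕ → ℕ} : ∀ v, I.dp K t i v < I.top → ∃ s : ℕ → ℕ,
    (∀ k < i, ∃ j < I.numCand k (t k), s k = I.cand k (t k) j) ∧
    ∑ k ∈ Finset.range i, I.phi K k (t k) (s k) = v ∧
    ∑ k ∈ Finset.range i, s k * ((I.m + 2) ^ I.n + (I.m + 2) ^ k) = I.dp K t i v := by
  induction i with
  | zero =>
    intro v h
    rw [dp] at h ⊢
    split_ifs at h ⊢ with h0
    · exact ⟨0, by simp, by simp [h0], by simp⟩
    · omega
  | succ i ih =>
    intro v h
    rw [dp] at h ⊢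
    rcases minUpTo_eq I.top (I.relax K t i (I.dp K t i) v) (I.numCand i (t i)) with h1 | ⟨j, hj, h1⟩
    · omega
    · rw [h1, relax] at h
      rw [h1, relax]
      split_ifs at h ⊢ with h2
      · obtain ⟨s, hs1, hs2, hs3⟩ := ih _ ((Nat.le_add_right _ _).trans_lt h)
        have hk : ∀ k ∈ Finset.range i, k ≠ i := fun k hk => (Finset.mem_range.mp hk).ne
        refine ⟨Function.update s i (I.cand i (t i) j), fun k hk => ?_, ?_, ?_⟩
        · by_cases hki : k = i
          · subst hki; exact ⟨j, hj, by simp⟩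
          · rw [Function.update_of_ne hki]; exact hs1 k (by omega)
        · rw [Finset.sum_range_succ, Function.update_self, Finset.sum_congr rfl fun k h => by
            rw [Function.update_of_ne (hk k h)], hs2]
          omega
        · rw [Finset.sum_range_succ, Function.update_self, Finset.sum_congr rfl fun k h => by
            rw [Function.update_of_ne (hk k h)], hs3]
      · omega

/-- Lowering every quantity to a candidate keeps the objective and does not raise the code, and both
are additive over the players. -/
theorem dp_complete {t : ℕ → ℕ} (s : ℕ → ℕ) :
    I.dp K t i (∑ k ∈ Finset.range i, I.phi K k (t k) (s k)) ≤
      ∑ k ∈ Finset.range i, s k * ((I.m + 2) ^ I.n + (I.m + 2) ^ k) := by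
  induction i with
  | zero => simp [dp]
  | succ i ih =>
    obtain ⟨j, hj, hj1, hj2⟩ := I.exists_cand K i (t i) (s i)
    rw [dp]
    refine (minUpTo_le hj).trans ?_
    rw [relax, hj2, if_pos (by rw [Finset.sum_range_succ]; omega), Finset.sum_range_succ,
      Finset.sum_range_succ, Nat.add_sub_cancel]
    exact Nat.add_le_add ih (Nat.mul_le_mul_right _ hj1)

theorem best_spec (t : ℕ → ℕ) {v w : ℕ} (hw : I.dp (I.scale t) t I.n w < I.top) (h : w < v) :
    w ≤ I.best t v ∧ I.dp (I.scale t) t I.n (I.best t v) < I.top := by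
  induction v with
  | zero => omega
  | succ v ih =>
    rw [best]
    split_ifs with h1
    · exact ⟨by omega, h1⟩
    · rcases Nat.lt_succ_iff_lt_or_eq.mp h with h | rfl
      · exact ih h
      · exact absurd hw h1

theorem best_le_pred (t : ℕ → ℕ) (v : ℕ) : I.best t (v + 1) ≤ v := by
  induction v with
  | zero => rw [best]; split_ifs <;> simp [best]
  | succ v ih => rw [best]; split_ifs <;> omega

theorem best_le (t : ℕ → ℕ) (v : ℕ) : I.best t v ≤ v := by
  cases v with
  | zero => rfl
  | succ v => exact (best_le_pred t v).trans (Nat.le_succ v)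

theorem phi_mono (K i t : ℕ) : Monotone (I.phi K i t) := fun s s' h => by
  refine Finset.sum_le_sum fun j _ => ?_
  split_ifs with h1 h2
  · rfl
  · exact absurd (h1.trans h) h2
  · exact Nat.zero_le _
  · rfl

theorem alloc_isOpt (t : ℕ → ℕ) : I.IsOpt t (I.alloc t) := by
  have hcode : ∀ s, I.Feasible s → I.dp (I.scale t) t I.n (I.obj t s) ≤ I.code s :=
    fun s _ => dp_complete s
  have hobj : ∀ s, I.Feasible s → I.obj t s < I.objBound t + 1 := fun s hs =>
    Nat.lt_succ_of_le (Finset.sum_le_sum fun i hi =>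
      phi_mono _ _ _ (hs.le (Finset.mem_range.mp hi)))
  have hdp : ∀ s, I.Feasible s → I.dp (I.scale t) t I.n (I.obj t s) < I.top := fun s hs =>
    (hcode s hs).trans_lt (code_lt_iff.mpr hs)
  have hbest := fun s hs => I.best_spec t (hdp s hs) (hobj s hs)
  -- The zero allocation shows that some objective value is attained.
  obtain ⟨s, hs1, hs2, hs3⟩ := dp_sound _
    (hbest (fun _ => 0) (by simp [Feasible])).2
  have hsf : I.Feasible s := code_lt_iff.mp (by
    unfold code; rw [hs3]; exact (hbest (fun _ => 0) (by simp [Feasible])).2)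
  have hA : ∀ i < I.n, I.alloc t i = s i := fun i hi => by
    unfold alloc; rw [← hs3]; exact digit_code hsf hi
  have hA' : ∀ i ∈ Finset.range I.n, I.alloc t i = s i := fun i hi => hA i (Finset.mem_range.mp hi)
  have e1 : I.obj t (I.alloc t) = I.best t (I.objBound t + 1) := by
    rw [← hs2]; exact Finset.sum_congr rfl fun i hi => by rw [hA' i hi]
  have e2 : I.code (I.alloc t) = I.dp (I.scale t) t I.n (I.best t (I.objBound t + 1)) := by
    rw [← hs3]; exact Finset.sum_congr rfl fun i hi => by rw [hA' i hi]
  refine ⟨?_, fun i hi => ?_, fun s' hs' => ?_⟩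
  · unfold Feasible; rw [Finset.sum_congr rfl hA']; exact hsf
  · obtain ⟨j, hj, h⟩ := hs1 i hi
    rw [hA i hi, h, cand]
    split_ifs with h0
    · exact Or.inl rfl
    · exact Or.inr ⟨j - 1, by unfold numCand at hj; omega, rfl⟩
  · have h1 := (hbest s' hs').1
    rcases h1.lt_or_eq with h1 | h1
    · exact Or.inl (by omega)
    · refine Or.inr ⟨by omega, ?_⟩
      rw [e2, ← h1]; exact hcode s' hs'

/-! ### Payments -/

/-- The payment of type `T` in the mechanism with outcome `f u` for type `u`. -/
def payment (v : ℕ → ℕ → ℚ) (f : ℕ → ℕ) (T : ℕ) : ℚ :=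
  ∑ u ∈ Finset.range T, (v (u + 1) (f (u + 1)) - v (u + 1) (f u))

/-- The first type with the outcome of type `c`. -/
def jump (f : ℕ → ℕ) (c : ℕ) : ℕ := lst (c + 1) fun u => f c ≤ f u

/-- The greatest type with another outcome than type `c`. -/
def prev (f : ℕ → ℕ) (c : ℕ) : ℕ := jump f c - 1

/-- The increase of the payment at the jump below type `c`. -/
def jumpTerm (v : ℕ → ℕ → ℚ) (f : ℕ → ℕ) (c : ℕ) : ℚ :=
  if jump f c = 0 then 0 else v (jump f c) (f (jump f c)) - v (jump f c) (f (prev f c))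

theorem jump_le (f : ℕ → ℕ) (c : ℕ) : jump f c ≤ c := lst_le_of le_rfl

section payment

variable {v : ℕ → ℕ → ℚ} {f : ℕ → ℕ} {T : ℕ}

theorem eq_of_jump_le (hf : ∀ u u', u ≤ u' → u' ≤ T → f u ≤ f u') {c u : ℕ} (hc : c ≤ T)
    (h : jump f c ≤ u) (hu : u ≤ c) : f u = f c := by
  refine le_antisymm (hf _ _ hu hc) (le_trans ?_ (hf _ _ h (hu.trans hc)))
  exact lst_holds (p := fun u => f c ≤ f u) (Nat.lt_succ_of_le (jump_le f c))

theorem payment_eq_of_const {c c' : ℕ} (h : c ≤ c') (hconst : ∀ u, c ≤ u → u ≤ c' → f u = f c') :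
    payment v f c' = payment v f c := by
  obtain ⟨k, rfl⟩ := Nat.exists_eq_add_of_le h
  unfold payment
  rw [Finset.sum_range_add, add_eq_left]
  refine Finset.sum_eq_zero fun u hu => ?_
  have := Finset.mem_range.mp hu
  rw [hconst (c + u) (by omega) (by omega), hconst (c + u + 1) (by omega) (by omega), sub_self]

/-- Summands vanish where the outcome is constant, so only the step into the current block of types
counts. -/
theorem payment_eq_jumpTerm_add (hf : ∀ u u', u ≤ u' → u' ≤ T → f u ≤ f u') {c : ℕ} (hc : c ≤ T) :
    payment v f c = jumpTerm v f c + payment v f (prev f c) := by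
  rw [payment_eq_of_const (jump_le f c) fun u h1 h2 => eq_of_jump_le (u := u) hf hc h1 h2]
  unfold jumpTerm prev
  split_ifs with h
  · simp [h, payment]
  · obtain ⟨k, hk⟩ := Nat.exists_eq_succ_of_ne_zero h
    rw [hk, payment, Finset.sum_range_succ, add_comm]
    rfl

theorem prev_le (f : ℕ → ℕ) (c : ℕ) : prev f c ≤ c :=
  (Nat.sub_le _ _).trans (jump_le f c)

theorem iterate_prev_le (f : ℕ → ℕ) (T k : ℕ) : (prev f)^[k] T ≤ T := by
  induction k with
  | zero => rfl
  | succ k ih => rw [Function.iterate_succ_apply']; exact (prev_le f _).trans ih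

theorem payment_eq_sum (hf : ∀ u u', u ≤ u' → u' ≤ T → f u ≤ f u') {M : ℕ}
    (hM : ((Finset.range (T + 1)).image f).card ≤ M) :
    payment v f T = ∑ k ∈ Finset.range M, jumpTerm v f ((prev f)^[k] T) := by
  have h1 : ∀ k, payment v f T = (∑ j ∈ Finset.range k, jumpTerm v f ((prev f)^[j] T)) +
      payment v f ((prev f)^[k] T) := by
    intro k
    induction k with
    | zero => simp
    | succ k ih =>
      rw [ih, Finset.sum_range_succ, payment_eq_jumpTerm_add hf (iterate_prev_le f T k),
        Function.iterate_succ_apply', add_assoc]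
  -- Each application of `prev` loses an outcome until the lowest block is reached. From then on the
  -- iterates are 0 and their terms are 0, so surplus summands are harmless.
  have h2 : ∀ k, (∀ u ≤ (prev f)^[k] T, f u = f ((prev f)^[k] T)) ∨
      ((Finset.range ((prev f)^[k] T + 1)).image f).card + k ≤
        ((Finset.range (T + 1)).image f).card := by
    intro k
    induction k with
    | zero => exact Or.inr le_rfl
    | succ k ih =>
      rw [Function.iterate_succ_apply']
      have hc := iterate_prev_le f T k
      generalize (prev f)^[k] T = c at *
      by_cases h0 : jump f c = 0
      · left
        intro u hu
        have : prev f c = 0 := by simp [prev, h0]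
        rw [this] at hu ⊢
        rw [Nat.le_zero.mp hu]
      · right
        rcases ih with ih | ih
        · exfalso
          have : jump f c ≤ 0 := lst_le_of (ih 0 (Nat.zero_le _)).ge
          omega
        · refine le_trans ?_ ih
          have : ((Finset.range (prev f c + 1)).image f).card <
              ((Finset.range (c + 1)).image f).card := by
            refine Finset.card_lt_card ((Finset.ssubset_iff_of_subset
              (Finset.image_subset_image (Finset.range_subset_range.mpr
                (Nat.succ_le_succ (prev_le f c))))).mpr
              ⟨f c, Finset.mem_image_of_mem f (by simp), fun h => ?_⟩)
            obtain ⟨u, hu, h⟩ := Finset.mem_image.mp h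
            have hu := Finset.mem_range.mp hu
            exact not_of_lt_lst (p := fun u => f c ≤ f u) (N := c + 1) (k := u)
              (by unfold prev at hu; change u < jump f c; omega) h.ge
          omega
  have h3 : payment v f ((prev f)^[M] T) = 0 := by
    rcases h2 M with h | h
    · rw [payment_eq_of_const (Nat.zero_le _) fun u _ hu => h u hu]; simp [payment]
    · exfalso
      have : 0 < ((Finset.range ((prev f)^[M] T + 1)).image f).card :=
        Finset.card_pos.mpr ⟨f 0, Finset.mem_image_of_mem f (by simp)⟩
      omega
  rw [h1 M, h3, add_zero]

end payment

/-- Deviations over `d` types are chained from adjacent ones. Upwards, the true type values the last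
extra quantity at most at its price; downwards, the higher type values the earlier extra quantities
at least as much as its predecessor does. -/
theorem payment_ic {f : ℕ → ℕ} (hf : ∀ u u', u ≤ u' → u' < I.sz i → f u ≤ f u')
    (hm : ∀ u < I.sz i, f u ≤ I.m) {c : ℕ} (d : ℕ) (hc : c + d < I.sz i) :
    I.ev i c (f (c + d)) - payment (I.ev i) f (c + d) ≤ I.ev i c (f c) - payment (I.ev i) f c ∧
    I.ev i (c + d) (f c) - payment (I.ev i) f c ≤
      I.ev i (c + d) (f (c + d)) - payment (I.ev i) f (c + d) := by
  induction d with
  | zero => simp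
  | succ d ih =>
    obtain ⟨h1, h2⟩ := ih (by omega)
    rw [← add_assoc] at *
    have e : payment (I.ev i) f (c + d + 1) = payment (I.ev i) f (c + d) +
        (I.ev i (c + d + 1) (f (c + d + 1)) - I.ev i (c + d + 1) (f (c + d))) := by
      unfold payment; rw [Finset.sum_range_succ]
    have m1 := hf (c + d) (c + d + 1) (by omega) hc
    have m2 := hf c (c + d) (by omega) (by omega)
    have s1 := ev_sub_le (t := c) (by omega) hc m1 (hm _ hc)
    have s2 := ev_sub_le (t := c + d) (by omega) hc m2 (hm _ (by omega))
    rw [e]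
    constructor <;> linarith

variable (I)

/-- The outcome of player `i` as a function of his type. -/
def share (t : ℕ → ℕ) (i u : ℕ) : ℕ := I.alloc (Function.update t i u) i

/-- The payment of player `i`. -/
def pay (t : ℕ → ℕ) (i : ℕ) : ℚ := payment (I.ev i) (I.share t i) (t i)

variable {I}

theorem Valid.update {t : ℕ → ℕ} (ht : I.Valid t) {u : ℕ} (hu : u < I.sz i) :
    I.Valid (Function.update t i u) := fun k hk => by
  by_cases h : k = i
  · subst h; simpa using hu
  · simpa [h] using ht k hk

theorem share_mono {t : ℕ → ℕ} (ht : I.Valid t) {u u' : ℕ} (h : u ≤ u') (hu : u' < I.sz i) :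
    I.share t i u ≤ I.share t i u' := by
  refine IsOpt.mono (ht.update hu) (lt_n_of_lt_sz hu) (by simpa using h) (fun j hj => ?_)
    (alloc_isOpt _) (alloc_isOpt _)
  simp [hj]

theorem share_le {t : ℕ → ℕ} (hi : i < I.n) (u : ℕ) : I.share t i u ≤ I.m :=
  (alloc_isOpt _).feasible.le hi

/-- Outcomes of lower types are 0 or jumps of these types, which by `pt_congr` are jumps of the
reported type. Its candidates bound the number of outcomes. -/
theorem pay_eq_sum {t : ℕ → ℕ} (ht : I.Valid t) (hi : i < I.n) :
    I.pay t i = ∑ k ∈ Finset.range (I.numCand i (t i)),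
      jumpTerm (I.ev i) (I.share t i) ((prev (I.share t i))^[k] (t i)) := by
  refine payment_eq_sum (fun u u' h hu => share_mono ht h (hu.trans_lt (ht i hi))) ?_
  have : (Finset.range (t i + 1)).image (I.share t i) ⊆
      (Finset.range (I.numCand i (t i))).image (I.cand i (t i)) := by
    intro y hy
    obtain ⟨u, hu, rfl⟩ := Finset.mem_image.mp hy
    have hu := Nat.lt_succ_iff.mp (Finset.mem_range.mp hu)
    rcases (I.alloc_isOpt (Function.update t i u)).candidate i hi with h | ⟨j, hj, h⟩
    · exact Finset.mem_image.mpr ⟨0, by simp [numCand], by rw [share, h]; simp [cand]⟩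
    · simp only [Function.update_self] at hj h
      have hl := Nat.mul_le_mul_left I.grid (lev_mono hu (ht i hi))
      exact Finset.mem_image.mpr ⟨j + 1, by simp only [numCand, Finset.mem_range]; omega, by
        rw [share, h, cand, if_neg (by omega), Nat.add_sub_cancel, pt_congr hu hj]⟩
  refine (Finset.card_le_card this).trans (Finset.card_image_le.trans ?_)
  rw [Finset.card_range]

/-! ### The mechanism -/

variable (I)

/-- The types of a profile as a sequence. -/
def types (t : Profile I.V) (k : ℕ) : ℕ := if h : k < I.n then t ⟨k, h⟩ else 0

variable {I}

theorem types_lt (t : Profile I.V) : I.Valid (I.types t) := fun k hk => by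
  simp [types, sz, hk]

theorem alloc_le (t : Profile I.V) (i : ℕ) (hi : i < I.n) : I.alloc (I.types t) i ≤ I.m :=
  (I.alloc_isOpt _).feasible.le hi

variable (I)

/-- The mechanism computed by the algorithm. -/
def mech : Mechanism I.V where
  alloc t := ⟨fun i => ⟨I.alloc (I.types t) i, Nat.lt_succ_of_le (alloc_le t i i.2)⟩, by
    have := (I.alloc_isOpt (I.types t)).feasible
    rw [Feasible, ← Fin.sum_univ_eq_sum_range] at this
    exact this⟩
  pay t i := I.pay (I.types t) i

variable {I}

theorem welfare_eq (t : Profile I.V) (o : Allocation I.n I.m) :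
    welfare I.V t o = I.wel (I.types t) fun k => if h : k < I.n then (o.1 ⟨k, h⟩ : ℕ) else 0 := by
  unfold welfare wel
  rw [← Fin.sum_univ_eq_sum_range (fun i => I.ev i (I.types t i)
    (if h : i < I.n then (o.1 ⟨i, h⟩ : ℕ) else 0))]
  refine Finset.sum_congr rfl fun i _ => ?_
  simp only [i.2, dif_pos, types, Fin.eta]
  exact (ev_eq i.2 (t i).2 (o.1 i).2).symm

theorem mech_approximates (ha : 0 < I.a) {ε : ℝ} (hε : 1 / (I.a : ℝ) ≤ ε) :
    I.mech.Approximates (1 - ε) := by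
  intro t o
  have ho : I.Feasible fun k => if h : k < I.n then (o.1 ⟨k, h⟩ : ℕ) else 0 := by
    have h := o.2
    unfold Feasible
    rw [← Fin.sum_univ_eq_sum_range (fun k => if h : k < I.n then (o.1 ⟨k, h⟩ : ℕ) else 0)]
    simpa using h
  have h1 := (I.alloc_isOpt (I.types t)).approx (types_lt t) ho
  rw [← welfare_eq] at h1
  have h2 : welfare I.V t (I.mech.alloc t) = I.wel (I.types t) (I.alloc (I.types t)) := by
    rw [welfare_eq]
    refine Finset.sum_congr rfl fun i hi => ?_
    simp [mech, Finset.mem_range.mp hi]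
  rw [← h2] at h1
  have h0 : 0 ≤ welfare I.V t o := by rw [welfare_eq]; exact wel_nonneg
  have h3 : ((1 - 1 / (I.a + 1) : ℚ) : ℝ) * welfare I.V t o ≤ welfare I.V t (I.mech.alloc t) := by
    exact_mod_cast h1
  refine le_trans (mul_le_mul_of_nonneg_right ?_ (by exact_mod_cast h0)) h3
  push_cast
  have ha' : (0 : ℝ) < I.a := by exact_mod_cast ha
  have : 1 / ((I.a : ℝ) + 1) ≤ 1 / I.a := one_div_le_one_div_of_le ha' (by linarith)
  linarith

theorem types_update (t : Profile I.V) (i : Fin I.n) (u : Fin (I.V i).size) :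
    I.types (Function.update t i u) = Function.update (I.types t) i u := by
  funext k
  by_cases h : k = i
  · subst h; simp [types]
  · rw [Function.update_of_ne h]
    unfold types
    split_ifs with hk
    · rw [Function.update_of_ne (fun h' => h (congrArg Fin.val h'))]
    · rfl

theorem mech_incentiveCompatible : I.mech.IncentiveCompatible := by
  intro i t u
  have ht := types_lt t
  have hti : (t i : ℕ) = I.types t i := by simp [types]
  have hu : (u : ℕ) < I.sz i := by simp [sz]
  have hti' := ht i i.2
  -- The outcome and payment functions depend only on the other reports; the own report merely
  -- selects the argument.
  have e : ∀ s : Profile I.V, ∀ h : ∃ w : Fin (I.V i).size, s = Function.update t i w,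
      I.mech.profit i (t i) s = I.ev i (t i) (I.share (I.types t) i (s i)) -
        payment (I.ev i) (I.share (I.types t) i) (s i) := by
    rintro s ⟨w, rfl⟩
    have h1 : ∀ k, I.share (Function.update (I.types t) i w) i k = I.share (I.types t) i k :=
      fun k => by simp [share]
    have h2 : I.types (Function.update t i w) = Function.update (I.types t) i w :=
      types_update t i w
    simp only [Mechanism.profit, mech, pay, h2, Function.update_self, funext h1]
    congr 1
    exact (ev_eq i.2 (t i).2 _).symm
  rw [e _ ⟨u, rfl⟩, e t ⟨t i, by simp⟩]
  simp only [Function.update_self]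
  have hf : ∀ u u', u ≤ u' → u' < I.sz i →
    I.share (I.types t) i u ≤ I.share (I.types t) i u' := fun _ _ h h' => share_mono ht h h'
  have hm : ∀ u < I.sz i, I.share (I.types t) i u ≤ I.m := fun u _ => share_le i.2 u
  rw [hti]
  rcases le_total (u : ℕ) (I.types t i) with h | h
  · obtain ⟨d, hd⟩ := Nat.exists_eq_add_of_le h
    have := (payment_ic hf hm (c := u) d (by omega)).2
    rwa [← hd] at this
  · obtain ⟨d, hd⟩ := Nat.exists_eq_add_of_le h
    have := (payment_ic hf hm (c := I.types t i) d (by omega)).1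
    rwa [← hd] at this

/-! ### The number of types -/

/-- Each type strictly exceeds its predecessor at some quantity. Types for which the same quantity
was chosen have different values there, so quantity, numerator and denominator determine the type.
This keeps the input and the binary searches over types small. -/
theorem size_type_le (ht : t < I.sz i) : t.size ≤ 3 * I.N + 7 := by
  have hcard : I.sz i - 1 ≤ (I.m + 1) * (2 ^ (I.N + 2) * 2 ^ (I.N + 2)) := by
    have h1 : ∀ u, ∃ s, u + 1 < I.sz i → s ≤ I.m ∧ I.ev i u s < I.ev i (u + 1) s := fun u => by
      by_cases h : u + 1 < I.sz i
      · obtain ⟨s, hs⟩ := exists_ev_lt (Nat.lt_succ_self u) h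
        exact ⟨s, fun _ => hs⟩
      · exact ⟨0, fun h' => absurd h' h⟩
    choose s hs using h1
    have hlt : ∀ a : ℕ, ∀ k, k.size ≤ a → k ∈ Finset.range (2 ^ a) := fun a k h =>
      Finset.mem_range.mpr (Nat.size_le.mp h)
    have := Finset.card_le_card_of_injOn (s := Finset.range (I.sz i - 1))
      (t := Finset.range (I.m + 1) ×ˢ (Finset.range (2 ^ (I.N + 2)) ×ˢ
        Finset.range (2 ^ (I.N + 2))))
      (fun u => (s u, (I.ev i (u + 1) (s u)).num.natAbs, (I.ev i (u + 1) (s u)).den)) ?_ ?_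
    · simpa using this
    · intro u hu
      have hu : u + 1 < I.sz i := by have := Finset.mem_range.mp hu; omega
      have hb := I.bits_ev_le i (u + 1) (s u)
      unfold bits at hb
      exact Finset.mem_product.mpr ⟨Finset.mem_range.mpr (Nat.lt_succ_of_le (hs u hu).1),
        Finset.mem_product.mpr ⟨hlt _ _ (by simp only; omega), hlt _ _ (by simp only; omega)⟩⟩
    · have key : ∀ u u', u < u' → u' + 1 < I.sz i → s u = s u' →
          I.ev i (u + 1) (s u) < I.ev i (u' + 1) (s u') := fun u u' h hu' he => by
        have := (hs u' hu').2
        rw [he]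
        exact (ev_mono_type (by omega) (by omega) (hs u' hu').1).trans_lt this
      intro u hu u' hu' he
      have hu : u + 1 < I.sz i := by have := Finset.mem_range.mp hu; omega
      have hu' : u' + 1 < I.sz i := by have := Finset.mem_range.mp hu'; omega
      simp only [Prod.mk.injEq] at he
      obtain ⟨e1, e2, e3⟩ := he
      have e4 : I.ev i (u + 1) (s u) = I.ev i (u' + 1) (s u') := by
        refine Rat.ext ?_ e3
        have n1 := Rat.num_nonneg.mpr (I.ev_nonneg (i := i) (t := u + 1) (s := s u))
        have n2 := Rat.num_nonneg.mpr (I.ev_nonneg (i := i) (t := u' + 1) (s := s u'))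
        omega
      rcases lt_trichotomy u u' with h | h | h
      · exact absurd e4 (key u u' h hu' e1).ne
      · exact h
      · exact absurd e4.symm (key u' u h hu e1.symm).ne
  have h1 : t ≤ (I.m + 1) * (2 ^ (I.N + 2) * 2 ^ (I.N + 2)) := by omega
  refine (Nat.size_le_size h1).trans ((natSize_mul_le _ _).trans ?_)
  have h2 := natSize_add_le I.m 1
  have h4 : (2 ^ (I.N + 2) * 2 ^ (I.N + 2)).size = I.N + 2 + (I.N + 2) + 1 := by
    rw [← pow_add, Nat.size_pow]
  rw [Nat.size_one] at h2
  have h3 : I.m.size ≤ I.N := by unfold N; omega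
  omega

end Inst

/-! ### The algorithm -/

theorem PB.ix {cnt : ι → ℕ} (h : PB ρ cnt) : PB (fun x : Ix cnt => ρ x.c) (fun x => x.k) :=
  (h.comap fun x : Ix cnt => x.c).mono fun x => x.lt.le

theorem Comp.nat_tsub {a b : ι → ℕ} (ha : Comp ρ e (fun c => .num (a c)))
    (hb : Comp ρ e (fun c => .num (b c))) : Comp ρ e (fun c => .num (a c - b c : ℕ)) :=
  (num_ite (nat_le hb ha) (ha.sub hb) (num 0 ha.small_left)).num_congr fun c => by
    split_ifs with h
    · rw [Nat.cast_sub h]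
    · rw [Nat.sub_eq_zero_of_le (by omega)]; rfl

theorem Comp.inv {a : ι → ℚ} (ha : Comp ρ e (fun c => .num (a c))) :
    Comp ρ e (fun c => .num (a c)⁻¹) :=
  ((num 1 ha.small_left).div ha).num_congr fun c => by rw [one_div]

/-- The parameters of the instance can be computed. -/
structure Par (ρ : ι → Inst) (e : ι → Data) : Prop where
  n : Comp ρ e (fun c => .num ((ρ c).n : ℕ))
  m : Comp ρ e (fun c => .num ((ρ c).m : ℕ))
  a : Comp ρ e (fun c => .num ((ρ c).a : ℕ))

theorem pb_n (ρ : ι → Inst) : PB ρ (fun c => (ρ c).n) :=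
  (PB.param ρ).mono fun c => by unfold Inst.N; omega

theorem pb_q (ρ : ι → Inst) : PB ρ (fun c => (ρ c).q) := by
  have ha : PB ρ (fun c => (ρ c).a) := (PB.param ρ).mono fun c => by unfold Inst.N; omega
  exact ((PB.const ρ 4).mul ((pb_n ρ).add (PB.const ρ 1))).mul (ha.add (PB.const ρ 1))

theorem pb_grid (ρ : ι → Inst) : PB ρ (fun c => (ρ c).grid) :=
  ((pb_q ρ).add (PB.const ρ 1)).pow 2

theorem pb_levBound (ρ : ι → Inst) : PB ρ (fun c => (ρ c).levBound) :=
  (pb_q ρ).mul ((((PB.const ρ 2).mul (PB.param ρ)).add (pb_n ρ)).add (PB.const ρ 6))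

theorem pb_lev (ρ : ι → Inst) (i t : ι → ℕ) : PB ρ (fun c => (ρ c).lev (i c) (t c)) :=
  (pb_levBound ρ).mono fun _ => Inst.lev_le

theorem pb_points (ρ : ι → Inst) (i t : ι → ℕ) :
    PB ρ (fun c => (ρ c).grid * (ρ c).lev (i c) (t c)) :=
  (pb_grid ρ).mul (pb_lev ρ i t)

theorem pb_scale (ρ : ι → Inst) (t : ι → ℕ → ℕ) : PB ρ (fun c => (ρ c).scale (t c)) :=
  (pb_levBound ρ).mono fun _ => Finset.sup_le fun _ _ => Inst.lev_le

namespace Par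

variable (P : Par ρ e) {i t l s K L j : ι → ℕ}

include P

theorem lift {r : κ → ι} {e' : κ → Data} (he : Comp (fun x => ρ (r x)) e' (fun x => e (r x))) :
    Par (fun x => ρ (r x)) e' :=
  ⟨he.lift P.n, he.lift P.m, he.lift P.a⟩

theorem nat (k : ℕ) : Comp ρ e (fun _ => .num (k : ℕ)) := .nat k P.n.small_left

theorem num (k : ℚ) : Comp ρ e (fun _ => .num k) := .num k P.n.small_left

theorem q : Comp ρ e (fun c => .num ((ρ c).q : ℕ)) :=
  ((P.nat 4).nat_mul P.n.succ).nat_mul P.a.succ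

theorem grid : Comp ρ e (fun c => .num ((ρ c).grid : ℕ)) :=
  (P.q.succ.nat_mul P.q.succ).nat_congr fun c => by unfold Inst.grid; ring

theorem ev_m (hi : Comp ρ e (fun c => .num (i c))) (ht : Comp ρ e (fun c => .num (t c))) :
    Comp ρ e (fun c => .num ((ρ c).ev (i c) (t c) (ρ c).m)) :=
  Comp.ev hi ht P.m

theorem base : Comp ρ e (fun c => .num (ρ c).base) := by
  refine ((P.num 1).add (Comp.sum (pb_n ρ) P.n fun e' he hk => ?_)).inv
  have P' := P.lift he
  exact (P'.ev_m hk (P'.nat 0)).inv.add (P'.ev_m hk (P'.nat 1)).inv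

theorem x (hj : Comp ρ e (fun c => .num (j c))) (pj : PB ρ j) :
    Comp ρ e (fun c => .num ((ρ c).x (j c))) :=
  P.base.mul (((P.num 1).add ((P.num 1).div P.q)).pow hj pj)

theorem lev (hi : Comp ρ e (fun c => .num (i c))) (ht : Comp ρ e (fun c => .num (t c))) :
    Comp ρ e (fun c => .num ((ρ c).lev (i c) (t c) : ℕ)) := by
  refine Comp.find (p := fun c j => (ρ c).ev (i c) (t c) (ρ c).m < (ρ c).x j) P.n.small_left
    (pb_levBound ρ) (fun c => ⟨_, le_rfl, Inst.ev_lt_x_levBound⟩) fun e' he hk => ?_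
  exact ((P.lift he).ev_m (he.lift hi) (he.lift ht)).lt
    ((P.lift he).x hk ((pb_levBound ρ).add (PB.const ρ 1)).ix)

theorem first (hv : ∀ c, t c < (ρ c).sz (i c)) (hi : Comp ρ e (fun c => .num (i c)))
    (ht : Comp ρ e (fun c => .num (t c))) (hl : Comp ρ e (fun c => .num (l c))) (pl : PB ρ l) :
    Comp ρ e (fun c => .num ((ρ c).first (i c) (t c) (l c) : ℕ)) := by
  refine Comp.least (p := fun c u => (ρ c).x (l c) ≤ (ρ c).ev (i c) u (ρ c).m) ht.succ
    (fun c u u' h hu hp => hp.trans (Inst.ev_mono_type h ?_ le_rfl)) fun e' he hk => ?_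
  · have := hv c; omega
  · exact (he.lift (P.x hl pl)).le ((P.lift he).ev_m (he.lift hi) hk)

theorem rep (hv : ∀ c, t c < (ρ c).sz (i c)) (hi : Comp ρ e (fun c => .num (i c)))
    (ht : Comp ρ e (fun c => .num (t c))) (hl : Comp ρ e (fun c => .num (l c))) (pl : PB ρ l) :
    Comp ρ e (fun c => .num ((ρ c).rep (i c) (t c) (l c) : ℕ)) := by
  refine Comp.iter (st := fun c k => .num ((ρ c).rep (i c) (t c) k : ℕ)) pl hl ?_ (P.nat 0) ?_
  · refine (ht.succ.succ.small.comap fun x : Ix (fun c => l c + 1) => x.c).natCast_le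
      (h := fun x : Ix (fun c => l c + 1) => t x.c + 1 + 1) fun x => ?_
    exact (Inst.rep_le_first _ (Nat.le_succ _)).trans (Nat.succ_le_succ (lst_le _ _))
  · intro e' he hk hst
    have hf := (P.lift he).first (fun x => hv x.c) (he.lift hi) (he.lift ht) hk pl.ix
    exact Comp.nat_ite (((P.lift he).ev_m (he.lift hi) hf).lt
      ((P.lift he).x hk.succ (pl.ix.add (PB.const _ 1)))) hf.succ hst

theorem val (hi : Comp ρ e (fun c => .num (i c))) (ht : Comp ρ e (fun c => .num (t c)))
    (hs : Comp ρ e (fun c => .num (s c))) :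
    Comp ρ e (fun c => .num ((ρ c).val (i c) (t c) (s c))) :=
  Comp.num_ite ht.nat_eq_zero (P.num 0) (Comp.ev hi (ht.nat_tsub (P.nat 1)) hs)

theorem inc (hv : ∀ c, t c < (ρ c).sz (i c)) (hi : Comp ρ e (fun c => .num (i c)))
    (ht : Comp ρ e (fun c => .num (t c))) (hl : Comp ρ e (fun c => .num (l c))) (pl : PB ρ l)
    (hs : Comp ρ e (fun c => .num (s c))) :
    Comp ρ e (fun c => .num ((ρ c).inc (i c) (t c) (l c) (s c))) :=
  (P.val hi (P.rep hv hi ht hl.succ (pl.add (PB.const ρ 1))) hs).sub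
    (P.val hi (P.rep hv hi ht hl pl) hs)

theorem del (hl : Comp ρ e (fun c => .num (l c))) (pl : PB ρ l) :
    Comp ρ e (fun c => .num ((ρ c).del (l c))) :=
  (P.x hl pl).div (P.q.mul (P.q.add (P.num 1)))

theorem pow (k : ℕ) {a : ι → ℚ} (ha : Comp ρ e (fun c => .num (a c))) :
    Comp ρ e (fun c => .num (a c ^ k)) :=
  ha.pow (P.nat k) (PB.const ρ k)

theorem gam (hl : Comp ρ e (fun c => .num (l c))) (pl : PB ρ l) :
    Comp ρ e (fun c => .num ((ρ c).gam (l c))) :=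
  (P.x hl pl).div ((P.pow 3 (P.q.add (P.num 1))).mul (hl.add ((P.num 2).mul P.q)))

theorem eta (hl : Comp ρ e (fun c => .num (l c))) (pl : PB ρ l) :
    Comp ρ e (fun c => .num ((ρ c).eta (l c))) :=
  (P.x hl pl).div ((P.pow 7 (P.q.add (P.num 1))).mul (P.pow 2 (hl.add ((P.num 2).mul P.q))))

theorem wt (hK : Comp ρ e (fun c => .num (K c))) (pK : PB ρ K)
    (hl : Comp ρ e (fun c => .num (l c))) (pl : PB ρ l)
    (hL : Comp ρ e (fun c => .num (L c))) (pL : PB ρ L) :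
    Comp ρ e (fun c => .num ((ρ c).wt (K c) (l c) (L c) : ℕ)) :=
  (((P.del hl pl).add (P.gam hL pL)).div (P.eta hK pK)).nat_floor fun c => by
    have := (ρ c).del_pos (l := l c)
    have := (ρ c).gam_pos (L := L c)
    have := (ρ c).eta_pos (K := K c)
    positivity

theorem pos (hv : ∀ c, t c < (ρ c).sz (i c)) (hll : ∀ c, l c < (ρ c).lev (i c) (t c))
    (hi : Comp ρ e (fun c => .num (i c)))
    (ht : Comp ρ e (fun c => .num (t c))) (hl : Comp ρ e (fun c => .num (l c))) (pl : PB ρ l)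
    (hj : Comp ρ e (fun c => .num (j c))) :
    Comp ρ e (fun c => .num ((ρ c).pos (i c) (t c) (l c) (j c) : ℕ)) := by
  refine Comp.least (N := fun c => (ρ c).m + 1)
    (p := fun c s => (j c + 1) * (ρ c).del (l c) ≤ (ρ c).inc (i c) (t c) (l c) s)
    P.m.succ (fun c s s' h hs hp => hp.trans (Inst.inc_mono (hv c) (hll c) h (by omega)))
    fun e' he hk => ?_
  exact (he.lift ((hj.add (P.num 1)).mul (P.del hl pl))).le
    ((P.lift he).inc (fun x => hv x.c) (he.lift hi) (he.lift ht) (he.lift hl) (pl.comap _) hk)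

theorem pt (hv : ∀ c, t c < (ρ c).sz (i c))
    (hjl : ∀ c, j c < (ρ c).grid * (ρ c).lev (i c) (t c))
    (hi : Comp ρ e (fun c => .num (i c))) (ht : Comp ρ e (fun c => .num (t c)))
    (hj : Comp ρ e (fun c => .num (j c))) :
    Comp ρ e (fun c => .num ((ρ c).pt (i c) (t c) (j c) : ℕ)) := by
  have hl : ∀ c, j c / (ρ c).grid < (ρ c).lev (i c) (t c) :=
    fun c => Nat.div_lt_of_lt_mul (hjl c)
  exact P.pos hv hl hi ht (hj.nat_div P.grid)
    ((pb_lev ρ i t).mono fun c => (hl c).le) (hj.nat_mod P.grid)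

theorem phi (hv : ∀ c, t c < (ρ c).sz (i c)) (hK : Comp ρ e (fun c => .num (K c))) (pK : PB ρ K)
    (hi : Comp ρ e (fun c => .num (i c))) (ht : Comp ρ e (fun c => .num (t c)))
    (hs : Comp ρ e (fun c => .num (s c))) :
    Comp ρ e (fun c => .num ((ρ c).phi (K c) (i c) (t c) (s c) : ℕ)) := by
  refine Comp.nat_sum (pb_points ρ i t) (P.grid.nat_mul (P.lev hi ht)) fun e' he hk => ?_
  have P' := P.lift he
  have hL := P.lev hi ht
  refine Comp.nat_ite ((P'.pt (fun x => hv x.c) (fun x => x.lt) (he.lift hi) (he.lift ht)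
    hk).nat_le (he.lift hs)) ?_ (P'.nat 0)
  exact P'.wt (he.lift hK) (pK.comap _) (hk.nat_div P'.grid)
    ((pb_points ρ i t).ix.mono fun x => Nat.div_le_self _ _) (he.lift hL) ((pb_lev ρ i t).comap _)

theorem cand (hv : ∀ c, t c < (ρ c).sz (i c)) (hj : ∀ c, j c < (ρ c).numCand (i c) (t c))
    (hi : Comp ρ e (fun c => .num (i c))) (ht : Comp ρ e (fun c => .num (t c)))
    (hjc : Comp ρ e (fun c => .num (j c))) :
    Comp ρ e (fun c => .num ((ρ c).cand (i c) (t c) (j c) : ℕ)) := by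
  -- The jump with index `j - 1` is known to be in range only in the branch `j ≠ 0`, so `ite` would
  -- not do.
  refine (Comp.cond (b := fun c => decide (j c = 0))
    (f := fun _ => .num ((0 : ℕ) : ℚ)) (g := fun c => .num ((ρ c).pt (i c) (t c) (j c - 1) : ℕ))
    hjc.nat_eq_zero ((P.nat 0).comap _) ?_).congr fun c => ?_
  · have hr : Comp (fun c : {c // decide (j c = 0) = false} => ρ c) (fun c => e c)
      (fun c => e c) := (Comp.refl P.n.small_left).comap _
    refine (P.lift hr).pt (fun c => hv c) (fun c => ?_) (hr.lift hi) (hr.lift ht)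
      ((hr.lift hjc).nat_tsub ((P.lift hr).nat 1))
    have h1 := hj c
    have h2 : j c ≠ 0 := by simpa using c.2
    unfold Inst.numCand at h1
    omega
  · unfold Inst.cand
    by_cases h : j c = 0 <;> simp [h]

end Par

theorem pb_numCand (ρ : ι → Inst) (i t : ι → ℕ) : PB ρ (fun c => (ρ c).numCand (i c) (t c)) :=
  (pb_points ρ i t).add (PB.const ρ 1)

/-- The parameters of the instance and a profile of types can be computed. -/
structure Env (ρ : ι → Inst) (e : ι → Data) (t : ι → ℕ → ℕ) : Prop extends Par ρ e where
  types : Comp ρ e (fun c => tab (ρ c).n fun k => .num (t c k : ℕ))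
  valid : ∀ c, (ρ c).Valid (t c)

namespace Inst

variable {I : Inst}

/-- Measured in the unit `eta K`, weights are polynomially bounded, and with them the size of the
table of the dynamic program. -/
theorem wt_le {K l L : ℕ} (hl : l ≤ K) (hL : L ≤ K) :
    I.wt K l L ≤ 2 * ((I.q + 1) ^ 7 * (K + 2 * I.q) ^ 2) := by
  have hq := I.q_cast_pos
  have hq1 : (1 : ℚ) ≤ I.q := by exact_mod_cast I.q_pos
  have hx := I.x_pos K
  have h1 : I.del l ≤ I.x K := by
    refine (div_le_self (I.x_pos l).le ?_).trans (I.x_strictMono.monotone hl)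
    nlinarith
  have h2 : I.gam L ≤ I.x K := (I.gam_mono hL).trans
    (I.gam_le.trans (div_le_self hx.le (by linarith)))
  refine Nat.floor_le_of_le ?_
  rw [div_le_iff₀ I.eta_pos]
  have hK : (0 : ℚ) ≤ K := Nat.cast_nonneg K
  have h3 : (2 * ((I.q + 1) ^ 7 * (K + 2 * I.q) ^ 2) : ℚ) * I.eta K = 2 * I.x K := by
    unfold eta; field_simp
  push_cast
  rw [h3]
  linarith

theorem phi_le {K i t s : ℕ} (hK : I.lev i t ≤ K) :
    I.phi K i t s ≤ I.grid * I.lev i t * (2 * ((I.q + 1) ^ 7 * (K + 2 * I.q) ^ 2)) := by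
  have := Finset.sum_le_card_nsmul (Finset.range (I.grid * I.lev i t))
    (fun j => if I.pt i t j ≤ s then I.wt K (j / I.grid) (I.lev i t) else 0)
    (2 * ((I.q + 1) ^ 7 * (K + 2 * I.q) ^ 2)) fun j hj => ?_
  · simpa [phi] using this
  · have hj : j / I.grid < I.lev i t := Nat.div_lt_of_lt_mul (Finset.mem_range.mp hj)
    split_ifs
    · exact wt_le (by omega) hK
    · exact Nat.zero_le _

end Inst

theorem pb_objBound (ρ : ι → Inst) (t : ι → ℕ → ℕ) : PB ρ (fun c => (ρ c).objBound (t c)) := by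
  refine PB.sum (pb_n ρ) (g := fun c => (ρ c).grid * (ρ c).levBound *
    (2 * (((ρ c).q + 1) ^ 7 * ((ρ c).scale (t c) + 2 * (ρ c).q) ^ 2))) ?_ fun c k hk => ?_
  · exact ((pb_grid ρ).mul (pb_levBound ρ)).mul ((PB.const ρ 2).mul
      ((((pb_q ρ).add (PB.const ρ 1)).pow 7).mul
        (((pb_scale ρ t).add ((PB.const ρ 2).mul (pb_q ρ))).pow 2)))
  · exact (Inst.phi_le (Inst.lev_le_scale (t c) hk)).trans
      (Nat.mul_le_mul_right _ (Nat.mul_le_mul_left _ Inst.lev_le))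

/-! ### Programs for the dynamic program, the allocation and the payments. -/

namespace Env

variable {t : ι → ℕ → ℕ} (E : Env ρ e t) {i u : ι → ℕ}

include E

theorem lift {r : κ → ι} {e' : κ → Data} (he : Comp (fun x => ρ (r x)) e' (fun x => e (r x))) :
    Env (fun x => ρ (r x)) e' (fun x => t (r x)) :=
  { E.toPar.lift he with
    types := he.lift E.types
    valid := fun _ => E.valid _ }

theorem type (hn : ∀ c, i c < (ρ c).n) (hi : Comp ρ e (fun c => .num (i c))) :
    Comp ρ e (fun c => .num (t c (i c) : ℕ)) :=
  Comp.get (g := fun c k => .num (t c k : ℕ)) E.types hi hn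

theorem scale : Comp ρ e (fun c => .num ((ρ c).scale (t c) : ℕ)) := by
  refine Comp.sup (g := fun c i => (ρ c).lev i (t c i)) (pb_n ρ) E.n (pb_levBound ρ)
    (fun _ _ _ => Inst.lev_le) fun e' he hk => ?_
  exact (E.lift he).lev hk ((E.lift he).type (fun x => x.lt) hk)

theorem phi {s : ι → ℕ} (hn : ∀ c, i c < (ρ c).n) (hi : Comp ρ e (fun c => .num (i c)))
    (hs : Comp ρ e (fun c => .num (s c))) :
    Comp ρ e (fun c => .num ((ρ c).phi ((ρ c).scale (t c)) (i c) (t c (i c)) (s c) : ℕ)) :=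
  E.toPar.phi (fun c => E.valid c _ (hn c)) E.scale (pb_scale ρ t) hi (E.type hn hi) hs

theorem objBound : Comp ρ e (fun c => .num ((ρ c).objBound (t c) : ℕ)) := by
  refine Comp.nat_sum (pb_n ρ) E.n fun e' he hk => ?_
  exact (E.lift he).phi (fun x => x.lt) hk (E.lift he).m

theorem top : Comp ρ e (fun c => .num ((ρ c).top : ℕ)) :=
  E.m.succ.nat_mul ((E.m.nat_add (E.nat 2)).nat_pow E.n (pb_n ρ))

theorem relax {D : ι → ℕ → ℕ} {v j : ι → ℕ} (hn : ∀ c, i c < (ρ c).n)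
    (hj : ∀ c, j c < (ρ c).numCand (i c) (t c (i c)))
    (hvb : ∀ c, v c < (ρ c).objBound (t c) + 1)
    (hD : Comp ρ e (fun c => tab ((ρ c).objBound (t c) + 1) fun v => .num (D c v : ℕ)))
    (hi : Comp ρ e (fun c => .num (i c))) (hv : Comp ρ e (fun c => .num (v c)))
    (hjc : Comp ρ e (fun c => .num (j c))) :
    Comp ρ e (fun c => .num ((ρ c).relax ((ρ c).scale (t c)) (t c) (i c) (D c) (v c) (j c) : ℕ)) := by
  have hcand := E.cand (fun c => E.valid c _ (hn c)) hj hi (E.type hn hi) hjc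
  have hphi := E.phi hn hi hcand
  have hB := E.m.nat_add (E.nat 2)
  have pi : PB ρ i := (pb_n ρ).mono fun c => (hn c).le
  refine Comp.nat_ite (hphi.nat_le hv) (Comp.nat_add ?_ (hcand.nat_mul
    ((hB.nat_pow E.n (pb_n ρ)).nat_add (hB.nat_pow hi pi)))) E.top
  exact Comp.get (g := fun c v => .num (D c v : ℕ)) hD (hv.nat_tsub hphi) fun c => by
    have := hvb c; omega

theorem dpTable : Comp ρ e (fun c => tab ((ρ c).objBound (t c) + 1)
    fun v => .num ((ρ c).dp ((ρ c).scale (t c)) (t c) (ρ c).n v : ℕ)) := by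
  have pV : PB ρ (fun c => (ρ c).objBound (t c) + 1) := (pb_objBound ρ t).add (PB.const ρ 1)
  refine Comp.iter (st := fun c i => tab ((ρ c).objBound (t c) + 1)
    fun v => .num ((ρ c).dp ((ρ c).scale (t c)) (t c) i v : ℕ)) (pb_n ρ) E.n ?_ ?_ ?_
  · refine Small.seg (ρ := fun x : Ix (fun c => (ρ c).n + 1) => ρ x.c)
      (cnt := fun x => (ρ x.c).objBound (t x.c) + 1)
      (g := fun x v => .num ((ρ x.c).dp ((ρ x.c).scale (t x.c)) (t x.c) x.k v : ℕ))
      (pV.comap _) ?_ id (fun _ => 0) _ fun x => (zero_add _).le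
    -- Entries are capped by `top`, which is exponential but has polynomially many bits.
    refine Small.natCast_le (h := fun y => (ρ y.c.c).top) (E.top.small.comap
      fun y : Ix (fun x : Ix (fun c => (ρ c).n + 1) => (ρ x.c).objBound (t x.c) + 1) => y.c.c)
      fun y => Inst.dp_le_top _ _ _ _
  · exact Comp.tab pV E.objBound.succ fun e' he hk =>
      Comp.nat_ite hk.nat_eq_zero ((E.lift he).nat 0) (E.lift he).top
  · intro e' he hk hst
    have E' := E.lift he
    refine Comp.tab (pV.comap _) E'.objBound.succ fun e'' he' hv => ?_
    have E'' := E'.lift he'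
    have hi := he'.lift hk
    have ht := E''.type (i := fun y => y.c.k) (fun y => y.c.lt) hi
    refine Comp.iter (cnt := fun y : Ix (fun x : Ix (fun c => (ρ c).n) =>
        (ρ x.c).objBound (t x.c) + 1) => (ρ y.c.c).numCand y.c.k (t y.c.c y.c.k))
      (st := fun y j => .num (Inst.minUpTo (ρ y.c.c).top
        ((ρ y.c.c).relax ((ρ y.c.c).scale (t y.c.c)) (t y.c.c) y.c.k
        ((ρ y.c.c).dp ((ρ y.c.c).scale (t y.c.c)) (t y.c.c) y.c.k) y.k) j : ℕ))
      (pb_numCand _ _ _) (E''.grid.nat_mul (E''.lev hi ht)).succ ?_ E''.top ?_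
    · exact Small.natCast_le (h := fun z => (ρ z.c.c.c).top) (E''.top.small.comap _)
        fun z => Inst.minUpTo_le_left _ _ _
    · intro e3 he3 hj hm
      have hr := (E''.lift he3).relax (i := fun z => z.c.c.k) (v := fun z => z.c.k)
        (j := fun z => z.k) (D := fun z => (ρ z.c.c.c).dp ((ρ z.c.c.c).scale (t z.c.c.c))
          (t z.c.c.c) z.c.c.k) (fun z => z.c.c.lt) (fun z => z.lt) (fun z => z.c.lt)
        (he3.lift (he'.lift hst)) (he3.lift hi) (he3.lift hv) hj
      exact Comp.nat_ite (hr.nat_lt hm) hr hm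

theorem best : Comp ρ e (fun c => .num ((ρ c).best (t c) ((ρ c).objBound (t c) + 1) : ℕ)) := by
  have pV : PB ρ (fun c => (ρ c).objBound (t c) + 1) := (pb_objBound ρ t).add (PB.const ρ 1)
  refine Comp.iter (st := fun c k => .num ((ρ c).best (t c) k : ℕ)) pV E.objBound.succ ?_
    (E.nat 0) ?_
  · refine PB.num ((pV.add (PB.const ρ 1)).ix.mono fun x => ?_)
    exact Inst.best_le _ _
  · intro e' he hk hst
    refine Comp.nat_ite (Comp.nat_lt ?_ (E.lift he).top) hk hst
    exact Comp.get (g := fun x v => .num ((ρ x.c).dp ((ρ x.c).scale (t x.c)) (t x.c) (ρ x.c).n v : ℕ))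
      (E.lift he).dpTable hk fun x => x.lt

theorem alloc (hn : ∀ c, i c < (ρ c).n) (hi : Comp ρ e (fun c => .num (i c))) :
    Comp ρ e (fun c => .num ((ρ c).alloc (t c) (i c) : ℕ)) := by
  have hB := E.m.nat_add (E.nat 2)
  have pi : PB ρ i := (pb_n ρ).mono fun c => (hn c).le
  refine (Comp.nat_div ?_ (hB.nat_pow hi pi)).nat_mod hB
  exact Comp.get (g := fun c v => .num ((ρ c).dp ((ρ c).scale (t c)) (t c) (ρ c).n v : ℕ))
    E.dpTable E.best fun c => Nat.lt_succ_of_le (Inst.best_le_pred _ _)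

theorem update (hu : ∀ c, u c < (ρ c).sz (i c))
    (hi : Comp ρ e (fun c => .num (i c))) (huc : Comp ρ e (fun c => .num (u c))) :
    Env ρ e (fun c => Function.update (t c) (i c) (u c)) :=
  { E.toPar with
    types := by
      refine (Comp.tab (g := fun c k => .num (if k = i c then u c else t c k : ℕ)) (pb_n ρ) E.n
        fun e' he hk => ?_).congr fun c => tab_congr fun k _ => ?_
      · exact Comp.nat_ite (hk.nat_eq (he.lift hi)) (he.lift huc)
          ((E.lift he).type (fun x => x.lt) hk)
      · rw [Function.update_apply]
    valid := fun c => (E.valid c).update (hu c) }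

theorem share (hn : ∀ c, i c < (ρ c).n) (hu : ∀ c, u c < (ρ c).sz (i c))
    (hi : Comp ρ e (fun c => .num (i c))) (huc : Comp ρ e (fun c => .num (u c))) :
    Comp ρ e (fun c => .num ((ρ c).share (t c) (i c) (u c) : ℕ)) :=
  (E.update hu hi huc).alloc hn hi

theorem jump (hn : ∀ c, i c < (ρ c).n) (hu : ∀ c, u c < (ρ c).sz (i c))
    (hi : Comp ρ e (fun c => .num (i c))) (huc : Comp ρ e (fun c => .num (u c))) :
    Comp ρ e (fun c => .num (Inst.jump ((ρ c).share (t c) (i c)) (u c) : ℕ)) := by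
  refine Comp.least (p := fun c w => (ρ c).share (t c) (i c) (u c) ≤ (ρ c).share (t c) (i c) w)
    huc.succ (fun c w w' h hw hp => hp.trans (Inst.share_mono (E.valid c) h ?_)) fun e' he hk => ?_
  · have := hu c; omega
  · refine (he.lift (E.share hn hu hi huc)).nat_le
      ((E.lift he).share (fun x => hn x.c) (fun x => ?_) (he.lift hi) hk)
    have := x.lt; have := hu x.c; omega

theorem jumpTerm (hn : ∀ c, i c < (ρ c).n) (hu : ∀ c, u c < (ρ c).sz (i c))
    (hi : Comp ρ e (fun c => .num (i c))) (huc : Comp ρ e (fun c => .num (u c))) :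
    Comp ρ e (fun c => .num
      (Inst.jumpTerm ((ρ c).ev (i c)) ((ρ c).share (t c) (i c)) (u c))) := by
  have hj := E.jump hn hu hi huc
  have hju : ∀ c, Inst.jump ((ρ c).share (t c) (i c)) (u c) < (ρ c).sz (i c) :=
    fun c => (Inst.jump_le _ _).trans_lt (hu c)
  have hp : Comp ρ e (fun c => .num (Inst.prev ((ρ c).share (t c) (i c)) (u c) : ℕ)) :=
    hj.nat_tsub (E.nat 1)
  have hpu : ∀ c, Inst.prev ((ρ c).share (t c) (i c)) (u c) < (ρ c).sz (i c) :=
    fun c => (Inst.prev_le _ _).trans_lt (hu c)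
  exact Comp.num_ite hj.nat_eq_zero (E.num 0) ((Comp.ev hi hj (E.share hn hju hi hj)).sub
    (Comp.ev hi hj (E.share hn hpu hi hp)))

theorem pay (hn : ∀ c, i c < (ρ c).n) (hi : Comp ρ e (fun c => .num (i c))) :
    Comp ρ e (fun c => .num ((ρ c).pay (t c) (i c))) := by
  have ht := E.type hn hi
  have hv : ∀ c, t c (i c) < (ρ c).sz (i c) := fun c => E.valid c _ (hn c)
  have hit : ∀ c k, (Inst.prev ((ρ c).share (t c) (i c)))^[k] (t c (i c)) < (ρ c).sz (i c) :=
    fun c k => (Inst.iterate_prev_le _ _ _).trans_lt (hv c)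
  refine (Comp.sum (g := fun c k => Inst.jumpTerm ((ρ c).ev (i c)) ((ρ c).share (t c) (i c))
    ((Inst.prev ((ρ c).share (t c) (i c)))^[k] (t c (i c))))
    (pb_numCand ρ i fun c => t c (i c)) (E.grid.nat_mul (E.lev hi ht)).succ
    fun e' he hk => ?_).num_congr fun c => (Inst.pay_eq_sum (E.valid c) (hn c)).symm
  refine (E.lift he).jumpTerm (fun x => hn x.c) (fun x => hit x.c x.k) (he.lift hi) ?_
  -- Every summand recomputes its iterate from the reported type; each application of `prev` is a
  -- binary search that reruns the allocation for other reports.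
  refine Comp.iter (cnt := fun x : Ix fun c => (ρ c).numCand (i c) (t c (i c)) => x.k)
    (st := fun x k => .num
    ((Inst.prev ((ρ x.c).share (t x.c) (i x.c)))^[k] (t x.c (i x.c)) : ℕ))
    (pb_numCand ρ i fun c => t c (i c)).ix hk ?_ (he.lift ht) ?_
  · exact Small.natCast_le (h := fun y => t y.c.c (i y.c.c)) (ht.small.comap _)
      fun y => Inst.iterate_prev_le _ _ _
  · intro e'' he' hk' hst
    have := ((E.lift he).lift he').jump (i := fun y => i y.c.c) (fun y => hn y.c.c)
      (fun y => hit y.c.c y.k) (he'.lift (he.lift hi)) hst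
    refine (this.nat_tsub (((E.lift he).lift he').nat 1)).nat_congr fun y => ?_
    rw [Function.iterate_succ_apply']
    rfl

theorem outcome : Comp ρ e (fun c => tab (ρ c).n fun k =>
    .pair (.num ((ρ c).alloc (t c) k : ℕ)) (.num ((ρ c).pay (t c) k))) :=
  Comp.tab (pb_n ρ) E.n fun _ he hk =>
    ((E.lift he).alloc (fun x => x.lt) hk).pair ((E.lift he).pay (fun x => x.lt) hk)

end Env

/-! ### Input and output -/

theorem ofList_ofFn (n : ℕ) (g : ℕ → Data) :
    Data.ofList (List.ofFn fun i : Fin n => g i) = tab n g := by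
  unfold tab seg
  rw [← List.range_eq_range', List.ofFn_eq_map, ← List.map_coe_finRange_eq_range, List.map_map]
  rfl

/-- Instances with a profile. -/
abbrev Case : Type := (I : Inst) × Profile I.V

theorem comp_mech : Comp (fun c : Case => c.1) (fun c => input c.1.a c.2)
    (fun c => output c.1.mech c.2) := by
  have hin : ∀ c : Case, input c.1.a c.2 = .pair (.num (c.1.a : ℕ)) (.pair (.num (c.1.m : ℕ))
      (tab c.1.n fun k => .num (c.1.types c.2 k : ℕ))) := fun c => by
    rw [input, ← ofList_ofFn]
    simp [Inst.types]
  have ha : PB (fun c : Case => c.1) (fun c => c.1.a) :=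
    (PB.param _).mono fun c => by unfold Inst.N; omega
  have hm : PB (fun c : Case => c.1) (fun c => c.1.m.size) :=
    (PB.param _).mono fun c => by unfold Inst.N; omega
  have ht : Small (fun x : Ix (fun c : Case => c.1.n) => x.c.1)
      (fun x => .num (x.c.1.types x.c.2 x.k : ℕ)) :=
    Small.natCast ((((PB.const _ 3).mul (PB.param _)).add (PB.const _ 7)).mono fun x =>
      Inst.size_type_le (Inst.types_lt x.c.2 x.k x.lt))
  have hl : Small (fun c : Case => c.1) (fun c => tab c.1.n fun k => .num (c.1.types c.2 k : ℕ)) :=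
    Small.seg (ρ := fun c : Case => c.1) (g := fun c k => .num (c.1.types c.2 k : ℕ)) (pb_n _) ht
      (fun c => c) (fun _ => 0) (fun c => c.1.n) fun _ => (zero_add _).le
  have hs : Small (fun c : Case => c.1) (fun c => input c.1.a c.2) := by
    simp only [hin]
    exact ha.num.pair ((Small.natCast hm).pair hl)
  have h0 := (Comp.refl hs).congr hin
  have E : Env (fun c : Case => c.1) (fun c => input c.1.a c.2) (fun c => c.1.types c.2) :=
    -- The number of players is not part of the input and is read off as the length of the list.
    { n := h0.snd.snd.length
      m := h0.snd.fst
      a := h0.fst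
      types := h0.snd.snd
      valid := fun c => Inst.types_lt c.2 }
  refine E.outcome.congr fun c => ?_
  rw [← ofList_ofFn]
  rfl

end MultiUnit

end

/-! ### From the size parameter to the polynomial of the statement. -/

theorem mainTheorem1 :
    ∃ (P : MultiUnit.Prog) (p : MvPolynomial (Fin 4) ℝ),
      ∀ ε : ℝ, 0 < ε → ∀ (n m : ℕ) (V : Fin n → MultiUnit.Domain m),
        (∀ i, (V i).SingleCrossing) →
        ∃ M : MultiUnit.Mechanism V,
          M.IncentiveCompatible ∧ M.Approximates (1 - ε) ∧
          ∀ t : MultiUnit.Profile V, ∃ T Q : ℕ,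
            MultiUnit.Runs (MultiUnit.oracle V) P
              (MultiUnit.input ⌈1 / ε⌉₊ t) (MultiUnit.output M t) T Q ∧
            (T : ℝ) ≤ MvPolynomial.eval
              ![(n : ℝ), 1 / ε, Real.logb 2 m, (MultiUnit.maxBits V : ℝ)] p ∧
            (Q : ℝ) ≤ MvPolynomial.eval
              ![(n : ℝ), 1 / ε, Real.logb 2 m, (MultiUnit.maxBits V : ℝ)] p := by
  obtain ⟨P, k, hP⟩ := MultiUnit.comp_mech
  -- The constant 4 is 2 from the base `N + 2`, 1 for rounding up `1 / ε`, and 1 for the bit length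
  -- of `m` against its logarithm.
  refine ⟨P, (MvPolynomial.X 0 + MvPolynomial.X 1 + MvPolynomial.X 2 + MvPolynomial.X 3 +
    MvPolynomial.C 4) ^ k, fun ε hε n m V hV => ?_⟩
  let I : MultiUnit.Inst := ⟨n, m, ⌈1 / ε⌉₊, V, hV⟩
  have hε' : 0 < 1 / ε := one_div_pos.mpr hε
  have ha : 0 < I.a := Nat.ceil_pos.mpr hε'
  have ha' : 1 / (I.a : ℝ) ≤ ε := by
    rw [one_div_le (by exact_mod_cast ha) hε]
    exact Nat.le_ceil _
  refine ⟨I.mech, MultiUnit.Inst.mech_incentiveCompatible,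
    MultiUnit.Inst.mech_approximates ha ha', fun t => ?_⟩
  obtain ⟨T, Q, hr, hT⟩ := hP ⟨I, t⟩
  have hQ := hr.size_le.2.2
  have hsize : (m.size : ℝ) ≤ Real.logb 2 m + 1 := by
    rcases Nat.eq_zero_or_pos m with rfl | hm
    · simp
    · have h1 : 2 ^ (m.size - 1) ≤ m := by
        by_contra! h
        have := Nat.size_le.mpr h
        have := Nat.size_pos.mpr hm
        omega
      have h2 : ((m.size - 1 : ℕ) : ℝ) ≤ Real.logb 2 m := by
        rw [Real.le_logb_iff_rpow_le (by norm_num) (by exact_mod_cast hm), Real.rpow_natCast]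
        exact_mod_cast h1
      rw [Nat.cast_sub (Nat.size_pos.mpr hm)] at h2
      push_cast at h2
      linarith
  have hceil : ((⌈1 / ε⌉₊ : ℕ) : ℝ) ≤ 1 / ε + 1 := (Nat.ceil_lt_add_one hε'.le).le
  have hN : ((I.N + 2 : ℕ) : ℝ) ≤ n + 1 / ε + Real.logb 2 m + MultiUnit.maxBits V + 4 := by
    have : I.N = n + ⌈1 / ε⌉₊ + m.size + MultiUnit.maxBits V := rfl
    rw [this]
    push_cast
    linarith
  have hTp : (T : ℝ) ≤ (n + 1 / ε + Real.logb 2 m + MultiUnit.maxBits V + 4) ^ k := by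
    refine le_trans ?_ (pow_le_pow_left₀ (Nat.cast_nonneg _) hN k)
    exact_mod_cast hT
  have hev : MvPolynomial.eval ![(n : ℝ), 1 / ε, Real.logb 2 m, (MultiUnit.maxBits V : ℝ)]
      ((MvPolynomial.X 0 + MvPolynomial.X 1 + MvPolynomial.X 2 + MvPolynomial.X 3 +
        MvPolynomial.C 4) ^ k) =
      (n + 1 / ε + Real.logb 2 m + MultiUnit.maxBits V + 4) ^ k := by
    simp
  rw [hev]
  exact ⟨T, Q, hr, hTp, le_trans (by exact_mod_cast hQ) hTp⟩
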